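/- Let $\mathcal X=\mathbb R^k$ ($k\ge 1$) and $\mathcal Z=\mathbb R^l$ be Euclidean spaces and let $Z\mapsto J_Z$ be a linear map of $\mathcal Z$ into the skew endomorphisms of $\mathcal X$ with $J_Z^2=-|Z|^2\,\mathrm{id}$. Let $H=\mathcal X\times\mathcal Z$ be the corresponding Heisenberg-type group, with multiplication $(X,Z)(X',Z')=(X+X',Z+Z'+\frac12[X,X'])$, where $\langle[X,Y],Z\rangle=\langle J_ZX,Y\rangle$, and with the left-invariant metric that is the Euclidean one at the identity; let $\Delta$ be its Laplacian. Let $\Gamma\subset\mathcal Z$ be a full lattice, let $0\ne\gamma\in\mathcal Z$ satisfy $\langle\gamma,v\rangle\in\mathbb Z$ for all $v\in\Gamma$, and put $\mu=\pi|\gamma|$ and $J_\mu=\pi J_\gamma$. Let $D_\mu$ be the directional derivative along the vector field $X\mapsto J_\mu X$, and let $$\lhd_\mu=\Delta_X+2\mathbf i D_\mu-\mu^2|X|^2-4\mu^2 .$$ For $n\in\mathbb N$, $m\in\mathbb Z$ let $\mathtt H^{(n,m)}$ be the space of complex harmonic homogeneous polynomials $H$ of degree $n$ on $\mathcal X$ with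 $D_\mu H=\mathbf i m\mu H$, and let $$(\Diamond_{\mu}f)(\tilde t)=4\tilde tf''(\tilde t)+(2k+4n)f'(\tilde t)-\big(2m\mu+4\mu^2(1+\tfrac14\tilde t)\big)f(\tilde t)$$ (this operator depends on $k,n,m,\mu$). Then the following hold. (0) For every $\psi:\mathcal X\to\mathbb C$ the function $\Psi_\gamma(X,Z)=\psi(X)e^{2\pi\mathbf i\langle\gamma,Z\rangle}$ is invariant under left translations by $\Gamma$, and $\Delta\Psi_\gamma(X,Z)=(\lhd_\mu\psi)(X)\,e^{2\pi\mathbf i\langle\gamma,Z\rangle}$ wherever $\psi$ is $C^2$ near $X$. (1) Let $R>0$, $A,B\in\mathbb R$ and $\lambda\in\mathbb C$. For a function $F$ on the closed ball $\bar B_R\subset\mathcal X$ and $P\in\mathtt H^{(n,m)}$ the radial component of $F$ along $P$ is $F_P(t)=t^{-n/2}\int_{|\omega|=1}F(\sqrt t\,\omega)\overline{P(\omega)}\,d\omega$. Let $E_\lambda$ be the space of all $F\in C^2(\bar B_R)$ with $\lhd_\mu F=\lambda F$ in $B_R$ all of whose radial components satisfy the boundary condition $AF_P'(R^2)+BF_P(R^2)=0$.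 Let $E_\lambda^{(n,m)}$ be the subspace of those $F\in E_\lambda$ for which $\omega\mapsto F(r\omega)$, $|\omega|=1$, is for each $r\in(0,R]$ the restriction of an element of $\mathtt H^{(n,m)}$. Then * $F\in E_\lambda^{(n,m)}$ if and only if $F(X)=f(|X|^2)H(X)$ on $\bar B_R$ for some $H\in\mathtt H^{(n,m)}$ and some $f\in C^2([0,R^2])$ with $\Diamond_\mu f=\lambda f$ on $(0,R^2)$ and $Af'(R^2)+Bf(R^2)=0$; * every $F\in E_\lambda$ lies in the $L^2(B_R)$-closure of the sum of the spaces $E_\lambda^{(n,m)}$; * $\mathtt H^{(n,m)}$ is finite-dimensional and, if there is a non-zero such $f$, then $\dim E_\lambda^{(n,m)}=\dim\mathtt H^{(n,m)}$. (2) Over the whole X-space, let $u_{r,n}=L_r^{(k/2+n-1)}$ be the Laguerre polynomial of degree $r$, and put $\nu_{(\mu,r,n,m)}=-((4r+4p+k)\mu+4\mu^2)$ with $p=(m+n)/2$. For all $r,n\in\mathbb N$ and $m\in\mathbb Z$: * a complex polynomial $u$ has degree $r$ and makes $u(\tilde t)e^{-\tilde t/2}$ an eigenfunction of $\Diamond_{1}$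 if and only if $u$ is a non-zero multiple of $u_{r,n}$; * $f_\mu(\tilde t)=u_{r,n}(\mu\tilde t)e^{-\mu\tilde t/2}$ satisfies $\Diamond_\mu f_\mu=\nu_{(\mu,r,n,m)}f_\mu$, and for $H\in\mathtt H^{(n,m)}$ the function $f_\mu(|X|^2)H(X)$ is in $L^2(\mathcal X)$ and $\lhd_\mu(f_\mu(|X|^2)H)=\nu_{(\mu,r,n,m)}f_\mu(|X|^2)H$. Let $T$ be the operator in $L^2(\mathcal X;\mathbb C)$ with $Tu=v$ if and only if $\lhd_\mu u=v$ in the sense of distributions ($u,v\in L^2$). Then the spectrum of $T$ is the set of the numbers $\nu_{(\mu,r,n,m)}$ with $r\in\mathbb N$ and $\mathtt H^{(n,m)}\ne0$. For every $\lambda\in\mathbb C$ the $\lambda$-eigenspace of $T$ is the closed linear span of the functions $f_\mu(|X|^2)H(X)$ with $H\in\mathtt H^{(n,m)}$ and $\nu_{(\mu,r,n,m)}=\lambda$, and all the functions $f_\mu(|X|^2)H(X)$ together have dense linear span in $L^2(\mathcal X)$. Each element $\lambda$ of the spectrum equals $\nu_{(\mu,r,n,m)}$, with $\mathtt H^{(n,m)}\neq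 0$, for infinitely many degrees $n$, and its eigenspace is infinite-dimensional. -/

import Mathlib

open MeasureTheory Set
open scoped InnerProductSpace Topology ContDiff ComplexConjugate ENNReal

noncomputable section

namespace ZCrystal

/-! ### Heisenberg-type groups -/

/-- The data of a Heisenberg-type group with X-space `ℝ^k` and Z-space `ℝ^l`: a linear map
`Z ↦ J_Z` into the skew endomorphisms of the X-space with `J_Z² = -|Z|² id`. -/
structure HTypeData (k l : ℕ) where
  J : EuclideanSpace ℝ (Fin l) →ₗ[ℝ] EuclideanSpace ℝ (Fin k) →ₗ[ℝ] EuclideanSpace ℝ (Fin k)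
  skew : ∀ z x y, ⟪J z x, y⟫_ℝ = -⟪x, J z y⟫_ℝ
  clifford : ∀ z x, J z (J z x) = -(‖z‖ ^ 2) • x

variable {k l : ℕ}

/-- The Lie bracket of two X-vectors, determined by `⟨[X, Y], Z⟩ = ⟨J_Z X, Y⟩`. -/
def HTypeData.bracket (N : HTypeData k l) (x y : EuclideanSpace ℝ (Fin k)) :
    EuclideanSpace ℝ (Fin l) :=
  WithLp.toLp 2 fun α => ⟪N.J (EuclideanSpace.single α 1) x, y⟫_ℝ

/-- The group multiplication `(X, Z)(X', Z') = (X + X', Z + Z' + ½[X, X'])`. -/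
def HTypeData.mul (N : HTypeData k l)
    (p q : EuclideanSpace ℝ (Fin k) × EuclideanSpace ℝ (Fin l)) :
    EuclideanSpace ℝ (Fin k) × EuclideanSpace ℝ (Fin l) :=
  (p.1 + q.1, p.2 + q.2 + (1 / 2 : ℝ) • N.bracket p.1 q.1)

/-- The Laplacian of the left-invariant metric: the sum of the squares of the left-invariant
vector fields extending an orthonormal basis of the Lie algebra. (The covariant derivative of each
of these fields along itself vanishes.) The integral curve through `p` of the left-invariant
field extending `V` is `t ↦ p · (tV)`. -/
def HTypeData.laplacian (N : HTypeData k l)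
    (Ψ : EuclideanSpace ℝ (Fin k) × EuclideanSpace ℝ (Fin l) → ℂ)
    (p : EuclideanSpace ℝ (Fin k) × EuclideanSpace ℝ (Fin l)) : ℂ :=
  ∑ i : Fin k,
      iteratedDeriv 2 (fun t : ℝ => Ψ (N.mul p (t • EuclideanSpace.single i 1, 0))) 0
    + ∑ α : Fin l,
      iteratedDeriv 2 (fun t : ℝ => Ψ (N.mul p (0, t • EuclideanSpace.single α 1))) 0

/-- The function `Ψ_γ(X, Z) = ψ(X) e^{2πi⟨γ, Z⟩}`. -/
def waveFn (γ : EuclideanSpace ℝ (Fin l)) (ψ : EuclideanSpace ℝ (Fin k) → ℂ)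
    (p : EuclideanSpace ℝ (Fin k) × EuclideanSpace ℝ (Fin l)) : ℂ :=
  ψ p.1 * Complex.exp (2 * Real.pi * Complex.I * (⟪γ, p.2⟫_ℝ : ℝ))

/-- The endomorphism `J_μ = π J_γ`, which satisfies `J_μ² = -μ² id` with `μ = π|γ|`. -/
def HTypeData.Jmu (N : HTypeData k l) (γ : EuclideanSpace ℝ (Fin l)) :
    EuclideanSpace ℝ (Fin k) →ₗ[ℝ] EuclideanSpace ℝ (Fin k) :=
  Real.pi • N.J γ

/-- The parameter `μ = π|γ|`. -/
def muOf (γ : EuclideanSpace ℝ (Fin l)) : ℝ := Real.pi * ‖γ‖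

/-- The Ginsburg-Landau-Zeeman operator `Δ_X + 2i D_μ - μ²|X|² - 4μ²`, where `D_μ` is the
derivative along the vector field `X ↦ L X` (used with `L = J_μ`). -/
def glz (L : EuclideanSpace ℝ (Fin k) →ₗ[ℝ] EuclideanSpace ℝ (Fin k)) (μ : ℝ)
    (F : EuclideanSpace ℝ (Fin k) → ℂ) (x : EuclideanSpace ℝ (Fin k)) : ℂ :=
  Laplacian.laplacian F x + 2 * Complex.I * fderiv ℝ F x (L x)
    - (μ : ℂ) ^ 2 * (‖x‖ : ℂ) ^ 2 * F x - 4 * (μ : ℂ) ^ 2 * F x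

/-! ### The harmonic polynomials `H^{(n,m)}` -/

/-- The Laplacian on complex polynomials in the coordinates of `ℝ^k`. -/
def polyLaplacian (k : ℕ) : MvPolynomial (Fin k) ℂ →ₗ[ℂ] MvPolynomial (Fin k) ℂ :=
  ∑ i : Fin k, (MvPolynomial.pderiv i).toLinearMap ∘ₗ (MvPolynomial.pderiv i).toLinearMap

/-- The directional derivative along `X ↦ L X` on polynomials: the derivation that sends the
coordinate function `x_i` to the `i`-th coordinate of `L X`. -/
def polyD (L : EuclideanSpace ℝ (Fin k) →ₗ[ℝ] EuclideanSpace ℝ (Fin k)) :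
    MvPolynomial (Fin k) ℂ →ₗ[ℂ] MvPolynomial (Fin k) ℂ :=
  (MvPolynomial.mkDerivation ℂ fun i : Fin k =>
    ∑ j : Fin k, MvPolynomial.C ((L (EuclideanSpace.single j 1) i : ℝ) : ℂ) *
      MvPolynomial.X j).toLinearMap

/-- The space of the complex harmonic homogeneous polynomials `H` of degree `n` with
`D_μ H = i m μ H`. -/
def harmonicSpace (L : EuclideanSpace ℝ (Fin k) →ₗ[ℝ] EuclideanSpace ℝ (Fin k)) (μ : ℝ)
    (n : ℕ) (m : ℤ) : Submodule ℂ (MvPolynomial (Fin k) ℂ) :=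
  MvPolynomial.homogeneousSubmodule (Fin k) ℂ n ⊓ LinearMap.ker (polyLaplacian k) ⊓
    LinearMap.ker (polyD L - (Complex.I * m * μ) • LinearMap.id)

/-- The function on `ℝ^k` defined by a complex polynomial. -/
def polyFun (P : MvPolynomial (Fin k) ℂ) (x : EuclideanSpace ℝ (Fin k)) : ℂ :=
  MvPolynomial.eval (fun i => (x i : ℂ)) P

lemma polyFun_continuous (P : MvPolynomial (Fin k) ℂ) : Continuous (polyFun P) := by
  unfold polyFun
  have h : Continuous fun x : EuclideanSpace ℝ (Fin k) => fun i : Fin k => (x i : ℂ) := by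
    fun_prop
  exact (MvPolynomial.continuous_eval P).comp h

/-! ### The radial operator -/

/-- The ordinary differential operator
`4t f'' + (2k + 4n) f' - (2mμ + 4μ²(1 + t/4)) f`. -/
def radialOp (k : ℕ) (μ : ℝ) (n : ℕ) (m : ℤ) (f : ℝ → ℂ) (t : ℝ) : ℂ :=
  4 * t * iteratedDeriv 2 f t + (2 * k + 4 * n) * deriv f t
    - (2 * m * μ + 4 * μ ^ 2 * (1 + t / 4)) * f t

/-- The eigenfunctions (and zero) of the radial operator on `[0, R²]` with eigenvalue `lam` and
boundary condition `A f'(R²) + B f(R²) = 0`; functions on `[0, R²]` are extended by zero. -/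
def radialEigenspace (k : ℕ) (μ R A B : ℝ) (n : ℕ) (m : ℤ) (lam : ℂ) :
    Submodule ℂ (ℝ → ℂ) where
  carrier := {f | (∀ t ∉ Icc 0 (R ^ 2), f t = 0) ∧ ContDiffOn ℝ 2 f (Icc 0 (R ^ 2)) ∧
    (∀ t ∈ Ioo 0 (R ^ 2), radialOp k μ n m f t = lam * f t) ∧
    ∃ d : ℂ, HasDerivWithinAt f d (Icc 0 (R ^ 2)) (R ^ 2) ∧ A * d + B * f (R ^ 2) = 0}
  zero_mem' := by
    refine ⟨fun _ _ => rfl, contDiffOn_const, fun t _ => ?_, 0, hasDerivWithinAt_const _ _ _, ?_⟩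
    · have h : (0 : ℝ → ℂ) = fun _ => (0 : ℂ) := rfl
      simp [radialOp, h]
    · simp
  add_mem' := by
    rintro f g ⟨f0, f1, f2, df, f3, f4⟩ ⟨g0, g1, g2, dg, g3, g4⟩
    refine ⟨fun t ht => by simp [f0 t ht, g0 t ht], f1.add g1, fun t ht => ?_,
      df + dg, f3.add g3, ?_⟩
    · have hn : Icc 0 (R ^ 2) ∈ 𝓝 t := Icc_mem_nhds ht.1 ht.2
      have cf := f1.contDiffAt hn
      have cg := g1.contDiffAt hn
      have e1 := iteratedDeriv_add cf cg
      have e2 := deriv_add (cf.differentiableAt (by norm_num)) (cg.differentiableAt (by norm_num))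
      have a := f2 t ht
      have b := g2 t ht
      simp only [radialOp] at a b ⊢
      rw [e1, e2]
      simp only [Pi.add_apply]
      linear_combination a + b
    · simp only [Pi.add_apply]
      linear_combination f4 + g4
  smul_mem' := by
    rintro c f ⟨f0, f1, f2, df, f3, f4⟩
    refine ⟨fun t ht => by simp [f0 t ht], f1.const_smul c, fun t ht => ?_,
      c • df, f3.const_smul c, ?_⟩
    · have hn : Icc 0 (R ^ 2) ∈ 𝓝 t := Icc_mem_nhds ht.1 ht.2
      have cf := f1.contDiffAt hn
      have e1 := iteratedDeriv_const_smul cf c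
      have e2 := deriv_const_smul c (cf.differentiableAt (by norm_num))
      have a := f2 t ht
      simp only [radialOp] at a ⊢
      rw [e1, e2]
      simp only [Pi.smul_apply, smul_eq_mul]
      linear_combination c * a
    · simp only [Pi.smul_apply, smul_eq_mul]
      linear_combination c * f4

/-- The function `f(|X|²) H(X)`. -/
def productFn (f : ℝ → ℂ) (P : MvPolynomial (Fin k) ℂ) (x : EuclideanSpace ℝ (Fin k)) : ℂ :=
  f (‖x‖ ^ 2) * polyFun P x

/-! ### The eigenvalue problem over a ball -/

/-- The radial component of `F` with respect to a spherical harmonic `P` of degree `n`: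
`t ↦ t^{-n/2} ∫_{|θ| = 1} F(√t θ) conj(P(θ)) dθ`. For `F = f(|X|²) H(X)` with `H` homogeneous of
degree `n` this is `f(t)` times the inner product of `H` and `P` on the unit sphere. -/
def radialComponent (n : ℕ) (P : MvPolynomial (Fin k) ℂ) (F : EuclideanSpace ℝ (Fin k) → ℂ)
    (t : ℝ) : ℂ :=
  ((Real.sqrt t : ℂ) ^ n)⁻¹ *
    ∫ θ : Metric.sphere (0 : EuclideanSpace ℝ (Fin k)) 1,
      F (Real.sqrt t • (θ : EuclideanSpace ℝ (Fin k))) *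
        conj (polyFun P (θ : EuclideanSpace ℝ (Fin k)))
      ∂((volume : Measure (EuclideanSpace ℝ (Fin k))).toSphere)

lemma radialComponent_integrable {R : ℝ} (hR : 0 ≤ R) (P : MvPolynomial (Fin k) ℂ)
    {F : EuclideanSpace ℝ (Fin k) → ℂ} (hF : ContinuousOn F (Metric.closedBall 0 R)) {t : ℝ}
    (ht : t ∈ Icc 0 (R ^ 2)) :
    Integrable (fun θ : Metric.sphere (0 : EuclideanSpace ℝ (Fin k)) 1 =>
      F (Real.sqrt t • (θ : EuclideanSpace ℝ (Fin k))) *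
        conj (polyFun P (θ : EuclideanSpace ℝ (Fin k))))
      ((volume : Measure (EuclideanSpace ℝ (Fin k))).toSphere) := by
  apply Continuous.integrable_of_hasCompactSupport
  · refine Continuous.mul ?_ ?_
    · refine hF.comp_continuous (by fun_prop) fun θ => ?_
      have : Real.sqrt t ≤ R := Real.sqrt_le_iff.2 ⟨hR, ht.2⟩
      simpa [norm_smul, abs_of_nonneg (Real.sqrt_nonneg t)] using this
    · exact Complex.continuous_conj.comp ((polyFun_continuous P).comp continuous_subtype_val)
  · exact HasCompactSupport.of_compactSpace _

lemma radialComponent_add {R : ℝ} (hR : 0 ≤ R) (n : ℕ) (P : MvPolynomial (Fin k) ℂ)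
    {F G : EuclideanSpace ℝ (Fin k) → ℂ} (hF : ContinuousOn F (Metric.closedBall 0 R))
    (hG : ContinuousOn G (Metric.closedBall 0 R)) {t : ℝ} (ht : t ∈ Icc 0 (R ^ 2)) :
    radialComponent n P (F + G) t = radialComponent n P F t + radialComponent n P G t := by
  simp only [radialComponent, Pi.add_apply, add_mul]
  rw [integral_add (radialComponent_integrable hR P hF ht) (radialComponent_integrable hR P hG ht),
    mul_add]

lemma radialComponent_smul (n : ℕ) (P : MvPolynomial (Fin k) ℂ) (c : ℂ)
    (F : EuclideanSpace ℝ (Fin k) → ℂ) :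
    radialComponent n P (c • F) = c • radialComponent n P F := by
  funext t
  simp only [radialComponent, Pi.smul_apply, smul_eq_mul, mul_assoc]
  rw [integral_const_mul]
  ring

/-- The eigenfunctions (and zero) of the Ginsburg-Landau-Zeeman operator on the ball of radius
`R` with eigenvalue `lam`, all of whose radial components satisfy the boundary condition
`A f'(R²) + B f(R²) = 0`; functions on the closed ball are extended by zero. -/
def ballEigenspace (L : EuclideanSpace ℝ (Fin k) →ₗ[ℝ] EuclideanSpace ℝ (Fin k))
    (μ R A B : ℝ) (lam : ℂ) : Submodule ℂ (EuclideanSpace ℝ (Fin k) → ℂ) where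
  carrier := {F | (∀ x ∉ Metric.closedBall (0 : EuclideanSpace ℝ (Fin k)) R, F x = 0) ∧
    ContDiffOn ℝ 2 F (Metric.closedBall 0 R) ∧
    (∀ x ∈ Metric.ball (0 : EuclideanSpace ℝ (Fin k)) R, glz L μ F x = lam * F x) ∧
    ∀ (n : ℕ) (m : ℤ), ∀ P ∈ harmonicSpace L μ n m,
      ∃ d : ℂ, HasDerivWithinAt (radialComponent n P F) d (Icc 0 (R ^ 2)) (R ^ 2) ∧
        A * d + B * radialComponent n P F (R ^ 2) = 0}
  zero_mem' := by
    refine ⟨fun _ _ => rfl, contDiffOn_const, fun x _ => ?_, fun n m P _ => ⟨0, ?_, ?_⟩⟩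
    · have h : (0 : EuclideanSpace ℝ (Fin k) → ℂ) = fun _ => (0 : ℂ) := rfl
      simp [glz, h]
    · have h : radialComponent n P (0 : EuclideanSpace ℝ (Fin k) → ℂ) = fun _ => 0 := by
        funext t; simp [radialComponent]
      rw [h]; exact hasDerivWithinAt_const _ _ _
    · simp [radialComponent]
  add_mem' := by
    rintro F G ⟨F0, F1, F2, F3⟩ ⟨G0, G1, G2, G3⟩
    refine ⟨fun x hx => by simp [F0 x hx, G0 x hx], F1.add G1, fun x hx => ?_,
      fun n m P hP => ?_⟩
    · have hn : Metric.closedBall (0 : EuclideanSpace ℝ (Fin k)) R ∈ 𝓝 x :=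
        Filter.mem_of_superset (Metric.isOpen_ball.mem_nhds hx) Metric.ball_subset_closedBall
      have cF := F1.contDiffAt hn
      have cG := G1.contDiffAt hn
      have e1 := cF.laplacian_add cG
      have e2 := fderiv_add (cF.differentiableAt (by norm_num)) (cG.differentiableAt (by norm_num))
      have a := F2 x hx
      have b := G2 x hx
      simp only [glz, e1, e2, Pi.add_apply, _root_.add_apply] at a b ⊢
      linear_combination a + b
    · obtain ⟨d, hd, hd'⟩ := F3 n m P hP
      obtain ⟨e, he, he'⟩ := G3 n m P hP
      have hE : ∀ t ∈ Icc 0 (R ^ 2), radialComponent n P (F + G) t =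
          (radialComponent n P F + radialComponent n P G) t := by
        intro t ht
        rcases le_or_gt 0 R with hR | hR
        · exact radialComponent_add hR n P F1.continuousOn G1.continuousOn ht
        · have hF : F = 0 := by
            funext x
            exact F0 x (by simp [Metric.closedBall_eq_empty.2 hR])
          simp [hF, radialComponent]
      have hmem : R ^ 2 ∈ Icc 0 (R ^ 2) := ⟨sq_nonneg R, le_refl _⟩
      refine ⟨d + e, (hd.add he).congr hE (hE _ hmem), ?_⟩
      rw [hE _ hmem, Pi.add_apply]
      linear_combination hd' + he'
  smul_mem' := by
    rintro c F ⟨F0, F1, F2, F3⟩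
    refine ⟨fun x hx => by simp [F0 x hx], F1.const_smul c, fun x hx => ?_, fun n m P hP => ?_⟩
    · have hn : Metric.closedBall (0 : EuclideanSpace ℝ (Fin k)) R ∈ 𝓝 x :=
        Filter.mem_of_superset (Metric.isOpen_ball.mem_nhds hx) Metric.ball_subset_closedBall
      have cF := F1.contDiffAt hn
      have e1 := InnerProductSpace.laplacian_smul c cF
      have e2 := fderiv_const_smul (cF.differentiableAt (by norm_num)) c
      have a := F2 x hx
      simp only [glz, e1, e2, Pi.smul_apply, _root_.smul_apply, smul_eq_mul] at a ⊢
      linear_combination c * a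
    · obtain ⟨d, hd, hd'⟩ := F3 n m P hP
      refine ⟨c • d, ?_, ?_⟩
      · rw [radialComponent_smul]
        exact hd.const_smul c
      · rw [radialComponent_smul, Pi.smul_apply, smul_eq_mul, smul_eq_mul]
        linear_combination c * hd'

/-- The functions whose restriction to each sphere of radius `r ∈ (0, R]` about the origin is,
as a function of the unit vector `θ = X / r`, a spherical harmonic `H^{(n,m)}`. -/
def sector (L : EuclideanSpace ℝ (Fin k) →ₗ[ℝ] EuclideanSpace ℝ (Fin k)) (μ R : ℝ)
    (n : ℕ) (m : ℤ) : Submodule ℂ (EuclideanSpace ℝ (Fin k) → ℂ) where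
  carrier := {F | ∀ r ∈ Ioc 0 R, ∃ P ∈ harmonicSpace L μ n m,
    ∀ θ : EuclideanSpace ℝ (Fin k), ‖θ‖ = 1 → F (r • θ) = polyFun P θ}
  zero_mem' := fun r _ => ⟨0, Submodule.zero_mem _, fun θ _ => by simp [polyFun]⟩
  add_mem' := by
    intro F G hF hG r hr
    obtain ⟨P, hP, h⟩ := hF r hr
    obtain ⟨Q, hQ, h'⟩ := hG r hr
    exact ⟨P + Q, Submodule.add_mem _ hP hQ, fun θ hθ => by
      simp only [Pi.add_apply, h θ hθ, h' θ hθ, polyFun, map_add]⟩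
  smul_mem' := by
    intro c F hF r hr
    obtain ⟨P, hP, h⟩ := hF r hr
    exact ⟨c • P, Submodule.smul_mem _ c hP, fun θ hθ => by
      simp only [Pi.smul_apply, h θ hθ, polyFun, MvPolynomial.smul_eval, smul_eq_mul]⟩

/-! ### The `L²`-theory over the whole X-space -/

/-- The Laguerre polynomial
`L_r^{(a)}(t) = ∑_{i ≤ r} (-1)^i binom(r + a, r - i) t^i / i!` with real parameter `a`, where
`binom(r + a, r - i) = (a + i + 1) ⋯ (a + r) / (r - i)!`. -/
def laguerre (r : ℕ) (a : ℝ) : Polynomial ℂ :=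
  ∑ i ∈ Finset.range (r + 1), Polynomial.monomial i
    ((-1) ^ i * (∏ j ∈ Finset.range (r - i), ((a : ℂ) + i + 1 + j)) /
      ((r - i).factorial * i.factorial))

/-- The number `-((4r + 4p + k)μ + 4μ²)` with `p = (m + n)/2`. -/
def nu (k : ℕ) (μ : ℝ) (r n : ℕ) (m : ℤ) : ℝ :=
  -((4 * r + 4 * (((m : ℝ) + n) / 2) + k) * μ + 4 * μ ^ 2)

/-- The radial function `u(μt) e^{-μt/2}` obtained from a polynomial `u`. -/
def expRadial (μ : ℝ) (u : Polynomial ℂ) (t : ℝ) : ℂ :=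
  u.eval ((μ * t : ℝ) : ℂ) * Real.exp (-(t * μ / 2))

/-- The function `L_r^{(k/2+n-1)}(μ|X|²) e^{-μ|X|²/2} H(X)`. -/
def laguerreFn (μ : ℝ) (r n : ℕ) (P : MvPolynomial (Fin k) ℂ) :
    EuclideanSpace ℝ (Fin k) → ℂ :=
  productFn (expRadial μ (laguerre r ((k : ℝ) / 2 + n - 1))) P

lemma glz_continuous {L : EuclideanSpace ℝ (Fin k) →ₗ[ℝ] EuclideanSpace ℝ (Fin k)} {μ : ℝ}
    {φ : EuclideanSpace ℝ (Fin k) → ℂ} (hφ : ContDiff ℝ ∞ φ) : Continuous (glz L μ φ) := by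
  have hL : Continuous L := L.continuous_of_finiteDimensional
  have h1 : Continuous (Laplacian.laplacian φ) := by
    rw [InnerProductSpace.laplacian_eq_iteratedFDeriv_stdOrthonormalBasis]
    have := hφ.continuous_iteratedFDeriv (m := 2) (by norm_cast)
    fun_prop
  have h2 : Continuous fun x => fderiv ℝ φ x (L x) :=
    (hφ.continuous_fderiv (by simp)).clm_apply hL
  have := hφ.continuous
  unfold glz
  fun_prop

lemma glz_compactSupport {L : EuclideanSpace ℝ (Fin k) →ₗ[ℝ] EuclideanSpace ℝ (Fin k)} {μ : ℝ}
    {φ : EuclideanSpace ℝ (Fin k) → ℂ} (hφ : HasCompactSupport φ) :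
    HasCompactSupport (glz L μ φ) := by
  refine HasCompactSupport.intro' (K := tsupport φ) hφ (isClosed_tsupport φ) fun x hx => ?_
  have h : φ =ᶠ[𝓝 x] fun _ => 0 := notMem_tsupport_iff_eventuallyEq.1 hx
  have h1 : Laplacian.laplacian φ x = 0 := by
    rw [(InnerProductSpace.laplacian_congr_nhds h).eq_of_nhds]
    simp
  simp [glz, h1, h.fderiv_eq, h.eq_of_nhds]

/-- The graph of the operator that the Ginsburg-Landau-Zeeman differential operator `◁` defines in
`L²(ℝ^k; ℂ)`: the pairs `(u, v)` of `L²`-functions with `◁u = v` in the sense of distributions. -/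
def l2Graph (L : EuclideanSpace ℝ (Fin k) →ₗ[ℝ] EuclideanSpace ℝ (Fin k)) (μ : ℝ) :
    Submodule ℂ (Lp ℂ 2 (volume : Measure (EuclideanSpace ℝ (Fin k))) ×
      Lp ℂ 2 (volume : Measure (EuclideanSpace ℝ (Fin k)))) where
  carrier := {p | ∀ φ : EuclideanSpace ℝ (Fin k) → ℂ, ContDiff ℝ ∞ φ → HasCompactSupport φ →
    ∫ x, conj (glz L μ φ x) * p.1 x = ∫ x, conj (φ x) * p.2 x}
  zero_mem' := by
    intro φ _ _
    have h : ∀ ψ : EuclideanSpace ℝ (Fin k) → ℂ,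
        ∫ x, conj (ψ x) * (0 : Lp ℂ 2 (volume : Measure (EuclideanSpace ℝ (Fin k)))) x = 0 := by
      intro ψ
      refine integral_eq_zero_of_ae ?_
      filter_upwards [Lp.coeFn_zero ℂ 2 (volume : Measure (EuclideanSpace ℝ (Fin k)))] with x hx
      rw [hx]
      simp
    simp only [Prod.fst_zero, Prod.snd_zero]
    rw [h, h]
  add_mem' := by
    intro p q hp hq φ h1 h2
    have key : ∀ ψ : EuclideanSpace ℝ (Fin k) → ℂ, Continuous ψ → HasCompactSupport ψ →
        ∀ u v : Lp ℂ 2 (volume : Measure (EuclideanSpace ℝ (Fin k))),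
        ∫ x, conj (ψ x) * (u + v : Lp ℂ 2 volume) x =
          (∫ x, conj (ψ x) * u x) + ∫ x, conj (ψ x) * v x := by
      intro ψ hc hs u v
      have hψ : MemLp (fun x => conj (ψ x)) 2 (volume : Measure (EuclideanSpace ℝ (Fin k))) :=
        (hc.memLp_of_hasCompactSupport hs).star
      have hu : Integrable (fun x => conj (ψ x) * u x) := hψ.integrable_mul (Lp.memLp u)
      have hv : Integrable (fun x => conj (ψ x) * v x) := hψ.integrable_mul (Lp.memLp v)
      rw [← integral_add hu hv]
      refine integral_congr_ae ?_
      filter_upwards [Lp.coeFn_add u v] with x hx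
      simp only [hx, Pi.add_apply, mul_add]
    simp only [Prod.fst_add, Prod.snd_add]
    rw [key _ (glz_continuous h1) (glz_compactSupport h2), key _ h1.continuous h2,
      hp φ h1 h2, hq φ h1 h2]
  smul_mem' := by
    intro c p hp φ h1 h2
    have key : ∀ (ψ : EuclideanSpace ℝ (Fin k) → ℂ)
        (u : Lp ℂ 2 (volume : Measure (EuclideanSpace ℝ (Fin k)))),
        ∫ x, conj (ψ x) * (c • u : Lp ℂ 2 volume) x = c * ∫ x, conj (ψ x) * u x := by
      intro ψ u
      rw [← integral_const_mul]
      refine integral_congr_ae ?_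
      filter_upwards [Lp.coeFn_smul c u] with x hx
      simp only [hx, Pi.smul_apply, smul_eq_mul]
      ring
    simp only [Prod.smul_fst, Prod.smul_snd]
    rw [key, key, hp φ h1 h2]

/-- The eigenspace of the `L²`-operator. -/
def l2Eigenspace (L : EuclideanSpace ℝ (Fin k) →ₗ[ℝ] EuclideanSpace ℝ (Fin k)) (μ : ℝ)
    (lam : ℂ) : Submodule ℂ (Lp ℂ 2 (volume : Measure (EuclideanSpace ℝ (Fin k)))) :=
  (l2Graph L μ).comap (LinearMap.prod LinearMap.id (lam • LinearMap.id))

/-- The spectrum of the `L²`-operator `T`: the `lam` for which `T - lam` has no bounded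
everywhere defined inverse `S`. -/
def l2Spectrum (L : EuclideanSpace ℝ (Fin k) →ₗ[ℝ] EuclideanSpace ℝ (Fin k)) (μ : ℝ) : Set ℂ :=
  {lam | ¬ ∃ S : Lp ℂ 2 (volume : Measure (EuclideanSpace ℝ (Fin k))) →L[ℂ]
      Lp ℂ 2 (volume : Measure (EuclideanSpace ℝ (Fin k))),
    ∀ u w, (u, w + lam • u) ∈ l2Graph L μ ↔ u = S w}

end ZCrystal
end

open ZCrystal

open MeasureTheory Set
open scoped InnerProductSpace Topology ContDiff ComplexConjugate ENNReal

noncomputable section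

namespace ZCrystal

/-! ### Polynomials as functions, and the polynomial forms of Δ and D -/

section

variable {k l : ℕ}

/-! The theorem is separation of variables for a Landau-type operator. Write `L` for `J_μ` and `D`
for the derivative along `x ↦ L x`. Since `L` is skew, `⟨L x, x⟩ = 0`, so `D` kills functions of
`|x|²` and acts on `f(|x|²)H(x)` only through `H`. For `H ∈ H^{(n,m)}` the partial differential
operator therefore reduces to the radial one (`glz_productFn`), and splitting off `e^{-μt/2}` turns
the radial equation into a confluent hypergeometric one, whose polynomial solutions are the Laguerre
polynomials. On the group, moving along an X-direction multiplies `ψ` by a phase with rate `i(L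
x)_i`. The squares of the fields then produce the operator (`laplacian_waveFn`).

The angular theory is algebraic. Integration by parts against a Gaussian makes harmonic polynomials
orthogonal to all polynomials of lower degree. Hence `S ↦ Δ(|x|²S)` is bijective on each homogeneous
degree, and polynomials decompose into products `|x|^{2j}H`. As `D` commutes with `Δ` and kills
`|x|²`, the harmonic factors can be taken with a definite weight `m`
(`mem_span_normSqPoly_mul_harmonic`).

Over a ball, Green's identity with test functions `φ(|x|²)P(x)` shows that the radial components of
an eigenfunction solve the radial equation weakly, hence classically (`radialOp_radialComponent`).
That equation is singular at `0` and has a power series solution `f₁` with `f₁(0) = 1`. The quantity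
`t^{k/2+n}` times the Wronskian with `f₁` is constant. It tends to `0` at the origin because `L² =
-μ²` forces `k ≥ 2`, so every radial component is a multiple of `f₁`. This describes the sector
eigenspaces. For density, polynomials approximate `F` uniformly, and on each sphere the orthogonal
projection of `F` onto finitely many harmonics does at least as well. These projections, taken for
all radii, are a single sum of sector eigenfunctions (`exists_sum_sector_near`).

Over the whole space no general self-adjointness theorem is used. Cut-offs show that the Laguerre
functions may be used as test functions for the distributional operator
(`integral_laguerreFn_of_mem_l2Graph`). A Fourier transform argument shows that polynomials times
the Gaussian are total, hence so are the Laguerre functions. Thus `L²` is the closure of an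
orthogonal sum of eigenspaces and, away from the discrete set of eigenvalues, the resolvent is a
bounded diagonal multiplier. A non-zero `H^{(n,m)}` has `m = 2p - n` with `0 ≤ p ≤ n`, and the
eigenvalue depends only on `r + p`. Every `H^{(n,-n)}` is non-zero, so taking `p = 0` puts every
degree `n` into every level, which gives the infinite multiplicity. -/

lemma polyFun_add (P Q : MvPolynomial (Fin k) ℂ) (x) :
    polyFun (P + Q) x = polyFun P x + polyFun Q x := by simp [polyFun]
lemma polyFun_sub (P Q : MvPolynomial (Fin k) ℂ) (x) :
    polyFun (P - Q) x = polyFun P x - polyFun Q x := by simp [polyFun]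
lemma polyFun_mul (P Q : MvPolynomial (Fin k) ℂ) (x) :
    polyFun (P * Q) x = polyFun P x * polyFun Q x := by simp [polyFun]
lemma polyFun_pow (P : MvPolynomial (Fin k) ℂ) (j : ℕ) (x) :
    polyFun (P ^ j) x = polyFun P x ^ j := by simp [polyFun]
lemma polyFun_smul (c : ℂ) (P : MvPolynomial (Fin k) ℂ) (x) :
    polyFun (c • P) x = c * polyFun P x := by simp [polyFun]
lemma polyFun_C (c : ℂ) (x : EuclideanSpace ℝ (Fin k)) :
    polyFun (MvPolynomial.C c) x = c := by simp [polyFun]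
lemma polyFun_X (i : Fin k) (x : EuclideanSpace ℝ (Fin k)) :
    polyFun (MvPolynomial.X i) x = x i := by simp [polyFun]
lemma polyFun_zero (x : EuclideanSpace ℝ (Fin k)) : polyFun 0 x = 0 := by simp [polyFun]
lemma polyFun_one (x : EuclideanSpace ℝ (Fin k)) : polyFun 1 x = 1 := by simp [polyFun]
lemma polyFun_sum {ι : Type*} (s : Finset ι) (P : ι → MvPolynomial (Fin k) ℂ) (x) :
    polyFun (∑ i ∈ s, P i) x = ∑ i ∈ s, polyFun (P i) x := by simp [polyFun]

lemma polyFun_contDiff (P : MvPolynomial (Fin k) ℂ) : ContDiff ℝ ∞ (polyFun P) := by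
  induction P using MvPolynomial.induction_on with
  | C a =>
    have : polyFun (k := k) (MvPolynomial.C a) = fun _ => a := by ext x; simp [polyFun_C]
    rw [this]; exact contDiff_const
  | add P Q hP hQ =>
    have : polyFun (P + Q) = fun x => polyFun P x + polyFun Q x := by ext x; simp [polyFun_add]
    rw [this]; exact hP.add hQ
  | mul_X P i hP =>
    have : polyFun (P * MvPolynomial.X i) = fun x => polyFun P x * (x i : ℂ) := by
      ext x; simp [polyFun_mul, polyFun_X]
    rw [this]
    refine hP.mul ?_
    exact Complex.ofRealCLM.contDiff.comp (EuclideanSpace.proj (𝕜 := ℝ) i).contDiff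

lemma polyFun_differentiable (P : MvPolynomial (Fin k) ℂ) : Differentiable ℝ (polyFun P) :=
  (polyFun_contDiff P).differentiable (by simp)

lemma fderiv_polyFun (P : MvPolynomial (Fin k) ℂ) (x v : EuclideanSpace ℝ (Fin k)) :
    fderiv ℝ (polyFun P) x v = ∑ i, (v i : ℂ) * polyFun (MvPolynomial.pderiv i P) x := by
  induction P using MvPolynomial.induction_on with
  | C a =>
    have : polyFun (k := k) (MvPolynomial.C a) = fun _ => a := by ext x; simp [polyFun_C]
    rw [this]; simp [polyFun]
  | add P Q hP hQ =>
    have : polyFun (P + Q) = fun x => polyFun P x + polyFun Q x := by ext x; simp [polyFun_add]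
    rw [this, fderiv_fun_add (polyFun_differentiable P x) (polyFun_differentiable Q x)]
    simp [hP, hQ, polyFun_add, mul_add, Finset.sum_add_distrib]
  | mul_X P i hP =>
    have h1 : polyFun (P * MvPolynomial.X i) = fun x => polyFun P x * (x i : ℂ) := by
      ext x; simp [polyFun_mul, polyFun_X]
    have h2 : HasFDerivAt (fun x : EuclideanSpace ℝ (Fin k) => (x i : ℂ))
        (Complex.ofRealCLM.comp (EuclideanSpace.proj (𝕜 := ℝ) i)) x :=
      (Complex.ofRealCLM.comp (EuclideanSpace.proj (𝕜 := ℝ) i)).hasFDerivAt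
    rw [h1, fderiv_fun_mul (polyFun_differentiable P x) h2.differentiableAt, h2.fderiv]
    simp only [_root_.add_apply, _root_.smul_apply, hP,
      ContinuousLinearMap.comp_apply, Complex.ofRealCLM_apply, smul_eq_mul, PiLp.proj_apply,
      Derivation.leibniz, MvPolynomial.pderiv_X, polyFun_add, polyFun_mul, mul_add,
      Finset.sum_add_distrib, polyFun_X]
    congr 1
    · rw [Finset.sum_eq_single i]
      · simp [polyFun_one]; ring
      · intro j _ hj; simp [hj.symm, polyFun_zero]
      · simp
    · rw [Finset.mul_sum]; exact Finset.sum_congr rfl fun j _ => by ring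

/-- The `i`-th coordinate vector. -/
abbrev basisVec (i : Fin k) : EuclideanSpace ℝ (Fin k) := EuclideanSpace.single i 1

lemma fderiv_polyFun_basisVec (P : MvPolynomial (Fin k) ℂ) (x) (i : Fin k) :
    fderiv ℝ (polyFun P) x (basisVec i) = polyFun (MvPolynomial.pderiv i P) x := by
  rw [fderiv_polyFun, Finset.sum_eq_single i] <;> simp +contextual [basisVec]

lemma laplacian_eq_sum_fderiv {f : EuclideanSpace ℝ (Fin k) → ℂ} {x : EuclideanSpace ℝ (Fin k)}
    (hf : ContDiffAt ℝ 2 f x) :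
    Laplacian.laplacian f x =
      ∑ i, fderiv ℝ (fun y => fderiv ℝ f y (basisVec i)) x (basisVec i) := by
  rw [InnerProductSpace.laplacian_eq_iteratedFDeriv_orthonormalBasis f
    (EuclideanSpace.basisFun (Fin k) ℝ)]
  refine Finset.sum_congr rfl fun i _ => ?_
  have h : DifferentiableAt ℝ (fderiv ℝ f) x :=
    (hf.fderiv_right (m := 1) (by norm_num)).differentiableAt (by norm_num)
  rw [iteratedFDeriv_two_apply, fderiv_clm_apply h (by fun_prop)]
  simp

lemma polyLaplacian_apply (P : MvPolynomial (Fin k) ℂ) :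
    polyLaplacian k P = ∑ i, MvPolynomial.pderiv i (MvPolynomial.pderiv i P) := by
  simp [polyLaplacian, LinearMap.sum_apply]

variable (L : EuclideanSpace ℝ (Fin k) →ₗ[ℝ] EuclideanSpace ℝ (Fin k))

/-- The linear polynomial `x ↦ (L x)_i`. -/
def coordPoly (i : Fin k) : MvPolynomial (Fin k) ℂ :=
  ∑ j : Fin k, MvPolynomial.C ((L (EuclideanSpace.single j 1) i : ℝ) : ℂ) * MvPolynomial.X j

lemma eq_sum_basisVec (x : EuclideanSpace ℝ (Fin k)) : x = ∑ j, x j • basisVec j := by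
  conv_lhs => rw [← (EuclideanSpace.basisFun (Fin k) ℝ).sum_repr x]
  simp

lemma map_apply_eq_sum (x : EuclideanSpace ℝ (Fin k)) (i : Fin k) :
    L x i = ∑ j, x j * L (basisVec j) i := by
  conv_lhs => rw [eq_sum_basisVec x]
  simp

lemma polyFun_coordPoly (i : Fin k) (x) : polyFun (coordPoly L i) x = (L x i : ℝ) := by
  rw [map_apply_eq_sum]
  simp [coordPoly, polyFun_sum, polyFun_mul, polyFun_C, polyFun_X, mul_comm]

lemma polyD_mul (P Q : MvPolynomial (Fin k) ℂ) :
    polyD L (P * Q) = P * polyD L Q + Q * polyD L P := by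
  simp [polyD]

lemma polyD_C (c : ℂ) : polyD L (MvPolynomial.C c) = 0 := by
  simp [polyD]

lemma polyD_X (i : Fin k) : polyD L (MvPolynomial.X i) = coordPoly L i := by
  simp [polyD, coordPoly]

lemma polyD_eq_sum (P : MvPolynomial (Fin k) ℂ) :
    polyD L P = ∑ i, coordPoly L i * MvPolynomial.pderiv i P := by
  induction P using MvPolynomial.induction_on with
  | C a => simp [polyD_C]
  | add P Q hP hQ => simp [hP, hQ, mul_add, Finset.sum_add_distrib]
  | mul_X P j hP =>
    rw [polyD_mul, polyD_X, hP]
    simp only [Derivation.leibniz, smul_eq_mul, mul_add, Finset.sum_add_distrib]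
    congr 1
    · rw [Finset.sum_eq_single j]
      · simp; ring
      · intro i _ hi; simp [MvPolynomial.pderiv_X, hi.symm]
      · simp
    · rw [Finset.mul_sum]; exact Finset.sum_congr rfl fun i _ => by ring

lemma fderiv_polyFun_map (P : MvPolynomial (Fin k) ℂ) (x) :
    fderiv ℝ (polyFun P) x (L x) = polyFun (polyD L P) x := by
  simp [fderiv_polyFun, polyD_eq_sum, polyFun_sum, polyFun_mul, polyFun_coordPoly]

/-- The polynomial with complex conjugate coefficients. -/
def polyConj (P : MvPolynomial (Fin k) ℂ) : MvPolynomial (Fin k) ℂ :=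
  MvPolynomial.map (starRingEnd ℂ) P

lemma polyFun_polyConj (P : MvPolynomial (Fin k) ℂ) (x) :
    polyFun (polyConj P) x = conj (polyFun P x) := by
  induction P using MvPolynomial.induction_on with
  | C a => simp [polyConj, polyFun_C]
  | add P Q hP hQ => simp_all [polyConj, polyFun_add]
  | mul_X P j hP => simp_all [polyConj, polyFun_mul, polyFun_X]

/-- The real points form a product of infinite subsets of `ℂ`, and such a product determines a
polynomial. This is what allows polynomial identities to be checked pointwise on `ℝ^k`. -/
lemma polyFun_injective {P Q : MvPolynomial (Fin k) ℂ} (h : ∀ x, polyFun P x = polyFun Q x) :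
    P = Q := by
  refine MvPolynomial.funext_set (s := fun _ => Set.range ((↑) : ℝ → ℂ))
    (fun _ => Set.infinite_range_of_injective Complex.ofReal_injective) ?_
  intro x hx
  choose y hy using fun i => hx i (Set.mem_univ i)
  have := h (WithLp.toLp 2 y)
  simp only [polyFun] at this
  simpa [hy] using this

lemma polyFun_homogeneous {P : MvPolynomial (Fin k) ℂ} {n : ℕ} (hP : P.IsHomogeneous n)
    (r : ℝ) (x : EuclideanSpace ℝ (Fin k)) : polyFun P (r • x) = (r : ℂ) ^ n * polyFun P x := by
  simp only [polyFun, MvPolynomial.eval_eq, Finset.mul_sum]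
  refine Finset.sum_congr rfl fun d hd => ?_
  have hdeg : ∑ i ∈ d.support, d i = n := by
    have := hP (MvPolynomial.mem_support_iff.1 hd)
    rw [Finsupp.weight_apply] at this
    simpa [Finsupp.sum] using this
  have : ∏ i ∈ d.support, (((r • x) i : ℝ) : ℂ) ^ d i =
      (r : ℂ) ^ n * ∏ i ∈ d.support, ((x i : ℝ) : ℂ) ^ d i := by
    rw [← hdeg, ← Finset.prod_pow_eq_pow_sum, ← Finset.prod_mul_distrib]
    exact Finset.prod_congr rfl fun i _ => by simp [mul_pow]
  rw [this]; ring

/-- The polynomial `|x|²`. -/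
def normSqPoly (k : ℕ) : MvPolynomial (Fin k) ℂ := ∑ i, MvPolynomial.X i ^ 2

lemma polyFun_normSqPoly (x : EuclideanSpace ℝ (Fin k)) :
    polyFun (normSqPoly k) x = ((‖x‖ ^ 2 : ℝ) : ℂ) := by
  rw [EuclideanSpace.real_norm_sq_eq]
  simp [normSqPoly, polyFun_sum, polyFun_pow, polyFun_X]

lemma pderiv_normSqPoly (i : Fin k) :
    MvPolynomial.pderiv i (normSqPoly k) = 2 * MvPolynomial.X i := by
  simp only [normSqPoly, map_sum]
  rw [Finset.sum_eq_single i]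
  · simp [Derivation.leibniz_pow]
  · intro j _ hj; simp [Derivation.leibniz_pow, MvPolynomial.pderiv_X, hj]
  · simp

lemma isHomogeneous_normSqPoly : (normSqPoly k).IsHomogeneous 2 :=
  MvPolynomial.IsHomogeneous.sum _ _ _ fun i _ => by
    simpa using (MvPolynomial.isHomogeneous_X ℂ i).pow 2

lemma isHomogeneous_coordPoly (i : Fin k) : (coordPoly L i).IsHomogeneous 1 :=
  MvPolynomial.IsHomogeneous.sum _ _ _ fun j _ => MvPolynomial.isHomogeneous_C_mul_X _ j

lemma isHomogeneous_polyLaplacian {P : MvPolynomial (Fin k) ℂ} {n : ℕ} (hP : P.IsHomogeneous n) :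
    (polyLaplacian k P).IsHomogeneous (n - 2) := by
  rw [polyLaplacian_apply]
  exact MvPolynomial.IsHomogeneous.sum _ _ _ fun i _ => (hP.pderiv (i := i)).pderiv (i := i)

end

/-! ### Gaussian integrals of polynomials -/

section

variable {k l : ℕ}

/-- The polynomial `P` times the Gaussian `e^{-ν|x|²/2}`. -/
def gaussFn (ν : ℝ) (P : MvPolynomial (Fin k) ℂ) (x : EuclideanSpace ℝ (Fin k)) : ℂ :=
  polyFun P x * Real.exp (-(‖x‖ ^ 2 * ν / 2))

/-- The Gaussian integral of a polynomial. -/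
def gaussInt (ν : ℝ) (P : MvPolynomial (Fin k) ℂ) : ℂ := ∫ x, gaussFn ν P x

lemma gaussFn_contDiff (ν : ℝ) (P : MvPolynomial (Fin k) ℂ) : ContDiff ℝ ∞ (gaussFn ν P) := by
  have h : ContDiff ℝ ∞ fun x : EuclideanSpace ℝ (Fin k) => Real.exp (-(‖x‖ ^ 2 * ν / 2)) :=
    Real.contDiff_exp.comp ((((contDiff_norm_sq ℝ).mul contDiff_const).div_const _).neg)
  exact (polyFun_contDiff P).mul (Complex.ofRealCLM.contDiff.comp h)

/-- The rate `ε` is generalised in the induction: a product with a coordinate spends half of it on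
the polynomial and half on the coordinate. -/
lemma norm_polyFun_le_exp (P : MvPolynomial (Fin k) ℂ) {ε : ℝ} (hε : 0 < ε) :
    ∃ C : ℝ, 0 ≤ C ∧ ∀ x, ‖polyFun P x‖ ≤ C * Real.exp (ε * ‖x‖ ^ 2) := by
  induction P using MvPolynomial.induction_on generalizing ε with
  | C a =>
    refine ⟨‖a‖, norm_nonneg _, fun x => ?_⟩
    rw [polyFun_C]
    exact le_mul_of_one_le_right (norm_nonneg _) (Real.one_le_exp (by positivity))
  | add P Q hP hQ =>
    obtain ⟨C, hC, h⟩ := hP hε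
    obtain ⟨D, hD, h'⟩ := hQ hε
    refine ⟨C + D, by positivity, fun x => ?_⟩
    rw [polyFun_add, add_mul]
    exact (norm_add_le _ _).trans (add_le_add (h x) (h' x))
  | mul_X P i hP =>
    obtain ⟨C, hC, h⟩ := hP (half_pos hε)
    refine ⟨C * (1 + 2 / ε), by positivity, fun x => ?_⟩
    have h1 : ‖polyFun (MvPolynomial.X i) x‖ ≤ (1 + 2 / ε) * Real.exp (ε / 2 * ‖x‖ ^ 2) := by
      have h2 : ‖polyFun (MvPolynomial.X i) x‖ ≤ ‖x‖ := by
        rw [polyFun_X, Complex.norm_real]; exact PiLp.norm_apply_le x i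
      have h3 := Real.add_one_le_exp (ε / 2 * ‖x‖ ^ 2)
      have h4 : ‖x‖ ≤ 1 + ‖x‖ ^ 2 := by nlinarith [sq_nonneg (‖x‖ - 1), norm_nonneg x]
      have h5 : 1 + ‖x‖ ^ 2 ≤ (1 + 2 / ε) * (ε / 2 * ‖x‖ ^ 2 + 1) := by
        have : (1 + 2 / ε) * (ε / 2 * ‖x‖ ^ 2 + 1) =
          1 + ‖x‖ ^ 2 + (ε / 2 * ‖x‖ ^ 2 + 2 / ε) := by field_simp; ring
        rw [this]
        have : 0 ≤ ε / 2 * ‖x‖ ^ 2 + 2 / ε := by positivity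
        linarith
      exact h2.trans (h4.trans (h5.trans (mul_le_mul_of_nonneg_left h3 (by positivity))))
    have h6 : Real.exp (ε * ‖x‖ ^ 2) = Real.exp (ε / 2 * ‖x‖ ^ 2) * Real.exp (ε / 2 * ‖x‖ ^ 2) := by
      rw [← Real.exp_add]; congr 1; ring
    rw [polyFun_mul, norm_mul, h6]
    calc _ ≤ (C * Real.exp (ε / 2 * ‖x‖ ^ 2)) * ((1 + 2 / ε) * Real.exp (ε / 2 * ‖x‖ ^ 2)) :=
          mul_le_mul (h x) h1 (norm_nonneg _) (by positivity)
      _ = _ := by ring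

lemma integrable_exp_neg_norm_sq {b : ℝ} (hb : 0 < b) :
    Integrable fun x : EuclideanSpace ℝ (Fin k) => Real.exp (-(b * ‖x‖ ^ 2)) := by
  have h := (GaussianFourier.integrable_cexp_neg_mul_sq_norm_add (V := EuclideanSpace ℝ (Fin k))
    (b := b) (by simpa using hb) 0 0).re
  refine h.congr (Filter.Eventually.of_forall fun x => ?_)
  have : Complex.exp (-(b : ℂ) * ‖x‖ ^ 2 + 0 * ((inner ℝ 0 x : ℝ) : ℂ)) =
      (Real.exp (-(b * ‖x‖ ^ 2)) : ℝ) := by push_cast; congr 1; ring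
  simp only [this]
  exact Complex.ofReal_re _

lemma norm_gaussFn_le (P : MvPolynomial (Fin k) ℂ) {ν : ℝ} (hν : 0 < ν) :
    ∃ C : ℝ, 0 ≤ C ∧ ∀ x, ‖gaussFn ν P x‖ ≤ C * Real.exp (-(ν / 4 * ‖x‖ ^ 2)) := by
  obtain ⟨C, hC, h⟩ := norm_polyFun_le_exp P (show 0 < ν / 4 by positivity)
  refine ⟨C, hC, fun x => ?_⟩
  rw [gaussFn, norm_mul, Complex.norm_real, Real.norm_of_nonneg (Real.exp_nonneg _)]
  calc _ ≤ C * Real.exp (ν / 4 * ‖x‖ ^ 2) * Real.exp (-(‖x‖ ^ 2 * ν / 2)) :=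
        mul_le_mul_of_nonneg_right (h x) (Real.exp_nonneg _)
    _ = _ := by rw [mul_assoc, ← Real.exp_add]; congr 2; ring

lemma gaussFn_integrable (P : MvPolynomial (Fin k) ℂ) {ν : ℝ} (hν : 0 < ν) :
    Integrable (gaussFn ν P) := by
  obtain ⟨C, hC, h⟩ := norm_gaussFn_le P hν
  refine ((integrable_exp_neg_norm_sq (k := k) (show 0 < ν / 4 by positivity)).const_mul C).mono'
    (gaussFn_contDiff ν P).continuous.aestronglyMeasurable (Filter.Eventually.of_forall h)

/-- The squared modulus is again a polynomial, `P` times its conjugate, times the Gaussian with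
parameter `2ν`, so integrability suffices. -/
lemma gaussFn_memLp (P : MvPolynomial (Fin k) ℂ) {ν : ℝ} (hν : 0 < ν) :
    MemLp (gaussFn ν P) 2 volume := by
  rw [memLp_two_iff_integrable_sq_norm (gaussFn_contDiff ν P).continuous.aestronglyMeasurable]
  have := (gaussFn_integrable (P * polyConj P) (show 0 < 2 * ν by positivity)).norm
  refine this.congr (Filter.Eventually.of_forall fun x => ?_)
  simp only [gaussFn, polyFun_mul, polyFun_polyConj, norm_mul, Complex.norm_real,
    Real.norm_of_nonneg (Real.exp_nonneg _), RCLike.norm_conj, mul_pow, ← Real.exp_nat_mul]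
  rw [← sq]; congr 2; push_cast; ring

lemma hasFDerivAt_gauss (ν : ℝ) (x : EuclideanSpace ℝ (Fin k)) :
    HasFDerivAt (fun y : EuclideanSpace ℝ (Fin k) => ((Real.exp (-(‖y‖ ^ 2 * ν / 2)) : ℝ) : ℂ))
      (Complex.ofRealCLM.comp (Real.exp (-(‖x‖ ^ 2 * ν / 2)) • (-ν) • innerSL ℝ x)) x := by
  have h0 : HasFDerivAt (fun y : EuclideanSpace ℝ (Fin k) => ‖y‖ ^ 2) (2 • innerSL ℝ x) x :=
    (hasStrictFDerivAt_norm_sq x).hasFDerivAt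
  have h1 : HasFDerivAt (fun y : EuclideanSpace ℝ (Fin k) => -(‖y‖ ^ 2 * ν / 2))
      ((-ν) • innerSL ℝ x) x := by
    have h2 := h0.const_mul (-ν / 2)
    refine (h2.congr_of_eventuallyEq (Filter.Eventually.of_forall fun y => ?_)).congr_fderiv ?_
    · ring
    · ext v; simp; ring
  exact Complex.ofRealCLM.hasFDerivAt.comp x h1.exp

lemma fderiv_gaussFn (ν : ℝ) (P : MvPolynomial (Fin k) ℂ) (x v : EuclideanSpace ℝ (Fin k)) :
    fderiv ℝ (gaussFn ν P) x v = (fderiv ℝ (polyFun P) x v - ν * (⟪x, v⟫_ℝ : ℝ) * polyFun P x) *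
      Real.exp (-(‖x‖ ^ 2 * ν / 2)) := by
  have h := ((polyFun_differentiable P x).hasFDerivAt.mul (hasFDerivAt_gauss ν x)).fderiv
  have h' : fderiv ℝ (gaussFn ν P) x = _ := h
  rw [h']
  simp
  ring

lemma fderiv_gaussFn_basisVec (ν : ℝ) (P : MvPolynomial (Fin k) ℂ) (x) (i : Fin k) :
    fderiv ℝ (gaussFn ν P) x (basisVec i) =
      gaussFn ν (MvPolynomial.pderiv i P - (ν : ℂ) • (MvPolynomial.X i * P)) x := by
  rw [fderiv_gaussFn, fderiv_polyFun_basisVec, gaussFn, polyFun_sub, polyFun_smul, polyFun_mul,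
    polyFun_X]
  simp [basisVec, EuclideanSpace.inner_single_right]
  ring_nf
  try tauto

lemma gaussInt_add {ν : ℝ} (hν : 0 < ν) (P Q : MvPolynomial (Fin k) ℂ) :
    gaussInt ν (P + Q) = gaussInt ν P + gaussInt ν Q := by
  simp only [gaussInt]
  rw [← integral_add (gaussFn_integrable P hν) (gaussFn_integrable Q hν)]
  exact integral_congr_ae (Filter.Eventually.of_forall fun x => by
    simp [gaussFn, polyFun_add, add_mul])

lemma gaussInt_smul (ν : ℝ) (c : ℂ) (P : MvPolynomial (Fin k) ℂ) :
    gaussInt ν (c • P) = c * gaussInt ν P := by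
  simp only [gaussInt]
  rw [← integral_const_mul]
  exact integral_congr_ae (Filter.Eventually.of_forall fun x => by
    simp [gaussFn, polyFun_smul, mul_assoc])

/-- The Gaussian integral as a linear functional. -/
def gaussIntₗ {ν : ℝ} (hν : 0 < ν) : MvPolynomial (Fin k) ℂ →ₗ[ℂ] ℂ where
  toFun := gaussInt ν
  map_add' := gaussInt_add hν
  map_smul' := gaussInt_smul ν

/-- Integration by parts against the constant `1`: the integral of `∂_i` of a polynomial times the
Gaussian is zero, and the Gaussian contributes `-ν x_i`. -/
lemma gaussInt_pderiv {ν : ℝ} (hν : 0 < ν) (P : MvPolynomial (Fin k) ℂ) (i : Fin k) :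
    gaussInt ν (MvPolynomial.pderiv i P) = ν * gaussInt ν (MvPolynomial.X i * P) := by
  have h := integral_mul_fderiv_eq_neg_fderiv_mul_of_integrable
    (μ := (volume : Measure (EuclideanSpace ℝ (Fin k)))) (f := fun _ => (1 : ℂ))
    (g := gaussFn ν P) (v := basisVec i) (by simp)
    (by simp only [one_mul, fderiv_gaussFn_basisVec]; exact gaussFn_integrable _ hν)
    (by simpa using gaussFn_integrable P hν) (fun _ _ => differentiableAt_const _)
    (fun x _ => (gaussFn_contDiff ν P).differentiable (by simp) x)
  simp only [one_mul, fderiv_gaussFn_basisVec] at h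
  have h2 : gaussIntₗ hν (MvPolynomial.pderiv i P - (ν : ℂ) • (MvPolynomial.X i * P)) = 0 := by
    simpa [gaussIntₗ, gaussInt] using h
  rw [map_sub, map_smul, sub_eq_zero] at h2
  exact h2

end

/-! ### The skew complex structure and Gaussian orthogonality -/

section

variable {k l : ℕ}

/-- `L` is skew-symmetric with `L² = -μ²` for some `μ > 0`. -/
structure IsSkewComplex (L : EuclideanSpace ℝ (Fin k) →ₗ[ℝ] EuclideanSpace ℝ (Fin k)) (μ : ℝ) :
    Prop where
  pos : 0 < μ
  skew : ∀ x y, ⟪L x, y⟫_ℝ = -⟪x, L y⟫_ℝ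
  sq : ∀ x, L (L x) = -(μ ^ 2) • x

variable {L : EuclideanSpace ℝ (Fin k) →ₗ[ℝ] EuclideanSpace ℝ (Fin k)} {μ : ℝ}

lemma IsSkewComplex.inner_self (h : IsSkewComplex L μ) (x) : ⟪L x, x⟫_ℝ = 0 := by
  have := h.skew x x
  rw [real_inner_comm x (L x)] at this
  rw [real_inner_comm]
  linarith

lemma IsSkewComplex.coord (h : IsSkewComplex L μ) (i j : Fin k) :
    L (basisVec j) i = -L (basisVec i) j := by
  have := h.skew (basisVec j) (basisVec i)
  simpa [basisVec, EuclideanSpace.inner_single_right, EuclideanSpace.inner_single_left] using this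

lemma pderiv_coordPoly (L : EuclideanSpace ℝ (Fin k) →ₗ[ℝ] EuclideanSpace ℝ (Fin k))
    (i j : Fin k) :
    MvPolynomial.pderiv j (coordPoly L i) = MvPolynomial.C ((L (basisVec j) i : ℝ) : ℂ) := by
  simp only [coordPoly, map_sum, Derivation.leibniz, MvPolynomial.pderiv_C]
  rw [Finset.sum_eq_single j]
  · simp
  · intro b _ hb; simp [MvPolynomial.pderiv_X, hb]
  · simp

lemma pderiv_comm (i j : Fin k) (P : MvPolynomial (Fin k) ℂ) :
    MvPolynomial.pderiv i (MvPolynomial.pderiv j P) =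
      MvPolynomial.pderiv j (MvPolynomial.pderiv i P) := by
  let Di : Derivation ℂ (MvPolynomial (Fin k) ℂ) (MvPolynomial (Fin k) ℂ) := MvPolynomial.pderiv i
  let Dj : Derivation ℂ (MvPolynomial (Fin k) ℂ) (MvPolynomial (Fin k) ℂ) := MvPolynomial.pderiv j
  have h0 : ⁅Di, Dj⁆ = 0 := by
    refine MvPolynomial.derivation_ext fun a => ?_
    rw [Derivation.commutator_apply]
    simp only [Di, Dj, MvPolynomial.pderiv_X, Pi.single_apply]
    split_ifs <;> simp
  have h := congrArg (fun D => D P) h0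
  simp only [Derivation.commutator_apply, Derivation.zero_apply] at h
  exact sub_eq_zero.1 h

lemma pderiv_polyD (L : EuclideanSpace ℝ (Fin k) →ₗ[ℝ] EuclideanSpace ℝ (Fin k))
    (P : MvPolynomial (Fin k) ℂ) (j : Fin k) :
    MvPolynomial.pderiv j (polyD L P) = polyD L (MvPolynomial.pderiv j P) +
      ∑ i, MvPolynomial.C ((L (basisVec j) i : ℝ) : ℂ) * MvPolynomial.pderiv i P := by
  rw [polyD_eq_sum, polyD_eq_sum, map_sum, ← Finset.sum_add_distrib]
  refine Finset.sum_congr rfl fun i _ => ?_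
  rw [Derivation.leibniz, pderiv_coordPoly, pderiv_comm, smul_eq_mul, smul_eq_mul]
  ring

/-- `D` generates rotations, which preserve `Δ`. In coordinates, the commutator is a contraction of
the skew matrix of `L` with the symmetric Hessian, and such a contraction equals its own negative.
-/
lemma IsSkewComplex.polyLaplacian_polyD (h : IsSkewComplex L μ) (P : MvPolynomial (Fin k) ℂ) :
    polyLaplacian k (polyD L P) = polyD L (polyLaplacian k P) := by
  simp only [polyLaplacian_apply, pderiv_polyD, map_add, map_sum, Finset.sum_add_distrib,
    Derivation.leibniz, MvPolynomial.pderiv_C, smul_eq_mul]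
  have key : ∑ j, ∑ i, MvPolynomial.C ((L (basisVec j) i : ℝ) : ℂ) *
      MvPolynomial.pderiv i (MvPolynomial.pderiv j P) = 0 := by
    have h1 : ∑ j, ∑ i, MvPolynomial.C ((L (basisVec j) i : ℝ) : ℂ) *
        MvPolynomial.pderiv i (MvPolynomial.pderiv j P) =
        -∑ j, ∑ i, MvPolynomial.C ((L (basisVec j) i : ℝ) : ℂ) *
        MvPolynomial.pderiv i (MvPolynomial.pderiv j P) := by
      conv_lhs => rw [Finset.sum_comm]
      simp only [← Finset.sum_neg_distrib]
      refine Finset.sum_congr rfl fun j _ => Finset.sum_congr rfl fun i _ => ?_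
      rw [h.coord, pderiv_comm]; simp
    have h2 : (2 : ℂ) • ∑ j, ∑ i, MvPolynomial.C ((L (basisVec j) i : ℝ) : ℂ) *
        MvPolynomial.pderiv i (MvPolynomial.pderiv j P) = 0 := by
      rw [two_smul]; nth_rewrite 1 [h1]; exact neg_add_cancel _
    exact (smul_eq_zero.1 h2).resolve_left two_ne_zero
  have key2 : ∑ j, ∑ i, MvPolynomial.C ((L (basisVec j) i : ℝ) : ℂ) *
      MvPolynomial.pderiv j (MvPolynomial.pderiv i P) = 0 := by
    rw [← key]
    exact Finset.sum_congr rfl fun j _ => Finset.sum_congr rfl fun i _ => by rw [pderiv_comm]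
  rw [key, key2]; simp

lemma polyD_normSqPoly (h : IsSkewComplex L μ) : polyD L (normSqPoly k) = 0 := by
  refine polyFun_injective fun x => ?_
  have h1 := h.inner_self x
  rw [PiLp.inner_apply] at h1
  simp only [polyD_eq_sum, polyFun_sum, polyFun_mul, pderiv_normSqPoly, polyFun_coordPoly,
    polyFun_X, polyFun_zero]
  have h2 : (∑ i, (L x i : ℂ) * (2 * x i)) = ((2 * ∑ i, L x i * x i : ℝ) : ℂ) := by
    push_cast; rw [Finset.mul_sum]; exact Finset.sum_congr rfl fun i _ => by ring
  have h3 : ∑ i, L x i * x i = 0 := by rw [← h1]; simp [mul_comm]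
  have h4 : polyFun (2 : MvPolynomial (Fin k) ℂ) x = 2 := polyFun_C 2 x
  rw [h4, h2, h3]; simp

lemma sum_X_mul_coordPoly (h : IsSkewComplex L μ) :
    ∑ i, MvPolynomial.X i * coordPoly L i = 0 := by
  have h1 := polyD_normSqPoly h
  simp only [polyD_eq_sum, pderiv_normSqPoly] at h1
  have h2 : (2 : ℂ) • ∑ i, MvPolynomial.X i * coordPoly L i = 0 := by
    rw [← h1, Finset.smul_sum]
    refine Finset.sum_congr rfl fun i _ => ?_
    rw [MvPolynomial.smul_eq_C_mul, map_ofNat]; ring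
  exact (smul_eq_zero.1 h2).resolve_left two_ne_zero

lemma polyD_polyConj (P : MvPolynomial (Fin k) ℂ) :
    polyD L (polyConj P) = polyConj (polyD L P) := by
  have h : ∀ i, polyConj (coordPoly L i) = coordPoly L i := fun i => by
    simp [polyConj, coordPoly]
  simp only [polyD_eq_sum]
  simp only [polyConj, map_sum, map_mul, MvPolynomial.pderiv_map] at h ⊢
  simp only [h]

lemma polyLaplacian_polyConj (P : MvPolynomial (Fin k) ℂ) :
    polyLaplacian k (polyConj P) = polyConj (polyLaplacian k P) := by
  simp only [polyLaplacian_apply, polyConj, map_sum, MvPolynomial.pderiv_map]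

/-- The field `x ↦ L x` is divergence free, as its matrix has zero diagonal, and tangent to the
spheres on which the Gaussian is constant. The first fact writes `D P` as a divergence, the second
(`sum_X_mul_coordPoly`) kills what the Gaussian contributes. -/
lemma gaussInt_polyD {ν : ℝ} (hν : 0 < ν) (h : IsSkewComplex L μ) (P : MvPolynomial (Fin k) ℂ) :
    gaussInt ν (polyD L P) = 0 := by
  have h1 : polyD L P = ∑ i, MvPolynomial.pderiv i (coordPoly L i * P) := by
    rw [polyD_eq_sum]
    refine Finset.sum_congr rfl fun i _ => ?_
    rw [Derivation.leibniz, pderiv_coordPoly]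
    have : L (basisVec i) i = 0 := by linarith [h.coord i i]
    simp [this]
  have h2 : gaussInt ν (polyD L P) = ∑ i, ν * gaussInt ν (MvPolynomial.X i *
      (coordPoly L i * P)) := by
    rw [h1]
    change gaussIntₗ hν _ = _
    rw [map_sum]
    exact Finset.sum_congr rfl fun i _ => gaussInt_pderiv hν _ i
  rw [h2, ← Finset.mul_sum]
  have h3 : ∑ i, gaussInt ν (MvPolynomial.X i * (coordPoly L i * P)) =
      gaussIntₗ hν ((∑ i, MvPolynomial.X i * coordPoly L i) * P) := by
    rw [Finset.sum_mul, map_sum]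
    exact Finset.sum_congr rfl fun i _ => by rw [mul_assoc]; rfl
  rw [h3, sum_X_mul_coordPoly h]; simp

/-- Integrate `∑ ∂_i(∂_i P · Q)` by parts. The Gaussian produces `ν ∑ x_i ∂_i P`, which is `νnP` by
Euler's identity. -/
lemma gaussInt_laplacian {ν : ℝ} (hν : 0 < ν) {P : MvPolynomial (Fin k) ℂ} {n : ℕ}
    (hP : P.IsHomogeneous n) (Q : MvPolynomial (Fin k) ℂ) :
    gaussInt ν (polyLaplacian k P * Q) +
      gaussInt ν (∑ i, MvPolynomial.pderiv i P * MvPolynomial.pderiv i Q) =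
      ν * n * gaussInt ν (P * Q) := by
  rw [← gaussInt_add hν]
  have h1 : polyLaplacian k P * Q + ∑ i, MvPolynomial.pderiv i P * MvPolynomial.pderiv i Q =
      ∑ i, MvPolynomial.pderiv i (MvPolynomial.pderiv i P * Q) := by
    rw [polyLaplacian_apply, Finset.sum_mul, ← Finset.sum_add_distrib]
    exact Finset.sum_congr rfl fun i _ => by rw [Derivation.leibniz]; simp; ring
  rw [h1]
  change gaussIntₗ hν _ = _
  rw [map_sum]
  have h2 : ∀ i, gaussIntₗ hν (MvPolynomial.pderiv i (MvPolynomial.pderiv i P * Q)) =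
      ν * gaussIntₗ hν (MvPolynomial.X i * MvPolynomial.pderiv i P * Q) := fun i => by
    rw [mul_assoc]; exact gaussInt_pderiv hν _ i
  simp only [h2]
  rw [← Finset.mul_sum, ← map_sum, ← Finset.sum_mul, hP.sum_X_mul_pderiv, mul_assoc]
  congr 1
  rw [smul_mul_assoc, map_nsmul, nsmul_eq_mul]; rfl

/-- The gradient term in `gaussInt_laplacian` is symmetric in `P` and `Q`, so it cancels when the
identity is subtracted from its mirror image. Different degrees can then be told apart as
eigenvalues are. -/
lemma gaussInt_harmonic_mul {ν : ℝ} (hν : 0 < ν) {P Q : MvPolynomial (Fin k) ℂ} {n d : ℕ}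
    (hP : P.IsHomogeneous n) (hP' : polyLaplacian k P = 0) (hQ : Q.IsHomogeneous d) :
    ν * ((n : ℂ) - d) * gaussInt ν (P * Q) = -gaussInt ν (P * polyLaplacian k Q) := by
  have h1 := gaussInt_laplacian hν hP Q
  have h2 := gaussInt_laplacian hν hQ P
  have h3 : ∑ i, MvPolynomial.pderiv i P * MvPolynomial.pderiv i Q =
    ∑ i, MvPolynomial.pderiv i Q * MvPolynomial.pderiv i P :=
    Finset.sum_congr rfl fun i _ => mul_comm _ _
  have h0 : gaussInt ν (0 * Q) = 0 := by rw [zero_mul]; exact map_zero (gaussIntₗ hν)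
  rw [hP', h0, zero_add, h3] at h1
  rw [mul_comm P Q, mul_comm P] at *
  linear_combination h2 - h1

lemma gaussInt_harmonic_mul_harmonic {ν : ℝ} (hν : 0 < ν) {P Q : MvPolynomial (Fin k) ℂ} {n d : ℕ}
    (hP : P.IsHomogeneous n) (hP' : polyLaplacian k P = 0) (hQ : Q.IsHomogeneous d)
    (hQ' : polyLaplacian k Q = 0) (hnd : n ≠ d) : gaussInt ν (P * Q) = 0 := by
  have h := gaussInt_harmonic_mul hν hP hP' hQ
  rw [hQ', mul_zero] at h
  have h0 : gaussInt ν (0 : MvPolynomial (Fin k) ℂ) = 0 := map_zero (gaussIntₗ hν)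
  rw [h0, neg_zero] at h
  refine (mul_eq_zero.1 h).resolve_left (mul_ne_zero (by exact_mod_cast hν.ne') ?_)
  rw [sub_ne_zero]; exact_mod_cast hnd

/-- Strong induction on `d`: by `gaussInt_harmonic_mul` the integral is proportional to the one with
`ΔQ`, of degree `d - 2`. For `d < 2` the truncated subtraction is useless, but then `ΔQ = 0`. -/
lemma gaussInt_harmonic_mul_lower {ν : ℝ} (hν : 0 < ν) {P : MvPolynomial (Fin k) ℂ} {n : ℕ}
    (hP : P.IsHomogeneous n) (hP' : polyLaplacian k P = 0) :
    ∀ (d : ℕ) (Q : MvPolynomial (Fin k) ℂ), d < n → Q.IsHomogeneous d → gaussInt ν (P * Q) = 0 := by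
  intro d
  induction d using Nat.strong_induction_on with
  | _ d ih =>
    intro Q hd hQ
    have h := gaussInt_harmonic_mul hν hP hP' hQ
    have h0 : gaussInt ν (P * polyLaplacian k Q) = 0 := by
      rcases Nat.lt_or_ge d 2 with h2 | h2
      · have hz : polyLaplacian k Q = 0 := by
          rw [polyLaplacian_apply]
          refine Finset.sum_eq_zero fun i _ => ?_
          have h3 : (MvPolynomial.pderiv i Q).IsHomogeneous 0 := by
            have := hQ.pderiv (i := i)
            rwa [show d - 1 = 0 by omega] at this
          rw [MvPolynomial.totalDegree_eq_zero_iff_eq_C.1 (Nat.le_zero.1 h3.totalDegree_le),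
            MvPolynomial.pderiv_C]
        rw [hz, mul_zero]; exact map_zero (gaussIntₗ hν)
      · exact ih (d - 2) (by omega) _ (by omega) (isHomogeneous_polyLaplacian hQ)
    rw [h0, neg_zero] at h
    refine (mul_eq_zero.1 h).resolve_left (mul_ne_zero (by exact_mod_cast hν.ne') ?_)
    rw [sub_ne_zero]; exact_mod_cast hd.ne'

lemma eq_zero_of_gaussInt_eq_zero {ν : ℝ} (hν : 0 < ν) {P : MvPolynomial (Fin k) ℂ}
    (hP : ∀ x, ∃ r : ℝ, 0 ≤ r ∧ polyFun P x = r) (h : gaussInt ν P = 0) : P = 0 := by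
  choose r hr hr' using hP
  have e : ∀ x, gaussFn ν P x = ((r x * Real.exp (-(‖x‖ ^ 2 * ν / 2)) : ℝ) : ℂ) := fun x => by
    rw [gaussFn, hr']; push_cast; rfl
  have h1 : ∫ x, (r x * Real.exp (-(‖x‖ ^ 2 * ν / 2)) : ℝ) = 0 := by
    have : gaussInt ν P = ((∫ x, (r x * Real.exp (-(‖x‖ ^ 2 * ν / 2)) : ℝ) : ℝ) : ℂ) := by
      rw [gaussInt, ← integral_complex_ofReal]; simp only [e]
    rw [this] at h; exact_mod_cast h
  have hi : Integrable (fun x => (r x * Real.exp (-(‖x‖ ^ 2 * ν / 2)) : ℝ)) := by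
    refine (gaussFn_integrable P hν).re.congr (Filter.Eventually.of_forall fun x => ?_)
    simp only [e]; exact Complex.ofReal_re _
  have h2 := (integral_eq_zero_iff_of_nonneg (fun x => mul_nonneg (hr x)
      (Real.exp_nonneg _)) hi).1 h1
  have h3 : gaussFn ν P =ᵐ[volume] fun _ => 0 := by
    filter_upwards [h2] with x hx
    rw [e, hx]; simp
  have h4 := (gaussFn_contDiff ν P).continuous.ae_eq_iff_eq volume continuous_const |>.1 h3
  refine polyFun_injective fun x => ?_
  have h5 := congrFun h4 x
  rw [gaussFn] at h5
  rw [polyFun_zero]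
  exact (mul_eq_zero.1 h5).resolve_right (by exact_mod_cast (Real.exp_pos _).ne')

lemma eq_zero_of_gaussInt_mul_conj {ν : ℝ} (hν : 0 < ν) {P : MvPolynomial (Fin k) ℂ}
    (h : gaussInt ν (P * polyConj P) = 0) : P = 0 := by
  have h1 := eq_zero_of_gaussInt_eq_zero hν (fun x => ⟨‖polyFun P x‖ ^ 2, by positivity, by
    rw [polyFun_mul, polyFun_polyConj, Complex.mul_conj, Complex.normSq_eq_norm_sq]⟩) h
  refine polyFun_injective fun x => ?_
  have h2 : polyFun (P * polyConj P) x = 0 := by rw [h1, polyFun_zero]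
  rw [polyFun_mul, polyFun_polyConj] at h2
  rw [polyFun_zero]
  rcases mul_eq_zero.1 h2 with h3 | h3
  · exact h3
  · exact (map_eq_zero _).1 h3

lemma isHomogeneous_polyConj {P : MvPolynomial (Fin k) ℂ} {n : ℕ} (hP : P.IsHomogeneous n) :
    (polyConj P).IsHomogeneous n := hP.map _

/-! ### Harmonic decomposition and weights of D -/

lemma mem_harmonicSpace {n : ℕ} {m : ℤ} {P : MvPolynomial (Fin k) ℂ} :
    P ∈ harmonicSpace L μ n m ↔
      P.IsHomogeneous n ∧ polyLaplacian k P = 0 ∧ polyD L P = (Complex.I * m * μ) • P := by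
  simp [harmonicSpace, sub_eq_zero, and_assoc]

lemma normSqPoly_ne_zero (hk : 0 < k) : normSqPoly k ≠ 0 := by
  intro h
  have h1 := congrArg (fun P => polyFun P (basisVec (⟨0, hk⟩ : Fin k))) h
  simp [polyFun_normSqPoly, polyFun_zero] at h1

/-- A harmonic `|x|²S` of degree `n + 2` is orthogonal to `S`, of lower degree, so the Gaussian
integral of `|x|²|S|²` vanishes. -/
lemma eq_zero_of_laplacian_normSqPoly_mul (hk : 0 < k) {S : MvPolynomial (Fin k) ℂ} {n : ℕ}
    (hS : S.IsHomogeneous n) (h : polyLaplacian k (normSqPoly k * S) = 0) : S = 0 := by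
  have h1 := gaussInt_harmonic_mul_lower one_pos (isHomogeneous_normSqPoly.mul hS) h n (polyConj S)
    (by omega) (isHomogeneous_polyConj hS)
  have h2 := eq_zero_of_gaussInt_eq_zero one_pos (fun x => ⟨‖x‖ ^ 2 * ‖polyFun S x‖ ^ 2,
    by positivity, by
      rw [polyFun_mul, polyFun_mul, polyFun_polyConj, polyFun_normSqPoly, mul_assoc,
        Complex.mul_conj, Complex.normSq_eq_norm_sq, ← Complex.ofReal_mul]⟩) h1
  rcases mul_eq_zero.1 h2 with h3 | h3
  · exact (mul_eq_zero.1 h3).resolve_left (normSqPoly_ne_zero hk)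
  · exact (map_eq_zero_iff _ (MvPolynomial.map_injective _ (RingHom.injective _))).1 h3

instance homogeneousSubmodule_finiteDimensional (n : ℕ) :
    FiniteDimensional ℂ (MvPolynomial.homogeneousSubmodule (Fin k) ℂ n) :=
  Module.Finite.iff_fg.2 (MvPolynomial.homogeneousSubmodule_fg (Fin k) ℂ n)

instance harmonicSpace_finiteDimensional (n : ℕ) (m : ℤ) :
    FiniteDimensional ℂ (harmonicSpace L μ n m) :=
  Submodule.finiteDimensional_of_le (S₂ := MvPolynomial.homogeneousSubmodule (Fin k) ℂ n)
    (inf_le_left.trans inf_le_left)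

/-- The decomposition of a homogeneous polynomial into a harmonic one and a multiple of `|x|²`. -/
lemma exists_harmonic_sub (hk : 0 < k) {Q : MvPolynomial (Fin k) ℂ} {n : ℕ}
    (hQ : Q.IsHomogeneous (n + 2)) :
    ∃ S : MvPolynomial (Fin k) ℂ, S.IsHomogeneous n ∧
      polyLaplacian k (Q - normSqPoly k * S) = 0 := by
  let T : MvPolynomial.homogeneousSubmodule (Fin k) ℂ n →ₗ[ℂ]
      MvPolynomial.homogeneousSubmodule (Fin k) ℂ n :=
    ((polyLaplacian k ∘ₗ LinearMap.mulLeft ℂ (normSqPoly k)).restrict fun S hS => by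
      have := isHomogeneous_polyLaplacian (isHomogeneous_normSqPoly.mul
        ((MvPolynomial.mem_homogeneousSubmodule _ _).1 hS))
      rw [MvPolynomial.mem_homogeneousSubmodule]
      rwa [show 2 + n - 2 = n by omega] at this)
  -- An injective endomorphism of a finite-dimensional space is surjective, so some `S` has
  -- `Δ(|x|²S) = ΔQ`.
  have hT : Function.Injective T := by
    rw [← LinearMap.ker_eq_bot, LinearMap.ker_eq_bot']
    intro S hS
    have h := congrArg Subtype.val hS
    exact Subtype.ext (eq_zero_of_laplacian_normSqPoly_mul hk
      ((MvPolynomial.mem_homogeneousSubmodule _ _).1 S.2) h)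
  obtain ⟨S, hS⟩ := (LinearMap.injective_iff_surjective.1 hT) ⟨polyLaplacian k Q, by
    have := isHomogeneous_polyLaplacian hQ
    rw [MvPolynomial.mem_homogeneousSubmodule]
    rwa [show n + 2 - 2 = n by omega] at this⟩
  refine ⟨S, (MvPolynomial.mem_homogeneousSubmodule _ _).1 S.2, ?_⟩
  have h := congrArg Subtype.val hS
  rw [map_sub, sub_eq_zero]
  exact h.symm

lemma polyLaplacian_eq_zero_of_degree_lt {Q : MvPolynomial (Fin k) ℂ} {n : ℕ}
    (hQ : Q.IsHomogeneous n) (hn : n < 2) : polyLaplacian k Q = 0 := by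
  rw [polyLaplacian_apply]
  refine Finset.sum_eq_zero fun i _ => ?_
  have h3 : (MvPolynomial.pderiv i Q).IsHomogeneous 0 := by
    have := hQ.pderiv (i := i)
    rwa [show n - 1 = 0 by omega] at this
  rw [MvPolynomial.totalDegree_eq_zero_iff_eq_C.1 (Nat.le_zero.1 h3.totalDegree_le),
    MvPolynomial.pderiv_C]

/-- The homogeneous polynomials of degree `n` with `D P = i m μ P`. -/
def weightSpace (L : EuclideanSpace ℝ (Fin k) →ₗ[ℝ] EuclideanSpace ℝ (Fin k)) (μ : ℝ)
    (n : ℕ) (m : ℤ) : Submodule ℂ (MvPolynomial (Fin k) ℂ) :=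
  MvPolynomial.homogeneousSubmodule (Fin k) ℂ n ⊓
    Module.End.eigenspace (polyD L) (Complex.I * m * μ)

lemma mem_weightSpace {n : ℕ} {m : ℤ} {P : MvPolynomial (Fin k) ℂ} :
    P ∈ weightSpace L μ n m ↔ P.IsHomogeneous n ∧ polyD L P = (Complex.I * m * μ) • P := by
  simp [weightSpace]

lemma weightSpace_mul {n n' : ℕ} {m m' : ℤ} {P Q : MvPolynomial (Fin k) ℂ}
    (hP : P ∈ weightSpace L μ n m) (hQ : Q ∈ weightSpace L μ n' m') :
    P * Q ∈ weightSpace L μ (n + n') (m + m') := by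
  rw [mem_weightSpace] at *
  refine ⟨hP.1.mul hQ.1, ?_⟩
  rw [polyD_mul, hP.2, hQ.2]
  simp only [MvPolynomial.smul_eq_C_mul]
  push_cast
  simp only [mul_add, add_mul, map_add]
  ring

lemma polyD_coordPoly (h : IsSkewComplex L μ) (i : Fin k) :
    polyD L (coordPoly L i) = (-(μ : ℂ) ^ 2) • MvPolynomial.X i := by
  refine polyFun_injective fun x => ?_
  rw [polyFun_smul, polyFun_X, polyD_eq_sum, polyFun_sum]
  simp only [polyFun_mul, polyFun_coordPoly, pderiv_coordPoly, polyFun_C]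
  have h1 := map_apply_eq_sum L (L x) i
  rw [h.sq] at h1
  have h2 : (∑ j, ((L x j : ℝ) : ℂ) * ((L (basisVec j) i : ℝ) : ℂ)) =
      ((∑ j, L x j * L (basisVec j) i : ℝ) : ℂ) := by push_cast; rfl
  rw [h2, ← h1]
  simp

/-- On linear forms `D² = -μ²`, so a coordinate splits into its components in the `±iμ` eigenspaces,
namely `½(x_i ∓ (i/μ)(L x)_i)`. -/
lemma X_eq_add_weight (h : IsSkewComplex L μ) (i : Fin k) :
    ∃ a ∈ weightSpace L μ 1 1, ∃ b ∈ weightSpace L μ 1 (-1), MvPolynomial.X i = a + b := by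
  have hμ : (μ : ℂ) ≠ 0 := by exact_mod_cast h.pos.ne'
  have hh : ∀ c : ℂ, ((1 / 2 : ℂ) • MvPolynomial.X i + c • coordPoly L i).IsHomogeneous 1 := by
    intro c
    rw [MvPolynomial.smul_eq_C_mul, MvPolynomial.smul_eq_C_mul]
    exact ((MvPolynomial.isHomogeneous_X ℂ i).C_mul _).add ((isHomogeneous_coordPoly L i).C_mul _)
  refine ⟨(1 / 2 : ℂ) • MvPolynomial.X i + (-Complex.I / (2 * μ)) • coordPoly L i,
    mem_weightSpace.2 ⟨hh _, ?_⟩,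
    (1 / 2 : ℂ) • MvPolynomial.X i + (Complex.I / (2 * μ)) • coordPoly L i,
    mem_weightSpace.2 ⟨hh _, ?_⟩, ?_⟩
  · rw [map_add, map_smul, map_smul, polyD_X, polyD_coordPoly h, smul_add, smul_smul, smul_smul,
      smul_smul, add_comm]
    congr 2
    · field_simp; push_cast; ring
    · field_simp; push_cast; linear_combination Complex.I_sq
  · rw [map_add, map_smul, map_smul, polyD_X, polyD_coordPoly h, smul_add, smul_smul, smul_smul,
      smul_smul, add_comm]
    congr 2
    · field_simp; push_cast; ring
    · field_simp; push_cast; linear_combination Complex.I_sq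
  · rw [show -Complex.I / (2 * μ) = -(Complex.I / (2 * μ)) by ring]; module

/-- Euler's identity writes `Q` through products `x_i ∂_i Q`. By induction `∂_i Q` is a sum of
weight vectors, and multiplication by `x_i` raises or lowers the weight by one. Hence only the
weights `2p - n` with `0 ≤ p ≤ n` occur. -/
lemma mem_iSup_weightSpace (h : IsSkewComplex L μ) (n : ℕ) (Q : MvPolynomial (Fin k) ℂ)
    (hQ : Q.IsHomogeneous n) : Q ∈ ⨆ p : Fin (n + 1), weightSpace L μ n (2 * (p : ℕ) - n) := by
  induction n generalizing Q with
  | zero =>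
    refine Submodule.mem_iSup_of_mem 0 (mem_weightSpace.2 ⟨hQ, ?_⟩)
    rw [MvPolynomial.totalDegree_eq_zero_iff_eq_C.1 (Nat.le_zero.1 hQ.totalDegree_le), polyD_C]
    simp
  | succ n ih =>
    have key : ∀ i R, R ∈ (⨆ p : Fin (n + 1), weightSpace L μ n (2 * (p : ℕ) - n)) →
        MvPolynomial.X i * R ∈ ⨆ p : Fin (n + 1 + 1), weightSpace L μ (n + 1)
            (2 * (p : ℕ) - (n + 1 : ℕ)) := by
      intro i R hR
      obtain ⟨a, ha, b, hb, hab⟩ := X_eq_add_weight h i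
      suffices hle : (⨆ p : Fin (n + 1), weightSpace L μ n (2 * (p : ℕ) - n)) ≤
        (⨆ p : Fin (n + 1 + 1), weightSpace L μ (n + 1) (2 * (p : ℕ) - (n + 1 : ℕ))).comap
          (LinearMap.mulLeft ℂ (MvPolynomial.X i)) from hle hR
      refine iSup_le fun p Q hQ => ?_
      rw [Submodule.mem_comap, LinearMap.mulLeft_apply, hab, add_mul]
      refine Submodule.add_mem _ (Submodule.mem_iSup_of_mem p.succ ?_)
        (Submodule.mem_iSup_of_mem p.castSucc ?_)
      · have := weightSpace_mul ha hQ
        rw [add_comm 1 n] at this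
        convert this using 2
        rw [Fin.val_succ]; push_cast; ring
      · have := weightSpace_mul hb hQ
        rw [add_comm 1 n] at this
        convert this using 2
        rw [Fin.val_castSucc]; push_cast; ring
    have h1 := hQ.sum_X_mul_pderiv
    have h2 : Q = ((n + 1 : ℕ) : ℂ)⁻¹ • ∑ i, MvPolynomial.X i * MvPolynomial.pderiv i Q := by
      rw [h1, ← Nat.cast_smul_eq_nsmul ℂ, smul_smul, inv_mul_cancel₀
          (by exact_mod_cast n.succ_ne_zero),
        one_smul]
    rw [h2]
    exact Submodule.smul_mem _ _ (Submodule.sum_mem _ fun i _ => key i _ (ih _ (by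
      simpa using hQ.pderiv (i := i))))

lemma weight_injective (hμ : 0 < μ) : Function.Injective fun m : ℤ => Complex.I * m * (μ : ℂ) := by
  intro a b hab
  have hμ' : (μ : ℂ) ≠ 0 := by exact_mod_cast hμ.ne'
  have h1 := mul_right_cancel₀ hμ' hab
  exact_mod_cast mul_left_cancel₀ Complex.I_ne_zero h1

lemma eigenspace_iSupIndep (hμ : 0 < μ) :
    iSupIndep fun m : ℤ => Module.End.eigenspace (polyD L) (Complex.I * m * μ) :=
  (Module.End.eigenspaces_iSupIndep (polyD L)).comp (weight_injective hμ)

/-- A harmonic polynomial is a sum of harmonic polynomials of definite weight. -/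
lemma mem_iSup_harmonicSpace (h : IsSkewComplex L μ) {n : ℕ} {Q : MvPolynomial (Fin k) ℂ}
    (hQ : Q.IsHomogeneous n) (hQ' : polyLaplacian k Q = 0) :
    Q ∈ ⨆ p : Fin (n + 1), harmonicSpace L μ n (2 * (p : ℕ) - n) := by
  obtain ⟨q, hq, rfl⟩ := (Submodule.mem_iSup_iff_exists_finsupp _ _).1
      (mem_iSup_weightSpace h n Q hQ)
  have hinj : Function.Injective fun p : Fin (n + 1) => (2 * ((p : ℕ) : ℤ) - n) := by
    intro a b hab
    have : (2 * ((a : ℕ) : ℤ) - n) = (2 * ((b : ℕ) : ℤ) - n) := hab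
    exact Fin.ext (by omega)
  have hind := (eigenspace_iSupIndep (L := L) h.pos).comp hinj
  -- `Δ` preserves weights, and weight vectors for different weights are independent. So `ΔQ = 0`
  -- forces each weight component to be harmonic.
  have h1 : ∀ p : Fin (n + 1), polyLaplacian k (q p) ∈
      Module.End.eigenspace (polyD L) (Complex.I * ((2 * ((p : ℕ) : ℤ) - n : ℤ) : ℂ) * μ) := by
    intro p
    rw [Module.End.mem_eigenspace_iff, ← h.polyLaplacian_polyD, (mem_weightSpace.1 (hq p)).2,
      map_smul]
  rw [Finsupp.sum_fintype _ _ (fun _ => rfl)] at hQ' ⊢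
  rw [map_sum] at hQ'
  have h2 := (iSupIndep_iff_finsetSum_eq_zero_imp_eq_zero _).1 hind Finset.univ
    (fun p => polyLaplacian k (q p)) (fun p _ => h1 p) hQ'
  refine Submodule.sum_mem _ fun p _ => Submodule.mem_iSup_of_mem p ?_
  exact mem_harmonicSpace.2 ⟨(mem_weightSpace.1 (hq p)).1, h2 p (Finset.mem_univ _),
    (mem_weightSpace.1 (hq p)).2⟩

/-- A non-zero element of any other weight would lie both in its own eigenspace of `D` and in the
sum of the eigenspaces of weight `2p - n`, contradicting independence. So `(m + n)/2` is an integer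
in `[0, n]`. -/
lemma exists_weight_of_harmonicSpace_ne_bot (h : IsSkewComplex L μ) {n : ℕ} {m : ℤ}
    (hne : harmonicSpace L μ n m ≠ ⊥) : ∃ p : ℕ, p ≤ n ∧ m = 2 * p - n := by
  by_contra! hcon
  obtain ⟨P, hP, hP0⟩ := Submodule.exists_mem_ne_zero_of_ne_bot hne
  obtain ⟨h1, h2, h3⟩ := mem_harmonicSpace.1 hP
  refine hP0 (Submodule.disjoint_def.1 ((eigenspace_iSupIndep (L := L) h.pos) m) P
    (Module.End.mem_eigenspace_iff.2 h3) ?_)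
  have h4 := mem_iSup_weightSpace h n P h1
  refine (iSup_le fun p => ?_ : (⨆ p : Fin (n + 1), weightSpace L μ n (2 * (p : ℕ) - n)) ≤ _) h4
  refine inf_le_right.trans ?_
  exact le_iSup₂_of_le (2 * ((p : ℕ) : ℤ) - n) (fun he => hcon p (by omega) he.symm) le_rfl

/-- Every polynomial is a combination of products `|x|^{2j} P(x)` with `P` in some `H^{(n,m)}`. -/
lemma mem_span_normSqPoly_mul_harmonic (hk : 0 < k) (h : IsSkewComplex L μ)
    (Q : MvPolynomial (Fin k) ℂ) :
    Q ∈ Submodule.span ℂ {R | ∃ (j n : ℕ) (m : ℤ), n + 2 * j ≤ Q.totalDegree ∧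
      ∃ P ∈ harmonicSpace L μ n m, R = normSqPoly k ^ j * P} := by
  have hom : ∀ d : ℕ, ∀ Q : MvPolynomial (Fin k) ℂ, Q.IsHomogeneous d →
      Q ∈ Submodule.span ℂ {R | ∃ (j n : ℕ) (m : ℤ), n + 2 * j ≤ d ∧
        ∃ P ∈ harmonicSpace L μ n m, R = normSqPoly k ^ j * P} := by
    intro d
    induction d using Nat.strong_induction_on with
    | _ d ih =>
      intro Q hQ
      have harm : ∀ Q : MvPolynomial (Fin k) ℂ, Q.IsHomogeneous d → polyLaplacian k Q = 0 →
          Q ∈ Submodule.span ℂ {R | ∃ (j n : ℕ) (m : ℤ), n + 2 * j ≤ d ∧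
            ∃ P ∈ harmonicSpace L μ n m, R = normSqPoly k ^ j * P} := by
        intro Q hQ hQ'
        have hle : (⨆ p : Fin (d + 1), harmonicSpace L μ d (2 * (p : ℕ) - d)) ≤
            Submodule.span ℂ {R | ∃ (j n : ℕ) (m : ℤ), n + 2 * j ≤ d ∧
              ∃ P ∈ harmonicSpace L μ n m, R = normSqPoly k ^ j * P} :=
          iSup_le fun p R hR => Submodule.subset_span ⟨0, d, _, by omega, R, hR, by simp⟩
        exact hle (mem_iSup_harmonicSpace h hQ hQ')
      rcases Nat.lt_or_ge d 2 with hd | hd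
      · exact harm Q hQ (polyLaplacian_eq_zero_of_degree_lt hQ hd)
      · obtain ⟨d, rfl⟩ := Nat.exists_eq_add_of_le' hd
        obtain ⟨S, hS, hS'⟩ := exists_harmonic_sub hk hQ
        have hS2 : (normSqPoly k * S).IsHomogeneous (d + 2) := by
          rw [add_comm]; exact isHomogeneous_normSqPoly.mul hS
        have h1 := harm _ (hQ.sub hS2) hS'
        have h2 := ih d (by omega) S hS
        have h3 : normSqPoly k * S ∈ Submodule.span ℂ {R | ∃ (j n : ℕ) (m : ℤ), n + 2 * j ≤ d + 2 ∧
            ∃ P ∈ harmonicSpace L μ n m, R = normSqPoly k ^ j * P} := by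
          refine (Submodule.span_le.2 ?_ : _ ≤ (Submodule.span ℂ _).comap
            (LinearMap.mulLeft ℂ (normSqPoly k))) h2
          rintro _ ⟨j, n, m, hj, P, hP, rfl⟩
          exact Submodule.subset_span ⟨j + 1, n, m, by omega, P, hP, by
            simp [pow_succ]; ring⟩
        have := Submodule.add_mem _ h1 h3
        rwa [sub_add_cancel] at this
  nth_rewrite 2 [← MvPolynomial.sum_homogeneousComponent Q]
  refine Submodule.sum_mem _ fun d hd => ?_
  refine Submodule.span_mono ?_ (hom d _ (MvPolynomial.homogeneousComponent_isHomogeneous d Q))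
  rintro R ⟨j, n, m, hj, hR⟩
  exact ⟨j, n, m, hj.trans (Nat.lt_succ_iff.1 (Finset.mem_range.1 hd)), hR⟩

/-- Different degrees are separated by harmonicity. For equal degrees, the product of `P` with the
conjugate of `Q` is an eigenvector of `D` with eigenvalue `i(m - m')μ ≠ 0`, while the integral of
`D` of anything is zero. -/
lemma gaussInt_mul_conj_eq_zero {ν : ℝ} (hν : 0 < ν) (h : IsSkewComplex L μ) {n n' : ℕ}
    {m m' : ℤ} {P Q : MvPolynomial (Fin k) ℂ} (hP : P ∈ harmonicSpace L μ n m)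
    (hQ : Q ∈ harmonicSpace L μ n' m') (hne : (n, m) ≠ (n', m')) :
    gaussInt ν (P * polyConj Q) = 0 := by
  obtain ⟨p1, p2, p3⟩ := mem_harmonicSpace.1 hP
  obtain ⟨q1, q2, q3⟩ := mem_harmonicSpace.1 hQ
  by_cases hn : n = n'
  · have hm : m ≠ m' := fun hm => hne (by rw [hn, hm])
    have h1 := gaussInt_polyD hν h (P * polyConj Q)
    have h2 : polyD L (P * polyConj Q) = (Complex.I * m * μ - Complex.I * m' * μ) •
        (P * polyConj Q) := by
      rw [polyD_mul, polyD_polyConj, p3, q3]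
      have : polyConj ((Complex.I * m' * μ) • Q) = (-(Complex.I * m' * μ)) • polyConj Q := by
        rw [MvPolynomial.smul_eq_C_mul, MvPolynomial.smul_eq_C_mul, polyConj, map_mul,
          MvPolynomial.map_C]
        simp [polyConj]
      rw [this]
      simp only [MvPolynomial.smul_eq_C_mul, map_sub, map_neg]
      ring
    rw [h2, gaussInt_smul] at h1
    exact (mul_eq_zero.1 h1).resolve_left (sub_ne_zero.2 fun he => hm (weight_injective h.pos he))
  · refine gaussInt_harmonic_mul_harmonic hν p1 p2 (isHomogeneous_polyConj q1) ?_ hn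
    rw [polyLaplacian_polyConj, q2]; simp [polyConj]

/-- There are non-zero elements of `H^{(n,-n)}`. -/
lemma exists_mem_harmonicSpace_neg (hk : 0 < k) (h : IsSkewComplex L μ) (n : ℕ) :
    ∃ P ∈ harmonicSpace L μ n (-n), P ≠ 0 := by
  let i : Fin k := ⟨0, hk⟩
  have hμ : (μ : ℂ) ≠ 0 := by exact_mod_cast h.pos.ne'
  -- A complex linear coordinate of weight `-1`; its powers are the required polynomials.
  let ζ : MvPolynomial (Fin k) ℂ := (μ : ℂ) • MvPolynomial.X i + Complex.I • coordPoly L i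
  have hζh : ζ.IsHomogeneous 1 := by
    simp only [ζ, MvPolynomial.smul_eq_C_mul]
    exact ((MvPolynomial.isHomogeneous_X ℂ i).C_mul _).add ((isHomogeneous_coordPoly L i).C_mul _)
  have hζD : polyD L ζ = (-(Complex.I * μ)) • ζ := by
    simp only [ζ, map_add, map_smul, polyD_X, polyD_coordPoly h, smul_add, smul_smul]
    rw [add_comm]
    congr 2
    · ring
    · linear_combination (μ : ℂ) * Complex.I_sq
  have hd : ∀ j, MvPolynomial.pderiv j ζ =
      MvPolynomial.C ((μ : ℂ) * (if j = i then 1 else 0) + Complex.I * (L (basisVec j) i : ℝ)) := by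
    intro j
    have h1 := pderiv_coordPoly L i j
    by_cases hj : j = i
    · subst hj; simp [ζ, h1, MvPolynomial.smul_eq_C_mul]
    · simp [ζ, h1, MvPolynomial.pderiv_X_of_ne (Ne.symm hj), MvPolynomial.smul_eq_C_mul, hj]
  -- The constant gradient of `ζ` is isotropic: its real part `μe_i` and its imaginary part, which
  -- is `-L e_i`, are orthogonal and both of length `μ`. Therefore every function of `ζ` is
  -- harmonic.
  have hsum : ∑ j, MvPolynomial.pderiv j ζ * MvPolynomial.pderiv j ζ = 0 := by
    simp only [hd, ← map_mul, ← map_sum]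
    rw [← map_zero MvPolynomial.C]
    congr 1
    have hnorm : ∑ j, L (basisVec j) i * L (basisVec j) i = μ ^ 2 := by
      have h1 := h.skew (basisVec i) (L (basisVec i))
      rw [h.sq, PiLp.inner_apply] at h1
      have h2 : ∑ j, L (basisVec j) i * L (basisVec j) i = ∑ j,
          L (basisVec i) j * L (basisVec i) j :=
        Finset.sum_congr rfl fun j _ => by rw [h.coord]; ring
      rw [h2]
      simpa [basisVec, inner_smul_right, ← sq] using h1
    have hii : L (basisVec i) i = 0 := by linarith [h.coord i i]
    have : ∀ j, ((μ : ℂ) * (if j = i then 1 else 0) + Complex.I * (L (basisVec j) i : ℝ)) *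
        ((μ : ℂ) * (if j = i then 1 else 0) + Complex.I * (L (basisVec j) i : ℝ)) =
        (if j = i then (μ : ℂ) ^ 2 else 0) - ((L (basisVec j) i * L (basisVec j) i : ℝ) : ℂ) := by
      intro j
      by_cases hj : j = i
      · subst hj
        rw [hii]; simp; ring
      · simp only [if_neg hj]; push_cast
        linear_combination ((L (basisVec j) i : ℝ) : ℂ) ^ 2 * Complex.I_sq
    simp only [this, Finset.sum_sub_distrib]
    rw [← Complex.ofReal_sum, hnorm]
    simp
  have hpow : ∀ n : ℕ, polyD L (ζ ^ n) = (Complex.I * ((-(n : ℤ) : ℤ) : ℂ) * μ) • ζ ^ n := by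
    intro n
    induction n with
    | zero => simp only [pow_zero]; rw [← map_one MvPolynomial.C, polyD_C]; simp
    | succ n ih =>
      rw [pow_succ, polyD_mul, ih, hζD]
      simp only [MvPolynomial.smul_eq_C_mul]
      push_cast
      simp only [mul_add, add_mul, map_add, map_neg, neg_add, mul_neg, neg_mul, mul_one]
      ring
  have hne : ζ ≠ 0 := by
    intro h0
    have h1 := hd i
    have hii : L (basisVec i) i = 0 := by linarith [h.coord i i]
    rw [h0, map_zero, hii] at h1
    refine hμ (MvPolynomial.C_injective (Fin k) ℂ ?_)
    simpa using h1.symm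
  refine ⟨ζ ^ n, mem_harmonicSpace.2 ⟨by simpa using hζh.pow n, ?_, hpow n⟩, pow_ne_zero n hne⟩
  rw [polyLaplacian_apply]
  have h2 : ∀ j, MvPolynomial.pderiv j (MvPolynomial.pderiv j (ζ ^ n)) =
      (MvPolynomial.pderiv j ζ * MvPolynomial.pderiv j ζ) * ((n : MvPolynomial (Fin k) ℂ) *
          ((n - 1 : ℕ) : MvPolynomial (Fin k) ℂ) * ζ ^ (n - 1 - 1)) := by
    intro j
    have h3 : MvPolynomial.pderiv j (MvPolynomial.pderiv j ζ) = 0 := by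
      rw [hd, MvPolynomial.pderiv_C]
    have h4 : MvPolynomial.pderiv j (n : MvPolynomial (Fin k) ℂ) = 0 := Derivation.map_natCast _ n
    simp only [h4, Derivation.leibniz_pow, Derivation.leibniz, h3, smul_eq_mul, nsmul_eq_mul]
    ring
  simp only [h2]
  rw [← Finset.sum_mul, hsum, zero_mul]

/-! ### Polar coordinates and spherical harmonics on the unit sphere -/

/-- The surface measure on the unit sphere. -/
abbrev sphereMeasure (k : ℕ) : Measure (Metric.sphere (0 : EuclideanSpace ℝ (Fin k)) 1) :=
  (volume : Measure (EuclideanSpace ℝ (Fin k))).toSphere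

/-- Off the origin, which is a null set since `k > 0`, the map `x ↦ (x/|x|, |x|)` carries Lebesgue
measure to the product of the surface measure and `r^{k-1} dr`; then Fubini. -/
lemma integral_polar {F : Type*} [NormedAddCommGroup F] [NormedSpace ℝ F] (hk : 0 < k)
    {g : EuclideanSpace ℝ (Fin k) → F} (hg : Integrable g) :
    ∫ x, g x = ∫ r in Ioi (0 : ℝ), r ^ (k - 1) •
      ∫ θ, g (r • (θ : EuclideanSpace ℝ (Fin k))) ∂(sphereMeasure k) := by
  have : Nonempty (Fin k) := ⟨⟨0, hk⟩⟩
  have hmp := (volume : Measure (EuclideanSpace ℝ (Fin k))).measurePreserving_homeomorphUnitSphereProd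
  have hdim : Module.finrank ℝ (EuclideanSpace ℝ (Fin k)) = k := by simp
  rw [hdim] at hmp
  have hemb := (homeomorphUnitSphereProd (EuclideanSpace ℝ (Fin k))).measurableEmbedding
  let G : Metric.sphere (0 : EuclideanSpace ℝ (Fin k)) 1 × Ioi (0 : ℝ) → F :=
    fun p => g ((p.2 : ℝ) • (p.1 : EuclideanSpace ℝ (Fin k)))
  have hG : ∀ x : ({0}ᶜ : Set (EuclideanSpace ℝ (Fin k))),
      G (homeomorphUnitSphereProd _ x) = g x := by
    intro x
    have hx : ‖(x : EuclideanSpace ℝ (Fin k))‖ ≠ 0 := norm_ne_zero_iff.2 x.2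
    simp only [G, homeomorphUnitSphereProd_apply_snd_coe, homeomorphUnitSphereProd_apply_fst_coe]
    rw [smul_smul, mul_inv_cancel₀ hx, one_smul]
  have hint : Integrable G ((sphereMeasure k).prod (Measure.volumeIoiPow (k - 1))) := by
    rw [← hmp.integrable_comp_emb hemb]
    have : (G ∘ homeomorphUnitSphereProd (EuclideanSpace ℝ (Fin k))) =
        fun x : ({0}ᶜ : Set (EuclideanSpace ℝ (Fin k))) => g x := funext hG
    rw [this]
    have h1 : IntegrableOn g ({0}ᶜ : Set (EuclideanSpace ℝ (Fin k))) volume := hg.integrableOn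
    exact (integrableOn_iff_comap_subtypeVal (measurableSet_singleton _).compl).1 h1
  calc ∫ x, g x = ∫ x : ({0}ᶜ : Set (EuclideanSpace ℝ (Fin k))), g x
        ∂(Measure.comap Subtype.val volume) := by
        rw [integral_subtype_comap (measurableSet_singleton _).compl g,
          restrict_compl_singleton]
    _ = ∫ p, G p ∂(sphereMeasure k).prod (Measure.volumeIoiPow (k - 1)) := by
        rw [← hmp.integral_comp hemb]
        simp only [hG]
    _ = ∫ r : Ioi (0 : ℝ), ∫ θ, G (θ, r) ∂(sphereMeasure k) ∂(Measure.volumeIoiPow (k - 1)) :=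
        integral_prod_symm _ hint
    _ = _ := by
        simp only [Measure.volumeIoiPow, ENNReal.ofReal, G]
        rw [integral_withDensity_eq_integral_smul,
          integral_subtype_comap measurableSet_Ioi fun a : ℝ => Real.toNNReal (a ^ (k - 1)) •
            ∫ θ, g (a • (θ : EuclideanSpace ℝ (Fin k))) ∂(sphereMeasure k),
          setIntegral_congr_fun measurableSet_Ioi fun x hx => ?_]
        · rw [NNReal.smul_def, Real.coe_toNNReal _ (pow_nonneg (le_of_lt hx) _)]
        · exact (measurable_subtype_coe.pow_const _).real_toNNReal

/-- The inner product of two polynomials over the unit sphere. -/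
def sphereInt (P Q : MvPolynomial (Fin k) ℂ) : ℂ :=
  ∫ θ, polyFun P (θ : EuclideanSpace ℝ (Fin k)) *
    conj (polyFun Q (θ : EuclideanSpace ℝ (Fin k))) ∂(sphereMeasure k)

/-- By homogeneity the radial integral factors out in polar coordinates, and it is a positive
number. This transfers orthogonality and definiteness from the Gaussian pairing to the sphere. -/
lemma gaussInt_eq_sphereInt (hk : 0 < k) {ν : ℝ} (hν : 0 < ν) {n n' : ℕ}
    {P Q : MvPolynomial (Fin k) ℂ} (hP : P.IsHomogeneous n) (hQ : Q.IsHomogeneous n') :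
    ∃ c : ℝ, 0 < c ∧ gaussInt ν (P * polyConj Q) = c * sphereInt P Q := by
  let w : ℝ → ℝ := fun r => r ^ (k - 1 + n + n') * Real.exp (-(ν / 2) * r ^ 2)
  have hw : IntegrableOn w (Ioi 0) := by
    have := integrableOn_rpow_mul_exp_neg_mul_sq (b := ν / 2) (by positivity)
      (s := (k - 1 + n + n' : ℕ)) (lt_of_lt_of_le (by norm_num) (Nat.cast_nonneg _))
    refine this.congr_fun (fun r _ => ?_) measurableSet_Ioi
    simp only [Real.rpow_natCast, w]
  refine ⟨∫ r in Ioi (0 : ℝ), w r, ?_, ?_⟩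
  · rw [setIntegral_pos_iff_support_of_nonneg_ae _ hw]
    · have : Ioi (0 : ℝ) ⊆ Function.support w ∩ Ioi 0 := fun r hr =>
        ⟨mul_ne_zero (pow_ne_zero _ (ne_of_gt hr)) (Real.exp_pos _).ne', hr⟩
      exact lt_of_lt_of_le (by simp) (measure_mono this)
    · filter_upwards [ae_restrict_mem measurableSet_Ioi] with r hr
      exact mul_nonneg (pow_nonneg (le_of_lt hr) _) (Real.exp_nonneg _)
  · rw [gaussInt, integral_polar hk (gaussFn_integrable _ hν), ← integral_complex_ofReal,
      ← integral_mul_const]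
    refine setIntegral_congr_fun measurableSet_Ioi fun r hr => ?_
    have hr' : 0 < r := hr
    have h1 : ∀ θ : Metric.sphere (0 : EuclideanSpace ℝ (Fin k)) 1,
        gaussFn ν (P * polyConj Q) (r • (θ : EuclideanSpace ℝ (Fin k))) =
        ((r : ℂ) ^ (n + n') * Real.exp (-(ν / 2) * r ^ 2)) *
          (polyFun P (θ : EuclideanSpace ℝ (Fin k)) *
            conj (polyFun Q (θ : EuclideanSpace ℝ (Fin k)))) := by
      intro θ
      have h2 : ‖r • (θ : EuclideanSpace ℝ (Fin k))‖ = r := by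
        rw [norm_smul, norm_eq_of_mem_sphere, Real.norm_of_nonneg hr'.le, mul_one]
      rw [gaussFn, polyFun_mul, polyFun_homogeneous hP,
        polyFun_homogeneous (isHomogeneous_polyConj hQ), polyFun_polyConj, h2]
      rw [show -(r ^ 2 * ν / 2) = -(ν / 2) * r ^ 2 by ring]
      ring
    simp only [h1, integral_const_mul, sphereInt, w]
    rw [Complex.real_smul]
    push_cast
    ring

lemma sphereInt_eq_zero (hk : 0 < k) (h : IsSkewComplex L μ) {n n' : ℕ}
    {m m' : ℤ} {P Q : MvPolynomial (Fin k) ℂ} (hP : P ∈ harmonicSpace L μ n m)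
    (hQ : Q ∈ harmonicSpace L μ n' m') (hne : (n, m) ≠ (n', m')) : sphereInt P Q = 0 := by
  obtain ⟨c, hc, h1⟩ := gaussInt_eq_sphereInt hk one_pos (mem_harmonicSpace.1 hP).1
    (mem_harmonicSpace.1 hQ).1
  rw [gaussInt_mul_conj_eq_zero one_pos h hP hQ hne] at h1
  exact (mul_eq_zero.1 h1.symm).resolve_left (by exact_mod_cast hc.ne')

lemma eq_zero_of_sphereInt_self (hk : 0 < k) {n : ℕ} {P : MvPolynomial (Fin k) ℂ}
    (hP : P.IsHomogeneous n) (h : sphereInt P P = 0) : P = 0 := by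
  obtain ⟨c, hc, h1⟩ := gaussInt_eq_sphereInt hk one_pos hP hP
  rw [h, mul_zero] at h1
  exact eq_zero_of_gaussInt_mul_conj one_pos h1

/-- A continuous function on the unit sphere as an element of `L²`. -/
def sphereLp (k : ℕ) : C(Metric.sphere (0 : EuclideanSpace ℝ (Fin k)) 1, ℂ) →L[ℂ]
    Lp ℂ 2 (sphereMeasure k) := ContinuousMap.toLp 2 (sphereMeasure k) ℂ

lemma inner_sphereLp (f g : C(Metric.sphere (0 : EuclideanSpace ℝ (Fin k)) 1, ℂ)) :
    ⟪sphereLp k f, sphereLp k g⟫_ℂ = ∫ θ, g θ * conj (f θ) ∂(sphereMeasure k) :=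
  ContinuousMap.inner_toLp (𝕜 := ℂ) (sphereMeasure k) f g

lemma norm_sq_sphereLp (f : C(Metric.sphere (0 : EuclideanSpace ℝ (Fin k)) 1, ℂ)) :
    ‖sphereLp k f‖ ^ 2 = ∫ θ, ‖f θ‖ ^ 2 ∂(sphereMeasure k) := by
  have h := inner_sphereLp f f
  rw [inner_self_eq_norm_sq_to_K] at h
  have h2 : ∀ θ, f θ * conj (f θ) = ((‖f θ‖ ^ 2 : ℝ) : ℂ) := fun θ => by
    rw [Complex.mul_conj, Complex.normSq_eq_norm_sq]
  simp only [h2, integral_complex_ofReal] at h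
  exact Complex.ofReal_injective (by simpa using h)

/-- The restriction of a polynomial to the unit sphere. -/
def sphereRestrict (k : ℕ) :
    MvPolynomial (Fin k) ℂ →ₗ[ℂ] C(Metric.sphere (0 : EuclideanSpace ℝ (Fin k)) 1, ℂ) where
  toFun P := ⟨fun θ => polyFun P θ, (polyFun_continuous P).comp continuous_subtype_val⟩
  map_add' P Q := by ext θ; simp [polyFun_add]
  map_smul' c P := by ext θ; simp [polyFun_smul]

lemma inner_sphereRestrict (P Q : MvPolynomial (Fin k) ℂ) :
    ⟪sphereLp k (sphereRestrict k P), sphereLp k (sphereRestrict k Q)⟫_ℂ = sphereInt Q P :=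
  inner_sphereLp _ _

/-- There is a basis of `H^{(n,m)}` that is orthonormal over the unit sphere. -/
lemma exists_orthonormal_basis (hk : 0 < k) (n : ℕ) (m : ℤ) :
    ∃ (d : ℕ) (e : Fin d → MvPolynomial (Fin k) ℂ), (∀ j, e j ∈ harmonicSpace L μ n m) ∧
      (∀ i j, sphereInt (e i) (e j) = if i = j then 1 else 0) ∧
      ∀ P ∈ harmonicSpace L μ n m, P = ∑ j, sphereInt P (e j) • e j := by
  let Φ : MvPolynomial (Fin k) ℂ →ₗ[ℂ] Lp ℂ 2 (sphereMeasure k) :=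
    (sphereLp k).toLinearMap ∘ₗ sphereRestrict k
  let K := (harmonicSpace L μ n m).map Φ
  let b := stdOrthonormalBasis ℂ K
  have hb : ∀ j, ∃ P ∈ harmonicSpace L μ n m, Φ P = b j := fun j => Submodule.mem_map.1 (b j).2
  choose e he1 he2 using hb
  have hin : ∀ P Q, ⟪Φ P, Φ Q⟫_ℂ = sphereInt Q P := inner_sphereRestrict
  refine ⟨_, e, he1, fun i j => ?_, fun P hP => ?_⟩
  · rw [← hin, he2, he2, ← Submodule.coe_inner, orthonormal_iff_ite.1 b.orthonormal]
    simp only [eq_comm]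
  · have h1 : Φ P = ∑ j, sphereInt P (e j) • Φ (e j) := by
      have h2 := congrArg Subtype.val (b.sum_repr' ⟨Φ P, Submodule.mem_map_of_mem hP⟩)
      simp only [Submodule.coe_sum, Submodule.coe_smul, Submodule.coe_inner] at h2
      rw [← h2]
      exact Finset.sum_congr rfl fun j _ => by rw [← hin, he2]
    have hR : P - ∑ j, sphereInt P (e j) • e j ∈ harmonicSpace L μ n m :=
      Submodule.sub_mem _ hP (Submodule.sum_mem _ fun j _ => Submodule.smul_mem _ _ (he1 j))
    -- The expansion holds in `L²` of the sphere. It lifts to polynomials because the difference is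
    -- homogeneous, and a homogeneous polynomial of norm zero on the sphere is zero.
    have h3 : Φ (P - ∑ j, sphereInt P (e j) • e j) = 0 := by
      rw [map_sub, map_sum, h1, sub_eq_zero]
      exact Finset.sum_congr rfl fun j _ => by rw [map_smul]
    have h4 : sphereInt (P - ∑ j, sphereInt P (e j) • e j) (P - ∑ j, sphereInt P (e j) • e j) =
        0 := by
      rw [← hin, h3, inner_zero_left]
    exact sub_eq_zero.1 (eq_zero_of_sphereInt_self hk (mem_harmonicSpace.1 hR).1 h4)

/-! ### Separation of variables -/

lemma hasFDerivAt_comp_normSq {f : ℝ → ℂ} {f' : ℂ} {x : EuclideanSpace ℝ (Fin k)}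
    (hf : HasDerivAt f f' (‖x‖ ^ 2)) :
    HasFDerivAt (fun y : EuclideanSpace ℝ (Fin k) => f (‖y‖ ^ 2))
      ((ContinuousLinearMap.toSpanSingleton ℝ f').comp (2 • innerSL ℝ x)) x :=
  hf.hasFDerivAt.comp x (hasStrictFDerivAt_norm_sq x).hasFDerivAt

lemma fderiv_productFn {f : ℝ → ℂ} {x : EuclideanSpace ℝ (Fin k)}
    (hf : DifferentiableAt ℝ f (‖x‖ ^ 2)) (P : MvPolynomial (Fin k) ℂ)
    (v : EuclideanSpace ℝ (Fin k)) :
    fderiv ℝ (productFn f P) x v = deriv f (‖x‖ ^ 2) * (2 * (⟪x, v⟫_ℝ : ℝ)) * polyFun P x +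
      f (‖x‖ ^ 2) * fderiv ℝ (polyFun P) x v := by
  have h := ((hasFDerivAt_comp_normSq hf.hasDerivAt).mul
    (polyFun_differentiable P x).hasFDerivAt).fderiv
  have h' : fderiv ℝ (productFn f P) x = _ := h
  rw [h']
  simp
  ring

lemma differentiableAt_productFn {f : ℝ → ℂ} {x : EuclideanSpace ℝ (Fin k)}
    (hf : DifferentiableAt ℝ f (‖x‖ ^ 2)) (P : MvPolynomial (Fin k) ℂ) :
    DifferentiableAt ℝ (productFn f P) x :=
  ((hasFDerivAt_comp_normSq hf.hasDerivAt).mul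
    (polyFun_differentiable P x).hasFDerivAt).differentiableAt

lemma contDiffAt_productFn {f : ℝ → ℂ} {x : EuclideanSpace ℝ (Fin k)} {N : ℕ∞}
    (hf : ContDiffAt ℝ N f (‖x‖ ^ 2)) (P : MvPolynomial (Fin k) ℂ) :
    ContDiffAt ℝ N (productFn f P) x :=
  (hf.comp x (contDiff_norm_sq ℝ).contDiffAt).mul
    ((polyFun_contDiff P).contDiffAt.of_le (by exact_mod_cast le_top))

lemma fderiv_productFn_basisVec {f : ℝ → ℂ} {x : EuclideanSpace ℝ (Fin k)}
    (hf : DifferentiableAt ℝ f (‖x‖ ^ 2)) (P : MvPolynomial (Fin k) ℂ) (i : Fin k) :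
    fderiv ℝ (productFn f P) x (basisVec i) =
      productFn (deriv f) ((2 : ℂ) • (MvPolynomial.X i * P)) x +
        productFn f (MvPolynomial.pderiv i P) x := by
  rw [fderiv_productFn hf, fderiv_polyFun_basisVec]
  simp only [productFn, polyFun_smul, polyFun_mul, polyFun_X]
  simp [basisVec, EuclideanSpace.inner_single_right]
  ring

/-- The `4n` comes from the cross term `2∇f(|x|²)·∇P = 4f'∑ x_i ∂_i P` and Euler's identity, the
`2k` from `Δ|x|²`; the term with `ΔP` drops out. -/
lemma laplacian_productFn {f : ℝ → ℂ} {x : EuclideanSpace ℝ (Fin k)}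
    (hf : ContDiffAt ℝ 2 f (‖x‖ ^ 2)) {n : ℕ} {P : MvPolynomial (Fin k) ℂ}
    (hP : P.IsHomogeneous n) (hP' : polyLaplacian k P = 0) :
    Laplacian.laplacian (productFn f P) x =
      (4 * ‖x‖ ^ 2 * iteratedDeriv 2 f (‖x‖ ^ 2) + (2 * k + 4 * n) * deriv f (‖x‖ ^ 2)) *
        polyFun P x := by
  have hev : ∀ᶠ t in 𝓝 (‖x‖ ^ 2), DifferentiableAt ℝ f t := by
    filter_upwards [hf.eventually (by norm_num)] with t ht
    exact ht.differentiableAt (by norm_num)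
  have hev' : ∀ᶠ y in 𝓝 x, DifferentiableAt ℝ f (‖y‖ ^ 2) :=
    ((continuous_norm.pow 2).tendsto x).eventually hev
  have hd : DifferentiableAt ℝ (deriv f) (‖x‖ ^ 2) := by
    have h1 : ContDiffAt ℝ 1 (fderiv ℝ f) (‖x‖ ^ 2) := hf.fderiv_right (by norm_num)
    have h2 : deriv f = fun t => fderiv ℝ f t 1 := by ext t; simp
    rw [h2]
    exact (h1.differentiableAt (by norm_num)).clm_apply (differentiableAt_const _)
  rw [laplacian_eq_sum_fderiv (contDiffAt_productFn (N := 2) hf P)]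
  have h1 : ∀ i : Fin k, fderiv ℝ (fun y => fderiv ℝ (productFn f P) y (basisVec i)) x
      (basisVec i) =
      iteratedDeriv 2 f (‖x‖ ^ 2) * (4 * (x i : ℂ) ^ 2 * polyFun P x) +
      deriv f (‖x‖ ^ 2) * (2 * polyFun P x +
        4 * polyFun (MvPolynomial.X i * MvPolynomial.pderiv i P) x) +
      f (‖x‖ ^ 2) * polyFun (MvPolynomial.pderiv i (MvPolynomial.pderiv i P)) x := by
    intro i
    have he : (fun y => fderiv ℝ (productFn f P) y (basisVec i)) =ᶠ[𝓝 x]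
        fun y => productFn (deriv f) ((2 : ℂ) • (MvPolynomial.X i * P)) y +
          productFn f (MvPolynomial.pderiv i P) y := by
      filter_upwards [hev'] with y hy
      exact fderiv_productFn_basisVec hy P i
    rw [he.fderiv_eq, fderiv_fun_add (differentiableAt_productFn hd _)
      (differentiableAt_productFn hev.self_of_nhds _)]
    rw [_root_.add_apply, fderiv_productFn_basisVec hd, fderiv_productFn_basisVec hev.self_of_nhds]
    simp only [productFn, polyFun_smul, polyFun_mul, polyFun_X, Derivation.map_smul,
      Derivation.leibniz, polyFun_add, MvPolynomial.pderiv_X_self, smul_eq_mul, polyFun_one,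
      iteratedDeriv_succ, iteratedDeriv_zero]
    ring
  have h2 : (∑ i, (x i : ℂ) ^ 2) = (‖x‖ : ℂ) ^ 2 := by
    have := polyFun_normSqPoly x
    simp only [normSqPoly, polyFun_sum, polyFun_pow, polyFun_X] at this
    rw [this]; push_cast; rfl
  have h3 : ∑ i, polyFun (MvPolynomial.X i * MvPolynomial.pderiv i P) x = n * polyFun P x := by
    rw [← polyFun_sum, hP.sum_X_mul_pderiv, ← Nat.cast_smul_eq_nsmul ℂ, polyFun_smul]
  have h4 : ∑ i, polyFun (MvPolynomial.pderiv i (MvPolynomial.pderiv i P)) x = 0 := by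
    rw [← polyFun_sum, ← polyLaplacian_apply, hP', polyFun_zero]
  simp only [h1, Finset.sum_add_distrib, ← Finset.mul_sum, ← Finset.sum_mul, h2, h3, h4,
    Finset.sum_const, Finset.card_univ, Fintype.card_fin, nsmul_eq_mul]
  ring

/-- `D` does not see `f(|x|²)` because `⟨L x, x⟩ = 0`, and on `P` the term `2iD` is multiplication
by `2i·imμ = -2mμ`. -/
lemma glz_productFn (h : IsSkewComplex L μ) {f : ℝ → ℂ} {x : EuclideanSpace ℝ (Fin k)}
    (hf : ContDiffAt ℝ 2 f (‖x‖ ^ 2)) {n : ℕ} {m : ℤ} {P : MvPolynomial (Fin k) ℂ}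
    (hP : P ∈ harmonicSpace L μ n m) :
    glz L μ (productFn f P) x = radialOp k μ n m f (‖x‖ ^ 2) * polyFun P x := by
  obtain ⟨h1, h2, h3⟩ := mem_harmonicSpace.1 hP
  rw [glz, laplacian_productFn hf h1 h2, fderiv_productFn (hf.differentiableAt (by norm_num)),
    real_inner_comm, h.inner_self, fderiv_polyFun_map, h3, polyFun_smul, radialOp, productFn]
  push_cast
  linear_combination 2 * f (‖x‖ ^ 2) * m * μ * polyFun P x * Complex.I_sq

/-- The exponent is chosen so that the potential term `μ²t` cancels. What remains is an equation of
Laguerre type for `g`, with coefficients at most linear in `t`. -/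
lemma radialOp_mul_exp (n : ℕ) (m : ℤ) (μ : ℝ) {g g1 g2 : ℝ → ℂ}
    (h1 : ∀ t, HasDerivAt g (g1 t) t) (h2 : ∀ t, HasDerivAt g1 (g2 t) t) (t : ℝ) :
    radialOp k μ n m (fun t => g t * Real.exp (-(t * μ / 2))) t =
      (4 * t * g2 t + (2 * k + 4 * n - 4 * μ * t) * g1 t -
        (2 * m * μ + 4 * μ ^ 2 + (k + 2 * n) * μ) * g t) * Real.exp (-(t * μ / 2)) := by
  have hE : ∀ t : ℝ, HasDerivAt (fun t : ℝ => ((Real.exp (-(t * μ / 2)) : ℝ) : ℂ))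
      (-(μ / 2) * Real.exp (-(t * μ / 2))) t := by
    intro t
    have h3 : HasDerivAt (fun t : ℝ => -(t * μ / 2)) (-(μ / 2)) t := by
      have := (hasDerivAt_id t).mul_const (-(μ / 2))
      rw [one_mul] at this
      exact this.congr_of_eventuallyEq (Filter.Eventually.of_forall fun s => by simp; ring)
    have h4 := h3.exp.ofReal_comp
    refine h4.congr_deriv ?_
    push_cast; ring
  have d1 : ∀ t, HasDerivAt (fun t => g t * Real.exp (-(t * μ / 2)))
      ((g1 t - μ / 2 * g t) * Real.exp (-(t * μ / 2))) t := by
    intro t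
    refine ((h1 t).mul (hE t)).congr_deriv ?_
    ring
  have d2 : ∀ t, HasDerivAt (fun t => (g1 t - μ / 2 * g t) * (Real.exp (-(t * μ / 2)) : ℂ))
      ((g2 t - μ * g1 t + μ ^ 2 / 4 * g t) * Real.exp (-(t * μ / 2))) t := by
    intro t
    refine (((h2 t).sub ((h1 t).const_mul ((μ : ℂ) / 2))).mul (hE t)).congr_deriv ?_
    simp only [Pi.sub_apply]
    ring
  have e1 : deriv (fun t => g t * (Real.exp (-(t * μ / 2)) : ℂ)) =
      fun t => (g1 t - μ / 2 * g t) * (Real.exp (-(t * μ / 2)) : ℂ) := funext fun t => (d1 t).deriv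
  rw [radialOp, iteratedDeriv_succ, iteratedDeriv_one, e1, (d2 t).deriv]
  ring

/-! ### Laguerre polynomials and the explicit eigenfunctions -/

lemma hasDerivAt_eval_mul (u : Polynomial ℂ) (μ t : ℝ) :
    HasDerivAt (fun t : ℝ => u.eval ((μ * t : ℝ) : ℂ))
      (μ * (Polynomial.derivative u).eval ((μ * t : ℝ) : ℂ)) t := by
  have h1 : HasDerivAt (fun t : ℝ => ((μ * t : ℝ) : ℂ)) μ t := by
    simpa using ((hasDerivAt_id t).const_mul μ).ofReal_comp
  have h2 := (u.hasDerivAt ((μ * t : ℝ) : ℂ)).comp t h1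
  rw [mul_comm]; exact h2

lemma expRadial_contDiff (μ : ℝ) (u : Polynomial ℂ) : ContDiff ℝ ∞ (expRadial μ u) := by
  have h1 : ContDiff ℝ ∞ fun t : ℝ => u.eval ((μ * t : ℝ) : ℂ) := by
    have h2 : ContDiff ℝ ∞ fun t : ℝ => ((μ * t : ℝ) : ℂ) :=
      Complex.ofRealCLM.contDiff.comp (contDiff_const.mul contDiff_id)
    exact ((u.differentiable.contDiff (n := ∞)).restrict_scalars ℝ).comp h2
  refine h1.mul (Complex.ofRealCLM.contDiff.comp (Real.contDiff_exp.comp ?_))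
  exact ((contDiff_id.mul contDiff_const).div_const _).neg

lemma radialOp_expRadial (n : ℕ) (m : ℤ) (μ : ℝ) (u : Polynomial ℂ) (t : ℝ) :
    radialOp k μ n m (expRadial μ u) t =
      μ * (4 * (μ * t : ℝ) * (Polynomial.derivative (Polynomial.derivative u)).eval
          ((μ * t : ℝ) : ℂ) +
        (2 * k + 4 * n - 4 * (μ * t : ℝ)) * (Polynomial.derivative u).eval ((μ * t : ℝ) : ℂ) -
        (2 * m + 4 * μ + (k + 2 * n)) * u.eval ((μ * t : ℝ) : ℂ)) * Real.exp (-(t * μ / 2)) := by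
  have h := radialOp_mul_exp (k := k) n m μ (hasDerivAt_eval_mul u μ)
    (fun t => (hasDerivAt_eval_mul (Polynomial.derivative u) μ t).const_mul (μ : ℂ)) t
  have h' : radialOp k μ n m (expRadial μ u) t = _ := h
  rw [h']
  push_cast
  ring

lemma laguerre_coeff (r : ℕ) (a : ℝ) (i : ℕ) : (laguerre r a).coeff i = if i ≤ r then
    ((-1) ^ i * (∏ j ∈ Finset.range (r - i), ((a : ℂ) + i + 1 + j)) /
      ((r - i).factorial * i.factorial)) else 0 := by
  simp only [laguerre, Polynomial.finsetSum_coeff, Polynomial.coeff_monomial]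
  split_ifs with h
  · rw [Finset.sum_eq_single i]
    · simp
    · intro b _ hb; simp [hb]
    · intro hi; exact absurd (Finset.mem_range.2 (by omega)) hi
  · refine Finset.sum_eq_zero fun j hj => ?_
    rw [if_neg]; have := Finset.mem_range.1 hj; omega

/-- The two-term recursion equivalent to Laguerre's equation. At `i = r` both sides vanish, which is
why the polynomial stops at degree `r`. -/
lemma laguerre_coeff_succ (r : ℕ) (a : ℝ) (i : ℕ) :
    ((i : ℂ) + 1) * (i + (a + 1)) * (laguerre r a).coeff (i + 1) =
      (i - r) * (laguerre r a).coeff i := by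
  rw [laguerre_coeff, laguerre_coeff]
  rcases lt_trichotomy i r with h | h | h
  · rw [if_pos (by omega), if_pos (by omega)]
    obtain ⟨d, rfl⟩ : ∃ d, r = i + 1 + d := ⟨r - i - 1, by omega⟩
    rw [show i + 1 + d - (i + 1) = d by omega, show i + 1 + d - i = d + 1 by omega,
      Finset.prod_range_succ']
    have h1 : ∀ j : ℕ, (a : ℂ) + ((i + 1 : ℕ) : ℂ) + 1 + j = a + i + 1 + ((j + 1 : ℕ) : ℂ) := by
      intro j; push_cast; ring
    simp only [h1, Nat.factorial_succ]
    have h2 : (d.factorial : ℂ) ≠ 0 := by exact_mod_cast d.factorial_ne_zero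
    have h3 : (i.factorial : ℂ) ≠ 0 := by exact_mod_cast i.factorial_ne_zero
    have h4 : (d : ℂ) + 1 ≠ 0 := by exact_mod_cast d.succ_ne_zero
    have h5 : (i : ℂ) + 1 ≠ 0 := by exact_mod_cast i.succ_ne_zero
    push_cast
    field_simp
    ring
  · subst h; simp
  · rw [if_neg (by omega), if_neg (by omega)]; simp

lemma coeff_laguerreOp (u : Polynomial ℂ) (b : ℂ) (i : ℕ) :
    (Polynomial.X * Polynomial.derivative (Polynomial.derivative u) +
      (Polynomial.C b - Polynomial.X) * Polynomial.derivative u).coeff i =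
      (i + 1) * (i + b) * u.coeff (i + 1) - i * u.coeff i := by
  cases i with
  | zero => simp [sub_mul, Polynomial.coeff_derivative]
  | succ i =>
    simp [sub_mul, Polynomial.coeff_derivative, Polynomial.coeff_X_mul]
    ring

lemma laguerre_ode (r : ℕ) (a : ℝ) (s : ℂ) :
    s * (Polynomial.derivative (Polynomial.derivative (laguerre r a))).eval s +
      ((a + 1) - s) * (Polynomial.derivative (laguerre r a)).eval s =
      -(r * (laguerre r a).eval s) := by
  have h : Polynomial.X * Polynomial.derivative (Polynomial.derivative (laguerre r a)) +
      (Polynomial.C ((a : ℂ) + 1) - Polynomial.X) * Polynomial.derivative (laguerre r a) =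
      -(Polynomial.C (r : ℂ) * laguerre r a) := by
    ext i
    rw [coeff_laguerreOp, laguerre_coeff_succ]
    simp only [Polynomial.coeff_neg, Polynomial.coeff_C_mul]
    ring
  have h2 := congrArg (Polynomial.eval s) h
  simpa using h2

lemma radialOp_laguerre (r n : ℕ) (m : ℤ) (μ t : ℝ) :
    radialOp k μ n m (expRadial μ (laguerre r ((k : ℝ) / 2 + n - 1))) t =
      nu k μ r n m * expRadial μ (laguerre r ((k : ℝ) / 2 + n - 1)) t := by
  have h := laguerre_ode r ((k : ℝ) / 2 + n - 1) ((μ * t : ℝ) : ℂ)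
  rw [radialOp_expRadial, expRadial, nu]
  push_cast at h ⊢
  linear_combination 4 * μ * Complex.exp (-(t * μ / 2)) * h

lemma laguerre_degree (r : ℕ) (a : ℝ) : (laguerre r a).degree = r := by
  have hc : (laguerre r a).coeff r ≠ 0 := by
    rw [laguerre_coeff, if_pos le_rfl]
    simp [Nat.factorial_ne_zero]
  refine le_antisymm ((Polynomial.degree_le_iff_coeff_zero _ _).2 fun i hi => ?_)
    (Polynomial.le_degree_of_ne_zero hc)
  rw [laguerre_coeff, if_neg]
  have : r < i := by exact_mod_cast hi
  omega

lemma laguerre_coeff_zero_ne (r : ℕ) {a : ℝ} (ha : 0 < a + 1) : (laguerre r a).coeff 0 ≠ 0 := by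
  rw [laguerre_coeff, if_pos (Nat.zero_le _)]
  refine div_ne_zero (mul_ne_zero (by simp) (Finset.prod_ne_zero_iff.2 fun j _ => ?_))
    (by simp [Nat.factorial_ne_zero])
  have : ((a : ℂ) + (0 : ℕ) + 1 + j) = ((a + 1 + j : ℝ) : ℂ) := by push_cast; ring
  rw [this]
  have h2 : 0 < a + 1 + j := by positivity
  exact_mod_cast h2.ne'

/-- The eigenvalue equation is a two-term recursion on the coefficients. Its leading coefficient
forces the eigenvalue, and as `(i + 1)(i + a + 1)` never vanishes for `a + 1 = k/2 + n > 0`, the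
constant coefficient determines the rest. -/
lemma laguerre_unique (hk : 0 < k) (r n : ℕ) (m : ℤ) (u : Polynomial ℂ) :
    (u.degree = r ∧ ∃ c : ℂ, ∀ t : ℝ,
        radialOp k 1 n m (expRadial 1 u) t = c * expRadial 1 u t) ↔
      ∃ c : ℂ, c ≠ 0 ∧ u = Polynomial.C c * laguerre r ((k : ℝ) / 2 + n - 1) := by
  have ha : 0 < (k : ℝ) / 2 + n - 1 + 1 := by
    have : (0 : ℝ) < k := by exact_mod_cast hk
    have : (0 : ℝ) < (k : ℝ) / 2 + n := by positivity
    linarith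
  set a : ℝ := (k : ℝ) / 2 + n - 1 with ha_def
  constructor
  · rintro ⟨hu, c, hc⟩
    -- The eigenvalue normalised so that the equation reads `s u'' + (a + 1 - s)u' = C u`;
    -- comparison at degree `r` gives `C = -r`.
    set C : ℂ := (c + 2 * m + 4 + (k + 2 * n)) / 4 with hC
    have hpoly : Polynomial.X * Polynomial.derivative (Polynomial.derivative u) +
        (Polynomial.C ((a : ℂ) + 1) - Polynomial.X) * Polynomial.derivative u =
        Polynomial.C C * u := by
      refine Polynomial.eq_of_infinite_eval_eq _ _ ((Set.infinite_range_of_injective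
        Complex.ofReal_injective).mono ?_)
      rintro _ ⟨t, rfl⟩
      have h := hc t
      rw [radialOp_expRadial, expRadial] at h
      have hE : ((Real.exp (-(t * 1 / 2)) : ℝ) : ℂ) ≠ 0 := by exact_mod_cast (Real.exp_pos _).ne'
      rw [← mul_assoc] at h
      have h2 := mul_right_cancel₀ hE h
      simp only [Set.mem_ofPred_eq, Polynomial.eval_add, Polynomial.eval_mul, Polynomial.eval_sub,
        Polynomial.eval_X, Polynomial.eval_C]
      rw [hC, ha_def]
      push_cast at h2 ⊢
      simp only [one_mul] at h2
      linear_combination h2 / 4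
    have hrec : ∀ i : ℕ, ((i : ℂ) + 1) * (i + (a + 1)) * u.coeff (i + 1) = (i + C) * u.coeff i := by
      intro i
      have h := congrArg (fun p => Polynomial.coeff p i) hpoly
      simp only [coeff_laguerreOp, Polynomial.coeff_C_mul] at h
      linear_combination h
    have hur : u.coeff r ≠ 0 := Polynomial.coeff_ne_zero_of_eq_degree hu
    have hCr : C = -r := by
      have h := hrec r
      rw [Polynomial.coeff_eq_zero_of_degree_lt (by rw [hu]; exact_mod_cast r.lt_succ_self),
        mul_zero] at h
      have := (mul_eq_zero.1 h.symm).resolve_right hur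
      linear_combination this
    have h0 := laguerre_coeff_zero_ne r ha
    have hz : ∀ i, u.coeff i = u.coeff 0 / (laguerre r a).coeff 0 * (laguerre r a).coeff i := by
      intro i
      induction i with
      | zero => field_simp
      | succ i ih =>
        have h1 := hrec i
        have h2 := laguerre_coeff_succ r a i
        have h3 : ((i : ℂ) + 1) * (i + (a + 1)) ≠ 0 := by
          refine mul_ne_zero (by exact_mod_cast i.succ_ne_zero) ?_
          have h4 : 0 < (i : ℝ) + (a + 1) := by positivity
          exact_mod_cast h4.ne'
        refine mul_left_cancel₀ h3 ?_
        rw [h1, ih, hCr]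
        linear_combination (-(u.coeff 0 / (laguerre r a).coeff 0)) * h2
    have hu' : u = Polynomial.C (u.coeff 0 / (laguerre r a).coeff 0) * laguerre r a := by
      ext i; rw [hz i, Polynomial.coeff_C_mul]
    refine ⟨_, fun hc0 => ?_, hu'⟩
    rw [hc0, map_zero, zero_mul] at hu'
    rw [hu'] at hur
    simp at hur
  · rintro ⟨c, hc, rfl⟩
    refine ⟨by rw [Polynomial.degree_C_mul hc, laguerre_degree], nu k 1 r n m, fun t => ?_⟩
    have h := laguerre_ode r a ((1 * t : ℝ) : ℂ)
    rw [radialOp_expRadial, expRadial, nu]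
    simp only [Polynomial.derivative_C_mul, Polynomial.eval_mul, Polynomial.eval_C]
    rw [ha_def] at h ⊢
    push_cast at h ⊢
    linear_combination 4 * c * Complex.exp (-(t * 1 / 2)) * h

lemma glz_laguerreFn (h : IsSkewComplex L μ) {r n : ℕ} {m : ℤ} {P : MvPolynomial (Fin k) ℂ}
    (hP : P ∈ harmonicSpace L μ n m) (x : EuclideanSpace ℝ (Fin k)) :
    glz L μ (laguerreFn μ r n P) x = nu k μ r n m * laguerreFn μ r n P x := by
  rw [laguerreFn, glz_productFn h ((expRadial_contDiff _ _).of_le (by norm_cast)).contDiffAt hP,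
    radialOp_laguerre, productFn, mul_assoc]

/-- The polynomial `u(μ|x|²) P(x)`. -/
def radialPoly (μ : ℝ) (u : Polynomial ℂ) (P : MvPolynomial (Fin k) ℂ) : MvPolynomial (Fin k) ℂ :=
  Polynomial.aeval ((μ : ℂ) • normSqPoly k) u * P

lemma polyFun_aeval (u : Polynomial ℂ) (Q : MvPolynomial (Fin k) ℂ) (x) :
    polyFun (Polynomial.aeval Q u) x = u.eval (polyFun Q x) := by
  induction u using Polynomial.induction_on' with
  | add p q hp hq => simp [polyFun_add, hp, hq]
  | monomial n a => simp [polyFun, MvPolynomial.algebraMap_eq, Polynomial.aeval_monomial]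

lemma productFn_expRadial (μ : ℝ) (u : Polynomial ℂ) (P : MvPolynomial (Fin k) ℂ) :
    productFn (expRadial μ u) P = gaussFn μ (radialPoly μ u P) := by
  ext x
  rw [productFn, expRadial, gaussFn, radialPoly, polyFun_mul, polyFun_aeval, polyFun_smul,
    polyFun_normSqPoly]
  push_cast
  ring

lemma laguerreFn_eq_gaussFn (μ : ℝ) (r n : ℕ) (P : MvPolynomial (Fin k) ℂ) :
    laguerreFn μ r n P = gaussFn μ (radialPoly μ (laguerre r ((k : ℝ) / 2 + n - 1)) P) :=
  productFn_expRadial _ _ _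

lemma laguerreFn_memLp (hμ : 0 < μ) (r n : ℕ) (P : MvPolynomial (Fin k) ℂ) :
    MemLp (laguerreFn μ r n P) 2 volume := by
  rw [laguerreFn_eq_gaussFn]; exact gaussFn_memLp _ hμ

/-! ### Green's identity -/

lemma continuous_mul_of_tsupport {X : Type*} [TopologicalSpace X] {w G : X → ℂ} {U : Set X}
    (hw : Continuous w) (hU : IsOpen U) (hs : tsupport w ⊆ U) (hG : ContinuousOn G U) :
    Continuous fun x => w x * G x :=
  continuous_of_tsupport fun _ hx => hw.continuousAt.mul
    (hG.continuousAt (hU.mem_nhds (hs (tsupport_mul_subset_left hx))))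

lemma integrable_mul_of_tsupport {w G : EuclideanSpace ℝ (Fin k) → ℂ}
    {U : Set (EuclideanSpace ℝ (Fin k))} (hw : Continuous w) (hc : HasCompactSupport w)
    (hU : IsOpen U) (hs : tsupport w ⊆ U) (hG : ContinuousOn G U) :
    Integrable fun x => w x * G x :=
  (continuous_mul_of_tsupport hw hU hs hG).integrable_of_hasCompactSupport hc.mul_right

lemma contDiff_partial {w : EuclideanSpace ℝ (Fin k) → ℂ} {N M : WithTop ℕ∞} (hw : ContDiff ℝ N w)
    (hMN : M + 1 ≤ N) (v : EuclideanSpace ℝ (Fin k)) : ContDiff ℝ M fun x => fderiv ℝ w x v :=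
  (hw.fderiv_right hMN).clm_apply contDiff_const

lemma tsupport_partial_subset (w : EuclideanSpace ℝ (Fin k) → ℂ) (v : EuclideanSpace ℝ (Fin k)) :
    tsupport (fun x => fderiv ℝ w x v) ⊆ tsupport w := by
  refine (closure_mono fun x hx => ?_ : _ ⊆ tsupport (fderiv ℝ w)).trans (tsupport_fderiv_subset ℝ)
  intro h0
  exact hx (by simp [h0])

lemma integral_mul_partial {w F : EuclideanSpace ℝ (Fin k) → ℂ}
    {U : Set (EuclideanSpace ℝ (Fin k))} (hw : ContDiff ℝ 1 w) (hc : HasCompactSupport w)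
    (hU : IsOpen U) (hs : tsupport w ⊆ U) (hF : ContDiffOn ℝ 1 F U) (v : EuclideanSpace ℝ (Fin k)) :
    ∫ x, w x * fderiv ℝ F x v = -∫ x, fderiv ℝ w x v * F x := by
  have hF' : ContinuousOn (fun x => fderiv ℝ F x v) U :=
    (hF.continuousOn_fderiv_of_isOpen hU le_rfl).clm_apply continuousOn_const
  have hw' := (contDiff_partial (M := 0) hw (by simp) v).continuous
  have hs' : tsupport (fun x => fderiv ℝ w x v) ⊆ tsupport w := tsupport_partial_subset w v
  have hc' : HasCompactSupport fun x => fderiv ℝ w x v :=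
    hc.of_isClosed_subset (isClosed_tsupport _) hs'
  exact integral_mul_fderiv_eq_neg_fderiv_mul_of_integrable
    (integrable_mul_of_tsupport hw' hc' hU (hs'.trans hs) hF.continuousOn)
    (integrable_mul_of_tsupport hw.continuous hc hU hs hF')
    (integrable_mul_of_tsupport hw.continuous hc hU hs hF.continuousOn)
    (fun x _ => hw.differentiable (by norm_num) x)
    (fun x hx => (hF.contDiffAt (hU.mem_nhds (hs hx))).differentiableAt (by norm_num))

lemma fderiv_map_eq_sum (F : EuclideanSpace ℝ (Fin k) → ℂ) (x) :
    fderiv ℝ F x (L x) = ∑ j, (L x j : ℂ) * fderiv ℝ F x (basisVec j) := by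
  conv_lhs => rw [eq_sum_basisVec (L x)]
  simp

/-- `D` is antisymmetric because its coefficient `(L x)_j` does not depend on `x_j`: the diagonal of
a skew matrix is zero, so integration by parts in `x_j` leaves no extra term. -/
lemma integral_mul_fderiv_map (h : IsSkewComplex L μ) {w F : EuclideanSpace ℝ (Fin k) → ℂ}
    {U : Set (EuclideanSpace ℝ (Fin k))} (hw : ContDiff ℝ 1 w) (hc : HasCompactSupport w)
    (hU : IsOpen U) (hs : tsupport w ⊆ U) (hF : ContDiffOn ℝ 1 F U) :
    ∫ x, w x * fderiv ℝ F x (L x) = -∫ x, fderiv ℝ w x (L x) * F x := by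
  have hL : Continuous L := L.continuous_of_finiteDimensional
  let Lc : EuclideanSpace ℝ (Fin k) →L[ℝ] EuclideanSpace ℝ (Fin k) := ⟨L, hL⟩
  let c : Fin k → EuclideanSpace ℝ (Fin k) →L[ℝ] ℂ := fun j =>
    Complex.ofRealCLM.comp ((EuclideanSpace.proj (𝕜 := ℝ) j).comp Lc)
  have hcj : ∀ j x, c j x = (L x j : ℂ) := fun j x => rfl
  have hF' : ∀ j : Fin k, ContinuousOn (fun x => fderiv ℝ F x (basisVec j)) U := fun j =>
    (hF.continuousOn_fderiv_of_isOpen hU le_rfl).clm_apply continuousOn_const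
  have hw' := fun j : Fin k => (contDiff_partial (M := 0) hw (by simp) (basisVec j)).continuous
  have hs' : ∀ j : Fin k, tsupport (fun x => fderiv ℝ w x (basisVec j)) ⊆ tsupport w :=
    fun j => tsupport_partial_subset w _
  have hc' : ∀ j : Fin k, HasCompactSupport fun x => fderiv ℝ w x (basisVec j) := fun j =>
    hc.of_isClosed_subset (isClosed_tsupport _) (hs' j)
  have key : ∀ j : Fin k, ∫ x, w x * ((L x j : ℂ) * fderiv ℝ F x (basisVec j)) =
      -∫ x, ((L x j : ℂ) * fderiv ℝ w x (basisVec j)) * F x := by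
    intro j
    have h1 := integral_mul_partial hw hc hU hs (F := fun x => c j x * F x)
      ((c j).contDiff.contDiffOn.mul hF) (basisVec j)
    have h2 : ∀ x, w x * fderiv ℝ (fun x => c j x * F x) x (basisVec j) =
        w x * ((L x j : ℂ) * fderiv ℝ F x (basisVec j)) := by
      intro x
      by_cases hx : x ∈ tsupport w
      · have hd : DifferentiableAt ℝ F x :=
          (hF.contDiffAt (hU.mem_nhds (hs hx))).differentiableAt (by norm_num)
        rw [fderiv_fun_mul (c j).differentiableAt hd, (c j).fderiv]
        have hjj : L (basisVec j) j = 0 := by linarith [h.coord j j]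
        have h3 : c j (basisVec j) = 0 := by rw [hcj, hjj]; simp
        simp [h3, hcj]
      · simp [image_eq_zero_of_notMem_tsupport hx]
    simp only [h2] at h1
    rw [h1]
    congr 1
    exact integral_congr_ae (Filter.Eventually.of_forall fun x => by
      simp only [hcj]; ring)
  have hcc : ∀ j, Continuous fun x => (L x j : ℂ) := fun j => (c j).continuous
  simp only [fderiv_map_eq_sum, Finset.mul_sum, Finset.sum_mul]
  rw [integral_finsetSum, integral_finsetSum, ← Finset.sum_neg_distrib]
  · exact Finset.sum_congr rfl fun j _ => key j
  · intro j _
    have := integrable_mul_of_tsupport (hw' j) (hc' j) hU ((hs' j).trans hs)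
      ((hcc j).continuousOn.mul hF.continuousOn)
    refine this.congr (Filter.Eventually.of_forall fun x => by simp only [Pi.mul_apply]; ring)
  · intro j _
    exact integrable_mul_of_tsupport hw.continuous hc hU hs ((hcc j).continuousOn.mul (hF' j))

lemma integral_laplacian_mul {w F : EuclideanSpace ℝ (Fin k) → ℂ}
    {U : Set (EuclideanSpace ℝ (Fin k))} (hw : ContDiff ℝ 2 w) (hc : HasCompactSupport w)
    (hU : IsOpen U) (hs : tsupport w ⊆ U) (hF : ContDiffOn ℝ 2 F U) :
    ∫ x, Laplacian.laplacian w x * F x = ∫ x, w x * Laplacian.laplacian F x := by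
  have hFp : ∀ j : Fin k, ContDiffOn ℝ 1 (fun x => fderiv ℝ F x (basisVec j)) U := fun j =>
    (hF.fderiv_of_isOpen hU (by norm_num)).clm_apply contDiffOn_const
  have hwp := fun j : Fin k => contDiff_partial (M := 1) hw (by norm_num) (basisVec j)
  have hs' : ∀ j : Fin k, tsupport (fun x => fderiv ℝ w x (basisVec j)) ⊆ tsupport w :=
    fun j => tsupport_partial_subset w _
  have hc' : ∀ j : Fin k, HasCompactSupport fun x => fderiv ℝ w x (basisVec j) := fun j =>
    hc.of_isClosed_subset (isClosed_tsupport _) (hs' j)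
  have hs'' : ∀ j : Fin k, tsupport (fun x => fderiv ℝ (fun y => fderiv ℝ w y (basisVec j)) x
      (basisVec j)) ⊆ tsupport w := fun j => (tsupport_partial_subset _ _).trans (hs' j)
  have hF1 : ContDiffOn ℝ 1 F U := hF.of_le (by norm_num)
  have h1 : ∀ x, Laplacian.laplacian w x * F x =
      ∑ j, fderiv ℝ (fun y => fderiv ℝ w y (basisVec j)) x (basisVec j) * F x := fun x => by
    rw [laplacian_eq_sum_fderiv hw.contDiffAt, Finset.sum_mul]
  have h2 : ∀ x, w x * Laplacian.laplacian F x =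
      ∑ j, w x * fderiv ℝ (fun y => fderiv ℝ F y (basisVec j)) x (basisVec j) := fun x => by
    by_cases hx : x ∈ tsupport w
    · rw [laplacian_eq_sum_fderiv (hF.contDiffAt (hU.mem_nhds (hs hx))), Finset.mul_sum]
    · simp [image_eq_zero_of_notMem_tsupport hx]
  simp only [h1, h2]
  rw [integral_finsetSum, integral_finsetSum]
  · refine Finset.sum_congr rfl fun j _ => ?_
    rw [integral_mul_partial (hw.of_le (by norm_num)) hc hU hs (hFp j),
      integral_mul_partial (hwp j) (hc' j) hU ((hs' j).trans hs) hF1, neg_neg]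
  · intro j _
    exact integrable_mul_of_tsupport hw.continuous hc hU hs
      (((hFp j).continuousOn_fderiv_of_isOpen hU le_rfl).clm_apply continuousOn_const)
  · intro j _
    exact integrable_mul_of_tsupport (contDiff_partial (M := 0) (hwp j) (by simp) _).continuous
      (hc.of_isClosed_subset (isClosed_tsupport _) (hs'' j)) hU ((hs'' j).trans hs) hF.continuousOn

/-- Conjugation flips the sign of the first-order term. The antisymmetry of `D` flips it back in
Green's identity, so `2iD` is symmetric. -/
lemma conj_glz {v : EuclideanSpace ℝ (Fin k) → ℂ} (hv : ContDiff ℝ 2 v) (x) :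
    conj (glz L μ v x) = Laplacian.laplacian (fun y => conj (v y)) x -
      2 * Complex.I * fderiv ℝ (fun y => conj (v y)) x (L x) -
      (μ : ℂ) ^ 2 * (‖x‖ : ℂ) ^ 2 * conj (v x) - 4 * (μ : ℂ) ^ 2 * conj (v x) := by
  have h1 : Laplacian.laplacian (fun y => conj (v y)) x = conj (Laplacian.laplacian v x) :=
    congrFun (InnerProductSpace.laplacian_CLE_comp_left (f := v) (l := Complex.conjCLE)) x
  have h2 : fderiv ℝ (fun y => conj (v y)) x (L x) = conj (fderiv ℝ v x (L x)) := by
    have h3 : HasFDerivAt (fun y => conj (v y))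
        ((Complex.conjCLE : ℂ →L[ℝ] ℂ).comp (fderiv ℝ v x)) x :=
      (Complex.conjCLE : ℂ →L[ℝ] ℂ).hasFDerivAt.comp x
        (hv.differentiable (by norm_num) x).hasFDerivAt
    rw [h3.fderiv]; rfl
  rw [h1, h2, glz]
  simp only [map_sub, map_add, map_mul, Complex.conj_I, map_pow, Complex.conj_ofReal, map_ofNat]
  ring

/-- Green's identity for the Ginsburg-Landau-Zeeman operator. -/
lemma integral_glz_symm (h : IsSkewComplex L μ) {v F : EuclideanSpace ℝ (Fin k) → ℂ}
    {U : Set (EuclideanSpace ℝ (Fin k))} (hv : ContDiff ℝ 2 v) (hc : HasCompactSupport v)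
    (hU : IsOpen U) (hs : tsupport v ⊆ U) (hF : ContDiffOn ℝ 2 F U) :
    ∫ x, conj (glz L μ v x) * F x = ∫ x, conj (v x) * glz L μ F x := by
  have hL : Continuous L := L.continuous_of_finiteDimensional
  set w : EuclideanSpace ℝ (Fin k) → ℂ := fun x => conj (v x) with hwdef
  have hw : ContDiff ℝ 2 w := (Complex.conjCLE : ℂ →L[ℝ] ℂ).contDiff.comp hv
  have hws : tsupport w = tsupport v := by
    have : Function.support w = Function.support v := by
      ext x; simp [hwdef]
    rw [tsupport, this, tsupport]
  have hwc : HasCompactSupport w := by rw [HasCompactSupport, hws]; exact hc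
  have hwU : tsupport w ⊆ U := by rw [hws]; exact hs
  have hF1 : ContDiffOn ℝ 1 F U := hF.of_le (by norm_num)
  have e1 := integral_laplacian_mul hw hwc hU hwU hF
  have e2 := integral_mul_fderiv_map h (hw.of_le (by norm_num)) hwc hU hwU hF1
  let pot : EuclideanSpace ℝ (Fin k) → ℂ := fun x => (μ : ℂ) ^ 2 * (‖x‖ : ℂ) ^ 2 + 4 * (μ : ℂ) ^ 2
  have hpot : Continuous pot := by fun_prop
  have hDw : Continuous fun x => fderiv ℝ w x (L x) :=
    (hw.continuous_fderiv (by norm_num)).clm_apply hL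
  have hsuppD : tsupport (fun x => fderiv ℝ w x (L x)) ⊆ tsupport w := by
    refine (closure_mono fun x hx => ?_ : _ ⊆ tsupport (fderiv ℝ w)).trans
        (tsupport_fderiv_subset ℝ)
    intro h0
    exact hx (by simp [h0])
  have hlapw : Continuous (Laplacian.laplacian w) := by
    have : Laplacian.laplacian w = fun x =>
        ∑ j, fderiv ℝ (fun y => fderiv ℝ w y (basisVec j)) x (basisVec j) :=
      funext fun x => laplacian_eq_sum_fderiv hw.contDiffAt
    rw [this]
    exact continuous_finsetSum _ fun j _ =>
      (contDiff_partial (M := 0) (contDiff_partial (M := 1) hw (by norm_num) _)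
          (by simp) _).continuous
  have hsuppL : tsupport (Laplacian.laplacian w) ⊆ tsupport w := by
    refine closure_minimal (fun x hx => ?_) (isClosed_tsupport _)
    by_contra hx'
    have h0 : w =ᶠ[𝓝 x] fun _ => 0 := notMem_tsupport_iff_eventuallyEq.1 hx'
    apply hx
    rw [(InnerProductSpace.laplacian_congr_nhds h0).eq_of_nhds]
    simp
  have hlapF : ContinuousOn (Laplacian.laplacian F) U := by
    have : EqOn (Laplacian.laplacian F) (fun x =>
        ∑ j, fderiv ℝ (fun y => fderiv ℝ F y (basisVec j)) x (basisVec j)) U :=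
      fun x hx => laplacian_eq_sum_fderiv (hF.contDiffAt (hU.mem_nhds hx))
    refine ContinuousOn.congr (continuousOn_finsetSum _ fun j _ => ?_) this
    exact (((hF.fderiv_of_isOpen hU (m := 1) (by norm_num)).clm_apply
      contDiffOn_const).continuousOn_fderiv_of_isOpen hU le_rfl).clm_apply continuousOn_const
  have hDF : ContinuousOn (fun x => fderiv ℝ F x (L x)) U :=
    (hF1.continuousOn_fderiv_of_isOpen hU le_rfl).clm_apply hL.continuousOn
  have i1 : Integrable fun x => Laplacian.laplacian w x * F x :=
    integrable_mul_of_tsupport hlapw (hwc.of_isClosed_subset (isClosed_tsupport _) hsuppL) hU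
      (hsuppL.trans hwU) hF.continuousOn
  have i2 : Integrable fun x => fderiv ℝ w x (L x) * F x :=
    integrable_mul_of_tsupport hDw (hwc.of_isClosed_subset (isClosed_tsupport _) hsuppD) hU
      (hsuppD.trans hwU) hF.continuousOn
  have i3 : Integrable fun x => w x * (pot x * F x) :=
    integrable_mul_of_tsupport hw.continuous hwc hU hwU (hpot.continuousOn.mul hF.continuousOn)
  have i4 : Integrable fun x => w x * Laplacian.laplacian F x :=
    integrable_mul_of_tsupport hw.continuous hwc hU hwU hlapF
  have i5 : Integrable fun x => w x * fderiv ℝ F x (L x) :=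
    integrable_mul_of_tsupport hw.continuous hwc hU hwU hDF
  have i12 : Integrable fun x => Laplacian.laplacian w x * F x -
      2 * Complex.I * (fderiv ℝ w x (L x) * F x) := i1.sub (i2.const_mul _)
  have i45 : Integrable fun x => w x * Laplacian.laplacian F x +
      2 * Complex.I * (w x * fderiv ℝ F x (L x)) := i4.add (i5.const_mul _)
  have l1 : ∫ x, conj (glz L μ v x) * F x = ((∫ x, Laplacian.laplacian w x * F x) -
      2 * Complex.I * ∫ x, fderiv ℝ w x (L x) * F x) - ∫ x, w x * (pot x * F x) := by
    rw [← integral_const_mul, ← integral_sub i1 (i2.const_mul _),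
      ← integral_sub i12 i3]
    refine integral_congr_ae (Filter.Eventually.of_forall fun x => ?_)
    simp only [conj_glz hv, pot, hwdef]
    ring
  have l2 : ∫ x, w x * glz L μ F x = ((∫ x, w x * Laplacian.laplacian F x) +
      2 * Complex.I * ∫ x, w x * fderiv ℝ F x (L x)) - ∫ x, w x * (pot x * F x) := by
    rw [← integral_const_mul, ← integral_add i4 (i5.const_mul _),
      ← integral_sub i45 i3]
    refine integral_congr_ae (Filter.Eventually.of_forall fun x => ?_)
    simp only [glz, pot]
    ring
  rw [l1, l2, e1, e2]
  ring

/-! ### Integrals depending on a parameter -/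

/-- Differentiation of a parametric integral over a compact space. -/
lemma hasDerivAt_integral_of_compact {S : Type*} [TopologicalSpace S] [CompactSpace S]
    [MeasurableSpace S] [OpensMeasurableSpace S] [SecondCountableTopology S]
    {ν : Measure S} [IsFiniteMeasure ν]
    {Φ Φ' : ℝ → S → ℂ} {I : Set ℝ} (hI : IsOpen I)
    (hΦ : ContinuousOn (fun p : ℝ × S => Φ p.1 p.2) (I ×ˢ univ))
    (hΦ' : ContinuousOn (fun p : ℝ × S => Φ' p.1 p.2) (I ×ˢ univ))
    (hd : ∀ r ∈ I, ∀ θ, HasDerivAt (fun r => Φ r θ) (Φ' r θ) r) {r : ℝ} (hr : r ∈ I) :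
    HasDerivAt (fun r => ∫ θ, Φ r θ ∂ν) (∫ θ, Φ' r θ ∂ν) r := by
  have hc : ∀ {Ψ : ℝ → S → ℂ}, ContinuousOn (fun p : ℝ × S => Ψ p.1 p.2) (I ×ˢ univ) →
      ∀ r ∈ I, Continuous (Ψ r) := fun {Ψ} h r hr =>
    h.comp_continuous (by fun_prop : Continuous fun θ : S => (r, θ)) fun θ => ⟨hr, mem_univ _⟩
  have hint : ∀ {g : S → ℂ}, Continuous g → Integrable g ν := fun hg =>
    hg.integrable_of_hasCompactSupport (HasCompactSupport.of_compactSpace _)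
  obtain ⟨ε, hε, hball⟩ := Metric.nhds_basis_closedBall.mem_iff.1 (hI.mem_nhds hr)
  have hK : IsCompact (Metric.closedBall r ε ×ˢ (univ : Set S)) :=
    (isCompact_closedBall r ε).prod isCompact_univ
  obtain ⟨C, hC⟩ := hK.exists_bound_of_continuousOn (hΦ'.mono (prod_mono hball le_rfl))
  refine (hasDerivAt_integral_of_dominated_loc_of_deriv_le (F := Φ) (F' := Φ') (bound := fun _ => C)
    (Metric.closedBall_mem_nhds r hε) ?_ (hint (hc hΦ r hr)) (hint (hc hΦ' r hr)).1 ?_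
    (integrable_const _) ?_).2
  · filter_upwards [hI.mem_nhds hr] with s hs
    exact (hint (hc hΦ s hs)).1
  · exact Filter.Eventually.of_forall fun θ s hs => hC (s, θ) ⟨hs, mem_univ _⟩
  · exact Filter.Eventually.of_forall fun θ s hs => hd s (hball hs) θ

/-- Dominated convergence on a compact relative neighbourhood of each point. Such neighbourhoods
exist for open and for closed intervals, and both cases are needed. -/
lemma continuousOn_integral_of_compact {S : Type*} [TopologicalSpace S] [CompactSpace S]
    [MeasurableSpace S] [OpensMeasurableSpace S] [SecondCountableTopology S]
    {ν : Measure S} [IsFiniteMeasure ν] {Φ : ℝ → S → ℂ} {I : Set ℝ}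
    (hI : ∀ r ∈ I, ∃ K, IsCompact K ∧ K ⊆ I ∧ K ∈ 𝓝[I] r)
    (hΦ : ContinuousOn (fun p : ℝ × S => Φ p.1 p.2) (I ×ˢ univ)) :
    ContinuousOn (fun r => ∫ θ, Φ r θ ∂ν) I := by
  intro r hr
  obtain ⟨K, hK, hKI, hKn⟩ := hI r hr
  have hc : ∀ r ∈ I, Continuous (Φ r) := fun r hr =>
    hΦ.comp_continuous (by fun_prop : Continuous fun θ : S => (r, θ)) fun θ => ⟨hr, mem_univ _⟩
  have hint : ∀ {g : S → ℂ}, Continuous g → Integrable g ν := fun hg =>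
    hg.integrable_of_hasCompactSupport (HasCompactSupport.of_compactSpace _)
  obtain ⟨C, hC⟩ := (hK.prod (isCompact_univ (X := S))).exists_bound_of_continuousOn
    (hΦ.mono (prod_mono hKI le_rfl))
  have h1 : ContinuousOn (fun r => ∫ θ, Φ r θ ∂ν) K := by
    refine continuousOn_of_dominated (bound := fun _ => C) (fun s hs => (hint (hc s (hKI hs))).1)
      (fun s hs => Filter.Eventually.of_forall fun θ => hC (s, θ) ⟨hs, mem_univ _⟩)
      (integrable_const _) (Filter.Eventually.of_forall fun θ => ?_)
    exact (hΦ.comp (by fun_prop : Continuous fun s : ℝ => (s, θ)).continuousOn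
      fun s hs => ⟨hKI hs, mem_univ _⟩)
  exact (h1 r (mem_of_mem_nhdsWithin hr hKn)).mono_of_mem_nhdsWithin hKn

/-! ### The regular solution of the radial equation -/

/-- The coefficients of the derivative of a power series. -/
def coeffDeriv (c : ℕ → ℂ) (j : ℕ) : ℂ := (j + 1) * c (j + 1)

/-- The sum of a power series at a real point. -/
def seriesFn (c : ℕ → ℂ) (t : ℝ) : ℂ := ∑' j, c j * (t : ℂ) ^ j

/-- Coefficients that decay like those of an exponential function. -/
def ExpBound (c : ℕ → ℂ) : Prop := ∃ C K : ℝ, 0 ≤ C ∧ 0 ≤ K ∧ ∀ j, ‖c j‖ ≤ C * (K ^ j / j.factorial)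

lemma ExpBound.deriv {c : ℕ → ℂ} (h : ExpBound c) : ExpBound (coeffDeriv c) := by
  obtain ⟨C, K, hC, hK, hb⟩ := h
  refine ⟨C * K, K, by positivity, hK, fun j => ?_⟩
  have h1 := hb (j + 1)
  rw [coeffDeriv, norm_mul]
  have h2 : ‖(j : ℂ) + 1‖ = j + 1 := by
    have : ((j : ℂ) + 1) = ((j + 1 : ℕ) : ℂ) := by push_cast; ring
    rw [this, Complex.norm_natCast]; push_cast; ring
  rw [h2]
  calc ((j : ℝ) + 1) * ‖c (j + 1)‖ ≤ (j + 1) * (C * (K ^ (j + 1) / (j + 1).factorial)) := by gcongr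
    _ = _ := by rw [Nat.factorial_succ]; push_cast; field_simp; ring

lemma ExpBound.summable_norm {c : ℕ → ℂ} (h : ExpBound c) (t : ℝ) :
    Summable fun j => ‖c j‖ * |t| ^ j := by
  obtain ⟨C, K, hC, hK, hb⟩ := h
  refine Summable.of_nonneg_of_le (fun j => by positivity) (fun j => ?_)
    ((Real.summable_pow_div_factorial (K * |t|)).mul_left C)
  calc ‖c j‖ * |t| ^ j ≤ C * (K ^ j / j.factorial) * |t| ^ j := by gcongr; exact hb j
    _ = _ := by rw [mul_pow]; ring

lemma ExpBound.summable {c : ℕ → ℂ} (h : ExpBound c) (t : ℝ) :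
    Summable fun j => c j * (t : ℂ) ^ j := by
  refine Summable.of_norm ?_
  simpa [norm_mul, norm_pow] using h.summable_norm t

lemma seriesFn_hasDerivAt {c : ℕ → ℂ} (h : ExpBound c) (t : ℝ) :
    HasDerivAt (seriesFn c) (seriesFn (coeffDeriv c) t) t := by
  have hT : t ∈ Metric.ball (0 : ℝ) (|t| + 1) := by simp
  have h0 : (0 : ℝ) ∈ Metric.ball (0 : ℝ) (|t| + 1) := by simp; positivity
  have hsum : Summable fun j : ℕ => ‖c j‖ * (j * (|t| + 1) ^ (j - 1)) := by
    rw [← summable_nat_add_iff 1]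
    have h1 := h.deriv.summable_norm (|t| + 1)
    refine h1.congr fun j => ?_
    rw [coeffDeriv, norm_mul, abs_of_nonneg (by positivity : (0:ℝ) ≤ |t| + 1)]
    have h2 : ‖(j : ℂ) + 1‖ = j + 1 := by
      have : ((j : ℂ) + 1) = ((j + 1 : ℕ) : ℂ) := by push_cast; ring
      rw [this, Complex.norm_natCast]; push_cast; ring
    rw [h2]; push_cast; ring
  have h3 := hasDerivAt_tsum_of_isPreconnected (g := fun j (s : ℝ) => c j * (s : ℂ) ^ j)
    (g' := fun j (s : ℝ) => c j * (j * (s : ℂ) ^ (j - 1))) hsum Metric.isOpen_ball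
    (convex_ball (0 : ℝ) (|t| + 1)).isPreconnected
    (fun j s _ => by
      have := ((hasDerivAt_pow j (s : ℂ)).comp_ofReal).const_mul (c j)
      exact this)
    (fun j s hs => by
      rw [norm_mul, norm_mul, norm_pow, Complex.norm_natCast, Complex.norm_real]
      have hs' : ‖s‖ ≤ |t| + 1 := by simpa using (mem_ball_zero_iff.1 hs).le
      gcongr)
    h0 (h.summable 0) hT
  refine h3.congr_deriv ?_
  have hs2 : Summable fun j : ℕ => c j * (j * (t : ℂ) ^ (j - 1)) := by
    rw [← summable_nat_add_iff 1]
    refine (h.deriv.summable t).congr fun j => ?_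
    rw [coeffDeriv]; push_cast; ring
  rw [hs2.tsum_eq_zero_add, seriesFn]
  simp only [Nat.cast_zero, zero_mul, mul_zero, zero_add]
  refine tsum_congr fun j => ?_
  rw [coeffDeriv]; push_cast; ring

lemma seriesFn_mul_self {c e : ℕ → ℂ} (he : ExpBound e) (h0 : e 0 = 0) (h : ∀ j, e (j + 1) = c j)
    (t : ℝ) : t * seriesFn c t = seriesFn e t := by
  rw [seriesFn, seriesFn, (he.summable t).tsum_eq_zero_add, h0, zero_mul, zero_add, ← tsum_mul_left]
  refine tsum_congr fun j => ?_
  rw [h]; ring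

lemma contDiff_two_of_hasDerivAt {f f1 f2 : ℝ → ℂ} (h1 : ∀ t, HasDerivAt f (f1 t) t)
    (h2 : ∀ t, HasDerivAt f1 (f2 t) t) (h3 : Continuous f2) : ContDiff ℝ 2 f := by
  have e1 : deriv f = f1 := funext fun t => (h1 t).deriv
  have e2 : deriv f1 = f2 := funext fun t => (h2 t).deriv
  have hf1 : ContDiff ℝ 1 f1 := by
    rw [contDiff_one_iff_deriv, e2]
    exact ⟨fun t => (h2 t).differentiableAt, h3⟩
  have : ContDiff ℝ (1 + 1) f := by
    rw [contDiff_succ_iff_deriv, e1]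
    exact ⟨fun t => (h1 t).differentiableAt, by simp, hf1⟩
  exact this

/-- The solution of the radial equation that is regular at the origin. -/
lemma exists_radial_solution (hk : 0 < k) (hμ : 0 < μ) (n : ℕ) (m : ℤ) (lam : ℂ) :
    ∃ f : ℝ → ℂ, ContDiff ℝ 2 f ∧ f 0 = 1 ∧ ∀ t, radialOp k μ n m f t = lam * f t := by
  have ha : 0 < (k : ℝ) / 2 + n := by
    have : (0 : ℝ) < k := by exact_mod_cast hk
    positivity
  set a : ℝ := (k : ℝ) / 2 + n with hadef
  set β : ℂ := (2 * m * μ + 4 * μ ^ 2 + (k + 2 * n) * μ + lam) / 4 with hβ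
  -- The recursion for `4t g'' + (4a - 4μt)g' = 4βg`. The sum is the Kummer series `₁F₁(β/μ; a;
  -- μt)`.
  let c : ℕ → ℂ := fun j => Nat.rec 1 (fun j x => x * ((μ * j + β) / ((j + 1) * (j + a)))) j
  have hc : ∀ j : ℕ, c (j + 1) = c j * ((μ * j + β) / ((j + 1) * (j + a))) := fun j => rfl
  have hja : ∀ j : ℕ, (j : ℂ) + a ≠ 0 := fun j => by
    have : 0 < (j : ℝ) + a := by positivity
    exact_mod_cast this.ne'
  have hj1 : ∀ j : ℕ, (j : ℂ) + 1 ≠ 0 := fun j => by exact_mod_cast j.succ_ne_zero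
  have hrec : ∀ j : ℕ, ((j : ℂ) + 1) * (j + a) * c (j + 1) = (μ * j + β) * c j := fun j => by
    have := hja j
    have := hj1 j
    rw [hc]; field_simp
  have hcb : ExpBound c := by
    -- Chosen so that `|μj + β| ≤ K(j + a)`; each step of the recursion then costs at most `K/(j +
    -- 1)`.
    set K : ℝ := μ + ‖β‖ / a with hK
    have hK0 : 0 ≤ K := by positivity
    refine ⟨1, K, by norm_num, hK0, fun j => ?_⟩
    rw [one_mul]
    induction j with
    | zero => simp [c]
    | succ j ih =>
      have hn1 : ‖(j : ℂ) + 1‖ = j + 1 := by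
        have : ((j : ℂ) + 1) = ((j + 1 : ℕ) : ℂ) := by push_cast; ring
        rw [this, Complex.norm_natCast]; push_cast; ring
      have hn2 : ‖(j : ℂ) + a‖ = j + a := by
        have : ((j : ℂ) + a) = ((j + a : ℝ) : ℂ) := by push_cast; ring
        rw [this, Complex.norm_real, Real.norm_of_nonneg (by positivity)]
      have hn3 : ‖(μ : ℂ) * j + β‖ ≤ K * (j + a) := by
        refine (norm_add_le _ _).trans ?_
        rw [norm_mul, Complex.norm_real, Complex.norm_natCast, Real.norm_of_nonneg hμ.le, hK]
        have : (μ + ‖β‖ / a) * (j + a) = μ * j + ‖β‖ + (μ * a + ‖β‖ / a * j) := by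
          field_simp; ring
        rw [this]
        have : 0 ≤ μ * a + ‖β‖ / a * j := by positivity
        linarith
      rw [hc, norm_mul, norm_div, norm_mul, hn1, hn2]
      calc ‖c j‖ * (‖(μ : ℂ) * j + β‖ / ((j + 1) * (j + a)))
          ≤ (K ^ j / j.factorial) * (K * (j + a) / ((j + 1) * (j + a))) := by gcongr
        _ = _ := by
          have h2 : (j : ℝ) + a ≠ 0 := by positivity
          rw [Nat.factorial_succ]; push_cast; field_simp; try ring
  have hd1 := seriesFn_hasDerivAt hcb
  have hd2 := seriesFn_hasDerivAt hcb.deriv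
  have hd3 := seriesFn_hasDerivAt hcb.deriv.deriv
  have hE : ContDiff ℝ 2 fun t : ℝ => ((Real.exp (-(t * μ / 2)) : ℝ) : ℂ) :=
    Complex.ofRealCLM.contDiff.comp
      (Real.contDiff_exp.comp ((contDiff_id.mul contDiff_const).div_const _).neg)
  refine ⟨fun t => seriesFn c t * Real.exp (-(t * μ / 2)),
    (contDiff_two_of_hasDerivAt hd1 hd2 (continuous_iff_continuousAt.2 fun t =>
      (hd3 t).continuousAt)).mul hE, ?_, fun t => ?_⟩
  · simp only [seriesFn]
    rw [tsum_eq_single 0 (fun j hj => by simp [hj])]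
    simp [c]
  · rw [radialOp_mul_exp n m μ hd1 hd2]
    have key : 4 * t * seriesFn (coeffDeriv (coeffDeriv c)) t +
        (2 * k + 4 * n - 4 * μ * t) * seriesFn (coeffDeriv c) t = 4 * β * seriesFn c t := by
      -- Multiplication by `t` shifts indices, so `t g''` and `t g'` have coefficients `j` times
      -- those of `g'` and `g`. The equation becomes the recursion, coefficient by coefficient.
      let e1 : ℕ → ℂ := fun j => j * coeffDeriv c j
      let e2 : ℕ → ℂ := fun j => j * c j
      have hb : ∀ {u : ℕ → ℂ}, ExpBound u → ExpBound fun j => (j : ℂ) * u j := by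
        intro u ⟨C, K, hC, hK, hb⟩
        refine ⟨C, 2 * K, hC, by positivity, fun j => ?_⟩
        rw [norm_mul, Complex.norm_natCast]
        have h1 : (j : ℝ) ≤ 2 ^ j := by exact_mod_cast j.lt_two_pow_self.le
        calc (j : ℝ) * ‖u j‖ ≤ 2 ^ j * (C * (K ^ j / j.factorial)) := by
              gcongr; exact hb j
          _ = _ := by rw [mul_pow]; ring
      have s1 : t * seriesFn (coeffDeriv (coeffDeriv c)) t = seriesFn e1 t :=
        seriesFn_mul_self (hb hcb.deriv) (by simp) (fun j => by simp [coeffDeriv]) t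
      have s2 : t * seriesFn (coeffDeriv c) t = seriesFn e2 t :=
        seriesFn_mul_self (hb hcb) (by simp) (fun j => by simp [coeffDeriv]) t
      have s3 : 4 * seriesFn e1 t + (2 * k + 4 * n) * seriesFn (coeffDeriv c) t -
          4 * μ * seriesFn e2 t = 4 * β * seriesFn c t := by
        simp only [seriesFn]
        rw [← tsum_mul_left, ← tsum_mul_left, ← tsum_mul_left, ← tsum_mul_left,
          ← Summable.tsum_add (((hb hcb.deriv).summable t).mul_left _)
            ((hcb.deriv.summable t).mul_left _),
          ← Summable.tsum_sub ((((hb hcb.deriv).summable t).mul_left _).add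
            ((hcb.deriv.summable t).mul_left _)) (((hb hcb).summable t).mul_left _)]
        refine tsum_congr fun j => ?_
        have h1 := hrec j
        rw [hadef] at h1
        push_cast at h1
        simp only [coeffDeriv]
        linear_combination 4 * (t : ℂ) ^ j * h1
      linear_combination s3 + 4 * s1 - 4 * μ * s2
    rw [key, hβ]
    ring

/-! ### Uniqueness for the radial equation -/

lemma hasDerivAt_deriv_of_contDiffAt {f : ℝ → ℂ} {t : ℝ} (hf : ContDiffAt ℝ 2 f t) :
    HasDerivAt (deriv f) (iteratedDeriv 2 f t) t := by
  rw [iteratedDeriv_succ, iteratedDeriv_one]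
  refine DifferentiableAt.hasDerivAt ?_
  have h1 : ContDiffAt ℝ 1 (fderiv ℝ f) t := hf.fderiv_right (by norm_num)
  exact ((h1.differentiableAt (by norm_num)).clm_apply (differentiableAt_const 1))

/-- The equation is singular only at `t = 0`. On a compact subinterval of `(0, T)` around both
points one may divide by `4t`, and the resulting first-order system for `(f, f')` is Lipschitz. -/
lemma radialOp_eq_zero_unique {n : ℕ} {m : ℤ} {μ T t₀ : ℝ} {lam : ℂ} (ht₀ : t₀ ∈ Ioo 0 T)
    {f : ℝ → ℂ} (hf : ContDiffOn ℝ 2 f (Ioo 0 T))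
    (hode : ∀ t ∈ Ioo 0 T, radialOp k μ n m f t = lam * f t)
    (h0 : f t₀ = 0) (h1 : deriv f t₀ = 0) : ∀ t ∈ Ioo 0 T, f t = 0 := by
  intro s hs
  have ha : 0 < min s t₀ / 2 := by have := lt_min hs.1 ht₀.1; linarith
  have ha1 : min s t₀ / 2 < min s t₀ := by linarith
  have hb : max s t₀ < (max s t₀ + T) / 2 := by have := max_lt hs.2 ht₀.2; linarith
  have hb1 : (max s t₀ + T) / 2 < T := by have := max_lt hs.2 ht₀.2; linarith
  set a' := min s t₀ / 2
  set b' := (max s t₀ + T) / 2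
  have hsub : ∀ t ∈ Ioo a' b', t ∈ Ioo 0 T := fun t ht => ⟨ha.trans ht.1, ht.2.trans hb1⟩
  let q : ℝ → ℂ := fun t => (lam + (2 * m * μ + 4 * μ ^ 2 * (1 + t / 4))) / (4 * t)
  let p : ℝ → ℂ := fun t => (2 * k + 4 * n) / (4 * t)
  have hne : ∀ t ∈ Icc a' b', (4 * (t : ℂ)) ≠ 0 := fun t ht => by
    have : t ≠ 0 := (ha.trans_le ht.1).ne'
    simpa using this
  obtain ⟨C1, hC1⟩ := (isCompact_Icc (a := a') (b := b')).exists_bound_of_continuousOn (f := q)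
    (ContinuousOn.div (by fun_prop) (by fun_prop) hne)
  obtain ⟨C2, hC2⟩ := (isCompact_Icc (a := a') (b := b')).exists_bound_of_continuousOn (f := p)
    (ContinuousOn.div (by fun_prop) (by fun_prop) hne)
  have hmem : a' ∈ Icc a' b' := by
    refine ⟨le_refl _, ?_⟩
    have := min_le_max (a := s) (b := t₀)
    linarith
  have hC1p : 0 ≤ C1 := (norm_nonneg _).trans (hC1 a' hmem)
  have hC2p : 0 ≤ C2 := (norm_nonneg _).trans (hC2 a' hmem)
  let v : ℝ → ℂ × ℂ → ℂ × ℂ := fun t y => (y.2, q t * y.1 - p t * y.2)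
  have hv : ∀ t ∈ Ioo a' b', LipschitzOnWith (Real.toNNReal (1 + C1 + C2)) (v t) univ := by
    intro t ht
    refine LipschitzOnWith.of_dist_le_mul fun x _ y _ => ?_
    rw [Real.coe_toNNReal _ (by positivity), dist_eq_norm, dist_eq_norm]
    have e : v t x - v t y = ((x - y).2, q t * (x - y).1 - p t * (x - y).2) := by
      simp only [v, Prod.mk_sub_mk, Prod.fst_sub, Prod.snd_sub]
      congr 1
      ring
    rw [e]
    have n1 := norm_fst_le (x - y)
    have n2 := norm_snd_le (x - y)
    have b1 := hC1 t (Ioo_subset_Icc_self ht)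
    have b2 := hC2 t (Ioo_subset_Icc_self ht)
    have hN := norm_nonneg (x - y)
    rw [Prod.norm_def]
    refine max_le ?_ ?_
    · refine n2.trans ?_
      nlinarith
    · refine (norm_sub_le _ _).trans ?_
      rw [norm_mul, norm_mul]
      have := mul_le_mul b1 n1 (norm_nonneg _) hC1p
      have := mul_le_mul b2 n2 (norm_nonneg _) hC2p
      nlinarith
  have hc : ∀ t ∈ Ioo 0 T, ContDiffAt ℝ 2 f t := fun t ht => hf.contDiffAt (Ioo_mem_nhds ht.1 ht.2)
  have hfd : ∀ t ∈ Ioo a' b', HasDerivAt (fun t => (f t, deriv f t)) (v t (f t, deriv f t)) t ∧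
      (f t, deriv f t) ∈ (univ : Set (ℂ × ℂ)) := by
    intro t ht
    refine ⟨?_, mem_univ _⟩
    have d1 : HasDerivAt f (deriv f t) t :=
      ((hc t (hsub t ht)).differentiableAt (by norm_num)).hasDerivAt
    have d2 : HasDerivAt (deriv f) (iteratedDeriv 2 f t) t := by
      exact hasDerivAt_deriv_of_contDiffAt (hc t (hsub t ht))
    convert d1.prodMk d2 using 1
    simp only [v, q, p, Prod.mk.injEq, true_and]
    have := hode t (hsub t ht)
    unfold radialOp at this
    have h4 : (t : ℂ) ≠ 0 := by simpa using hne t (Ioo_subset_Icc_self ht)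
    field_simp
    linear_combination -this
  have hz : ∀ t ∈ Ioo a' b', HasDerivAt (fun _ : ℝ => (0 : ℂ × ℂ)) (v t 0) t ∧
      (0 : ℂ × ℂ) ∈ (univ : Set (ℂ × ℂ)) := by
    intro t ht
    have : v t 0 = 0 := by simp [v]
    rw [this]
    exact ⟨hasDerivAt_const _ _, mem_univ _⟩
  have ht0' : t₀ ∈ Ioo a' b' :=
    ⟨ha1.trans_le (min_le_right _ _), (le_max_right _ _).trans_lt hb⟩
  have hs' : s ∈ Ioo a' b' := ⟨ha1.trans_le (min_le_left _ _), (le_max_left _ _).trans_lt hb⟩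
  have := ODE_solution_unique_of_mem_Ioo hv ht0' hfd hz (by simp [h0, h1]) hs'
  simpa using congrArg Prod.fst this

/-- A solution whose Wronskian with the regular solution vanishes at the origin, after
multiplication by the weight, is a multiple of the regular solution. -/
lemma exists_eq_mul_of_wronskian {n : ℕ} {m : ℤ} {μ R : ℝ} {lam : ℂ} (hR : 0 < R)
    {f f1 : ℝ → ℂ} (hf : ContDiffOn ℝ 2 f (Ioo 0 (R ^ 2)))
    (hode : ∀ t ∈ Ioo 0 (R ^ 2), radialOp k μ n m f t = lam * f t)
    (hf1 : ContDiff ℝ 2 f1) (hf10 : f1 0 = 1) (hode1 : ∀ t, radialOp k μ n m f1 t = lam * f1 t)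
    (hlim : Filter.Tendsto (fun r : ℝ => (r : ℂ) ^ (k + 2 * n) *
      (f (r ^ 2) * deriv f1 (r ^ 2) - deriv f (r ^ 2) * f1 (r ^ 2))) (𝓝[>] 0) (𝓝 0)) :
    ∃ c : ℂ, ∀ t ∈ Ioo 0 (R ^ 2), f t = c * f1 t := by
  set W : ℝ → ℂ := fun r : ℝ => (r : ℂ) ^ (k + 2 * n) *
      (f (r ^ 2) * deriv f1 (r ^ 2) - deriv f (r ^ 2) * f1 (r ^ 2)) with hW
  have hsq : ∀ r ∈ Ioo 0 R, r ^ 2 ∈ Ioo 0 (R ^ 2) := fun r hr =>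
    ⟨by have := hr.1; positivity, by have := hr.1; have := hr.2; gcongr⟩
  have hc : ∀ t ∈ Ioo 0 (R ^ 2), ContDiffAt ℝ 2 f t :=
    fun t ht => hf.contDiffAt (Ioo_mem_nhds ht.1 ht.2)
  -- Abel's identity: in the variable `t` the factor that makes the Wronskian constant is
  -- `t^{k/2+n}`. Substituting `t = r²` avoids half-integral powers.
  have hder : ∀ r ∈ Ioo 0 R, HasDerivAt W 0 r := by
    intro r hr
    have ht := hsq r hr
    have d1 : HasDerivAt f (deriv f (r ^ 2)) (r ^ 2) :=
      ((hc _ ht).differentiableAt (by norm_num)).hasDerivAt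
    have d2 := hasDerivAt_deriv_of_contDiffAt (hc _ ht)
    have e1 : HasDerivAt f1 (deriv f1 (r ^ 2)) (r ^ 2) :=
      (hf1.differentiable (by norm_num) _).hasDerivAt
    have e2 := hasDerivAt_deriv_of_contDiffAt (hf1.contDiffAt (x := r ^ 2))
    have hs : HasDerivAt (fun r : ℝ => r ^ 2) (2 * r) r := by
      simpa using hasDerivAt_pow 2 r
    have hw := HasDerivAt.scomp (h := fun r : ℝ => r ^ 2) r ((d1.mul e2).sub (d2.mul e1)) hs
    have hp : HasDerivAt (fun r : ℝ => (r : ℂ) ^ (k + 2 * n))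
        ((k + 2 * n : ℕ) * (r : ℂ) ^ (k + 2 * n - 1)) r := by
      have := (hasDerivAt_pow (k + 2 * n) (r : ℂ)).comp_ofReal
      simpa using this
    refine (hp.mul hw).congr_deriv ?_
    have q1 := hode _ ht
    have q2 := hode1 (r ^ 2)
    simp only [radialOp] at q1 q2
    simp only [Function.comp_apply, Pi.mul_apply, Pi.sub_apply, Complex.real_smul]
    have hr0 : (r : ℂ) ≠ 0 := by simpa using hr.1.ne'
    -- The exponent `k + 2n - 1` is truncated when `k = n = 0`, a case not excluded here.
    rcases Nat.eq_zero_or_pos (k + 2 * n) with h0 | h0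
    · have hk : k = 0 := by omega
      have hn : n = 0 := by omega
      subst hk hn
      push_cast at q1 q2 ⊢
      have : (r : ℂ) * ((r : ℂ) * 0 + 0) = 0 := by ring
      apply mul_left_cancel₀ (mul_ne_zero two_ne_zero hr0)
      linear_combination f (r ^ 2) * q2 - f1 (r ^ 2) * q1
    · obtain ⟨N, hN⟩ : ∃ N, k + 2 * n = N + 1 := ⟨k + 2 * n - 1, by omega⟩
      have hN' : (k : ℂ) + 2 * n = N + 1 := by exact_mod_cast hN
      rw [hN]
      push_cast at q1 q2 ⊢
      have : (2 * k + 4 * n : ℂ) = 2 * (N + 1) := by linear_combination 2 * hN'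
      rw [this] at q1 q2
      linear_combination (r : ℂ) ^ N / 2 * (f (r ^ 2) * q2 - f1 (r ^ 2) * q1)
  have hconst : ∀ r ∈ Ioo 0 R, W r = 0 := by
    intro r hr
    have hW' : ∀ s ∈ Ioo 0 R, W s = W r := fun s hs =>
      isOpen_Ioo.is_const_of_deriv_eq_zero isPreconnected_Ioo
        (fun x hx => (hder x hx).differentiableAt.differentiableWithinAt)
        (fun x hx => (hder x hx).deriv) hs hr
    have h2 : Filter.Tendsto W (𝓝[>] 0) (𝓝 (W r)) := by
      refine tendsto_const_nhds.congr' ?_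
      filter_upwards [Ioo_mem_nhdsGT hR] with s hs
      exact (hW' s hs).symm
    exact tendsto_nhds_unique h2 hlim
  obtain ⟨r, hr, hne⟩ : ∃ r ∈ Ioo 0 R, f1 (r ^ 2) ≠ 0 := by
    have hcont : ContinuousAt (fun r : ℝ => f1 (r ^ 2)) 0 :=
      (hf1.continuous.comp (continuous_pow 2)).continuousAt
    have := hcont.eventually_ne (y := 0) (by simp [hf10])
    have h2 := (this.filter_mono (nhdsWithin_le_nhds (s := Ioi 0))).and (Ioo_mem_nhdsGT hR)
    obtain ⟨r, h1, h2⟩ := h2.exists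
    exact ⟨r, h2, h1⟩
  have ht := hsq r hr
  have hw : f (r ^ 2) * deriv f1 (r ^ 2) - deriv f (r ^ 2) * f1 (r ^ 2) = 0 := by
    have := hconst r hr
    simp only [hW, mul_eq_zero] at this
    refine this.resolve_left ?_
    have hr0 : (r : ℂ) ≠ 0 := by simpa using hr.1.ne'
    exact pow_ne_zero _ hr0
  -- At a point where `f₁ ≠ 0`, this makes `f - c f₁` vanish, and the zero Wronskian makes its
  -- derivative vanish too.
  set c := f (r ^ 2) / f1 (r ^ 2)
  refine ⟨c, fun t hT => ?_⟩
  have hcf : ContDiff ℝ 2 (c • f1) := contDiff_const.smul hf1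
  have := radialOp_eq_zero_unique (k := k) (n := n) (m := m) (μ := μ) (lam := lam) ht
    (f := f - c • f1) (hf.sub hcf.contDiffOn) ?_ ?_ ?_ t hT
  · simpa [sub_eq_zero] using this
  · intro s hs
    have e1 := iteratedDeriv_sub (hc s hs) (hcf.contDiffAt (x := s))
    have e2 := deriv_sub ((hc s hs).differentiableAt (by norm_num))
      (hcf.differentiable (by norm_num) s)
    have e3 := iteratedDeriv_const_smul (hf1.contDiffAt (x := s)) c
    have e4 := deriv_const_smul c (hf1.differentiable (by norm_num) s)
    have q1 := hode s hs
    have q2 := hode1 s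
    simp only [radialOp] at q1 q2 ⊢
    rw [e1, e2, e3, e4]
    simp only [Pi.sub_apply, Pi.smul_apply, smul_eq_mul]
    linear_combination q1 - c * q2
  · simp only [Pi.sub_apply, Pi.smul_apply, smul_eq_mul, c]
    field_simp
    ring
  · rw [deriv_sub ((hc _ ht).differentiableAt (by norm_num))
      (hcf.differentiable (by norm_num) _), deriv_const_smul c (hf1.differentiable (by norm_num) _)]
    simp only [smul_eq_mul, c]
    field_simp
    linear_combination -hw

/-! ### Radial components satisfy the radial equation -/

/-- The integral of `F` against a spherical harmonic over the sphere of radius `r`. -/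
def sphereMean (P : MvPolynomial (Fin k) ℂ) (F : EuclideanSpace ℝ (Fin k) → ℂ) (r : ℝ) : ℂ :=
  ∫ θ, F (r • (θ : EuclideanSpace ℝ (Fin k))) *
    conj (polyFun P (θ : EuclideanSpace ℝ (Fin k))) ∂(sphereMeasure k)

lemma smul_sphere_mem_ball {R r : ℝ} (hr : r ∈ Ioo (-R) R)
    (θ : Metric.sphere (0 : EuclideanSpace ℝ (Fin k)) 1) :
    r • (θ : EuclideanSpace ℝ (Fin k)) ∈ Metric.ball (0 : EuclideanSpace ℝ (Fin k)) R := by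
  have : ‖(θ : EuclideanSpace ℝ (Fin k))‖ = 1 := by simp
  rw [mem_ball_zero_iff, norm_smul, this, mul_one, Real.norm_eq_abs, abs_lt]
  exact hr

lemma contDiffOn_two_of_hasDerivAt {I : Set ℝ} (hI : IsOpen I) {f f1 f2 : ℝ → ℂ}
    (h1 : ∀ t ∈ I, HasDerivAt f (f1 t) t) (h2 : ∀ t ∈ I, HasDerivAt f1 (f2 t) t)
    (h3 : ContinuousOn f2 I) : ContDiffOn ℝ 2 f I := by
  have e1 : EqOn (deriv f) f1 I := fun t ht => (h1 t ht).deriv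
  have e2 : EqOn (deriv f1) f2 I := fun t ht => (h2 t ht).deriv
  have c1 : ContDiffOn ℝ 1 f1 I := by
    rw [show (1 : WithTop ℕ∞) = 0 + 1 by norm_num, contDiffOn_succ_iff_deriv_of_isOpen hI]
    refine ⟨fun t ht => (h2 t ht).differentiableAt.differentiableWithinAt, by simp, ?_⟩
    rw [contDiffOn_zero]
    exact h3.congr e2
  rw [show (2 : WithTop ℕ∞) = 1 + 1 by norm_num, contDiffOn_succ_iff_deriv_of_isOpen hI]
  exact ⟨fun t ht => (h1 t ht).differentiableAt.differentiableWithinAt, by simp, c1.congr e1⟩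

/-- Two differentiations under the integral over the compact sphere. Negative radii are admitted so
that `r = 0` is interior: the mean and its derivative stay bounded there, unlike the radial
component, which carries a factor `r^{-n}`. -/
lemma contDiffOn_sphereMean {R : ℝ} (P : MvPolynomial (Fin k) ℂ)
    {F : EuclideanSpace ℝ (Fin k) → ℂ} (hF : ContDiffOn ℝ 2 F (Metric.ball 0 R)) :
    ContDiffOn ℝ 2 (sphereMean P F) (Ioo (-R) R) := by
  have hP : Continuous fun p : ℝ × Metric.sphere (0 : EuclideanSpace ℝ (Fin k)) 1 =>
      conj (polyFun P (p.2 : EuclideanSpace ℝ (Fin k))) :=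
    Complex.continuous_conj.comp ((polyFun_continuous P).comp
      (continuous_subtype_val.comp continuous_snd))
  have hmaps : MapsTo (fun p : ℝ × Metric.sphere (0 : EuclideanSpace ℝ (Fin k)) 1 =>
      p.1 • (p.2 : EuclideanSpace ℝ (Fin k))) (Ioo (-R) R ×ˢ univ) (Metric.ball 0 R) :=
    fun p hp => smul_sphere_mem_ball hp.1 p.2
  have hsc : ContinuousOn (fun p : ℝ × Metric.sphere (0 : EuclideanSpace ℝ (Fin k)) 1 =>
      p.1 • (p.2 : EuclideanSpace ℝ (Fin k))) (Ioo (-R) R ×ˢ univ) := by fun_prop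
  have hv : ContinuousOn (fun p : ℝ × Metric.sphere (0 : EuclideanSpace ℝ (Fin k)) 1 =>
      (p.2 : EuclideanSpace ℝ (Fin k))) (Ioo (-R) R ×ˢ univ) := by fun_prop
  have hF1 : ContDiffOn ℝ 1 (fderiv ℝ F) (Metric.ball 0 R) :=
    hF.fderiv_of_isOpen Metric.isOpen_ball (by norm_num)
  have hF2 : ContDiffOn ℝ 0 (fderiv ℝ (fderiv ℝ F)) (Metric.ball 0 R) :=
    hF1.fderiv_of_isOpen Metric.isOpen_ball (by norm_num)
  have hline : ∀ (θ : EuclideanSpace ℝ (Fin k)) (r : ℝ),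
      HasDerivAt (fun r : ℝ => r • θ) θ r := fun θ r => by
    simpa using (hasDerivAt_id r).smul_const θ
  refine contDiffOn_two_of_hasDerivAt isOpen_Ioo
    (f1 := fun r => ∫ θ, fderiv ℝ F (r • (θ : EuclideanSpace ℝ (Fin k))) θ *
      conj (polyFun P (θ : EuclideanSpace ℝ (Fin k))) ∂(sphereMeasure k))
    (f2 := fun r => ∫ θ, fderiv ℝ (fderiv ℝ F) (r • (θ : EuclideanSpace ℝ (Fin k))) θ θ *
      conj (polyFun P (θ : EuclideanSpace ℝ (Fin k))) ∂(sphereMeasure k))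
    (fun r hr => ?_) (fun r hr => ?_) ?_
  · refine hasDerivAt_integral_of_compact (ν := sphereMeasure k)
      (Φ := fun r θ => F (r • (θ : EuclideanSpace ℝ (Fin k))) *
        conj (polyFun P (θ : EuclideanSpace ℝ (Fin k))))
      (Φ' := fun r θ => fderiv ℝ F (r • (θ : EuclideanSpace ℝ (Fin k))) θ *
        conj (polyFun P (θ : EuclideanSpace ℝ (Fin k))))
      isOpen_Ioo ?_ ?_ (fun r hr θ => ?_) hr
    · exact (hF.continuousOn.comp hsc hmaps).mul hP.continuousOn
    · exact ((hF1.continuousOn.comp hsc hmaps).clm_apply hv).mul hP.continuousOn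
    · refine HasDerivAt.mul_const ?_ _
      have := (hF.contDiffAt (Metric.isOpen_ball.mem_nhds (smul_sphere_mem_ball hr θ))).differentiableAt
        (by norm_num)
      exact this.hasFDerivAt.comp_hasDerivAt r (hline θ r)
  · refine hasDerivAt_integral_of_compact (ν := sphereMeasure k)
      (Φ := fun r θ => fderiv ℝ F (r • (θ : EuclideanSpace ℝ (Fin k))) θ *
        conj (polyFun P (θ : EuclideanSpace ℝ (Fin k))))
      (Φ' := fun r θ => fderiv ℝ (fderiv ℝ F) (r • (θ : EuclideanSpace ℝ (Fin k))) θ θ *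
        conj (polyFun P (θ : EuclideanSpace ℝ (Fin k))))
      isOpen_Ioo ?_ ?_ (fun r hr θ => ?_) hr
    · exact ((hF1.continuousOn.comp hsc hmaps).clm_apply hv).mul hP.continuousOn
    · exact (((hF2.continuousOn.comp hsc hmaps).clm_apply hv).clm_apply hv).mul hP.continuousOn
    · refine HasDerivAt.mul_const ?_ _
      have := (hF1.contDiffAt (Metric.isOpen_ball.mem_nhds (smul_sphere_mem_ball hr θ))).differentiableAt
        (by norm_num)
      have h2 := this.hasFDerivAt.comp_hasDerivAt r (hline θ r)
      simpa using h2.clm_apply (hasDerivAt_const r (θ : EuclideanSpace ℝ (Fin k)))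
  · refine continuousOn_integral_of_compact (fun r hr => ?_)
      ((((hF2.continuousOn.comp hsc hmaps).clm_apply hv).clm_apply hv).mul hP.continuousOn)
    obtain ⟨ε, hε, hball⟩ := Metric.nhds_basis_closedBall.mem_iff.1 (isOpen_Ioo.mem_nhds hr)
    exact ⟨_, isCompact_closedBall r ε, hball,
      mem_nhdsWithin_of_mem_nhds (Metric.closedBall_mem_nhds r hε)⟩

lemma continuousOn_sphereMean {R : ℝ} (P : MvPolynomial (Fin k) ℂ)
    {F : EuclideanSpace ℝ (Fin k) → ℂ} (hF : ContinuousOn F (Metric.closedBall 0 R)) :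
    ContinuousOn (sphereMean P F) (Icc (-R) R) := by
  refine continuousOn_integral_of_compact
    (fun r hr => ⟨_, isCompact_Icc, le_rfl, self_mem_nhdsWithin⟩) ?_
  refine ContinuousOn.mul (hF.comp (by fun_prop) ?_) ?_
  · rintro ⟨r, θ⟩ ⟨hr, -⟩
    have : ‖(θ : EuclideanSpace ℝ (Fin k))‖ = 1 := by simp
    rw [mem_closedBall_zero_iff, norm_smul, this, mul_one, Real.norm_eq_abs, abs_le]
    exact hr
  · exact (Complex.continuous_conj.comp ((polyFun_continuous P).comp
      (continuous_subtype_val.comp continuous_snd))).continuousOn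

lemma radialComponent_eq_sphereMean (n : ℕ) (P : MvPolynomial (Fin k) ℂ)
    (F : EuclideanSpace ℝ (Fin k) → ℂ) (t : ℝ) :
    radialComponent n P F t = ((Real.sqrt t : ℂ) ^ n)⁻¹ * sphereMean P F (Real.sqrt t) := rfl

lemma radialComponent_sq (n : ℕ) (P : MvPolynomial (Fin k) ℂ)
    (F : EuclideanSpace ℝ (Fin k) → ℂ) {r : ℝ} (hr : 0 < r) :
    (r : ℂ) ^ n * radialComponent n P F (r ^ 2) = sphereMean P F r := by
  have : (r : ℂ) ≠ 0 := by simpa using hr.ne'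
  rw [radialComponent_eq_sphereMean, Real.sqrt_sq hr.le, mul_inv_cancel_left₀ (pow_ne_zero _ this)]

lemma sqrt_mem_Ioo {R t : ℝ} (hR : 0 < R) (ht : t ∈ Ioo 0 (R ^ 2)) :
    Real.sqrt t ∈ Ioo 0 R :=
  ⟨Real.sqrt_pos.2 ht.1, (Real.sqrt_lt' hR).2 ht.2⟩

lemma contDiffOn_radialComponent {R : ℝ} (hR : 0 < R) (n : ℕ) (P : MvPolynomial (Fin k) ℂ)
    {F : EuclideanSpace ℝ (Fin k) → ℂ} (hF : ContDiffOn ℝ 2 F (Metric.ball 0 R)) :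
    ContDiffOn ℝ 2 (radialComponent n P F) (Ioo 0 (R ^ 2)) := by
  have hs : ContDiffOn ℝ 2 Real.sqrt (Ioo 0 (R ^ 2)) := fun t ht =>
    (Real.contDiffAt_sqrt ht.1.ne').contDiffWithinAt
  have h1 : ContDiffOn ℝ 2 (fun t => ((Real.sqrt t : ℝ) : ℂ)) (Ioo 0 (R ^ 2)) :=
    Complex.ofRealCLM.contDiff.comp_contDiffOn hs
  refine ContDiffOn.mul ((h1.pow n).inv fun t ht => ?_) ((contDiffOn_sphereMean P hF).comp hs ?_)
  · have : Real.sqrt t ≠ 0 := (Real.sqrt_pos.2 ht.1).ne'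
    exact pow_ne_zero n (by simpa using this)
  · intro t ht
    have := sqrt_mem_Ioo hR ht
    exact ⟨by linarith [this.1], this.2⟩

lemma continuousOn_radialComponent {R : ℝ} (hR : 0 < R) (n : ℕ) (P : MvPolynomial (Fin k) ℂ)
    {F : EuclideanSpace ℝ (Fin k) → ℂ} (hF : ContinuousOn F (Metric.closedBall 0 R)) :
    ContinuousOn (radialComponent n P F) (Ioc 0 (R ^ 2)) := by
  have hs : ContinuousOn Real.sqrt (Ioc 0 (R ^ 2)) := Real.continuous_sqrt.continuousOn
  have h1 : ContinuousOn (fun t => ((Real.sqrt t : ℝ) : ℂ)) (Ioc 0 (R ^ 2)) :=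
    Complex.continuous_ofReal.comp_continuousOn hs
  refine ContinuousOn.mul ((h1.pow n).inv₀ fun t ht => ?_) ((continuousOn_sphereMean P hF).comp hs ?_)
  · have : Real.sqrt t ≠ 0 := (Real.sqrt_pos.2 ht.1).ne'
    exact pow_ne_zero n (by simpa using this)
  · intro t ht
    have := Real.sqrt_nonneg t
    exact ⟨by linarith, Real.sqrt_le_iff.2 ⟨hR.le, ht.2⟩⟩

/-- A skew endomorphism of a line is zero, so `L² = -μ² ≠ 0` excludes `k = 1`. The behaviour of the
Wronskian at the origin depends on this. -/
lemma two_le_of_isSkewComplex (hk : 0 < k) (h : IsSkewComplex L μ) : 2 ≤ k := by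
  by_contra hlt
  obtain rfl : k = 1 := by omega
  have h0 : L (basisVec 0) = 0 := by
    ext i
    have h1 := h.coord 0 0
    fin_cases i
    simp only [basisVec] at h1 ⊢
    simp only [Fin.zero_eta, PiLp.zero_apply]
    linarith
  have h2 := h.sq (basisVec 0)
  rw [h0, map_zero] at h2
  have h3 := congrArg (fun v => v 0) h2
  have := h.pos
  simp [this.ne'] at h3

/-- The support stays away from `0`, the only point where the square root is not smooth on the
closed half-line. This converts test functions of `r` into test functions of `t = r²`. -/
lemma contDiff_comp_sqrt {R : ℝ} {g : ℝ → ℝ} (hg : ContDiff ℝ ∞ g) (hc : HasCompactSupport g)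
    (hs : tsupport g ⊆ Ioo 0 R) :
    ContDiff ℝ ∞ (fun t : ℝ => (g (Real.sqrt t) : ℂ)) ∧
      HasCompactSupport (fun t : ℝ => (g (Real.sqrt t) : ℂ)) ∧
      tsupport (fun t : ℝ => (g (Real.sqrt t) : ℂ)) ⊆ Ioo 0 (R ^ 2) := by
  have hK : IsCompact ((fun r : ℝ => r ^ 2) '' tsupport g) :=
    IsCompact.image hc (continuous_pow 2)
  have hsub : tsupport (fun t : ℝ => (g (Real.sqrt t) : ℂ)) ⊆ (fun r : ℝ => r ^ 2) '' tsupport g :=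
      by
    refine closure_minimal (fun t ht => ?_) hK.isClosed
    have h1 : g (Real.sqrt t) ≠ 0 := by simpa using ht
    have h2 := subset_tsupport g (Function.mem_support.2 h1)
    have h3 : 0 < Real.sqrt t := (hs h2).1
    exact ⟨_, h2, Real.sq_sqrt (Real.sqrt_pos.1 h3).le⟩
  have hI : (fun r : ℝ => r ^ 2) '' tsupport g ⊆ Ioo 0 (R ^ 2) := by
    rintro _ ⟨r, hr, rfl⟩
    have h1 := (hs hr).1
    have h2 := (hs hr).2
    exact ⟨by positivity, pow_lt_pow_left₀ h2 h1.le two_ne_zero⟩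
  refine ⟨contDiff_iff_contDiffAt.2 fun t => ?_, hK.of_isClosed_subset (isClosed_tsupport _) hsub,
    hsub.trans hI⟩
  rcases lt_or_ge 0 t with ht | ht
  · exact Complex.ofRealCLM.contDiff.contDiffAt.comp t
      (hg.contDiffAt.comp t (Real.contDiffAt_sqrt ht.ne'))
  · have : t ∉ tsupport (fun t : ℝ => (g (Real.sqrt t) : ℂ)) := fun h =>
      absurd (hI (hsub h)).1 (not_lt.2 ht)
    exact contDiffAt_const.congr_of_eventuallyEq (notMem_tsupport_iff_eventuallyEq.1 this)

lemma tsupport_comp_normSq_mul {ψ : ℝ → ℂ} {R : ℝ} (hR : 0 < R) (hs : tsupport ψ ⊆ Ioo 0 (R ^ 2))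
    (w : EuclideanSpace ℝ (Fin k) → ℂ) :
    HasCompactSupport (fun x : EuclideanSpace ℝ (Fin k) => ψ (‖x‖ ^ 2) * w x) ∧
    tsupport (fun x : EuclideanSpace ℝ (Fin k) => ψ (‖x‖ ^ 2) * w x) ⊆ Metric.ball 0 R := by
  have hcl : IsClosed {x : EuclideanSpace ℝ (Fin k) | ‖x‖ ^ 2 ∈ tsupport ψ} :=
    (isClosed_tsupport ψ).preimage (by fun_prop)
  have hsub : tsupport (fun x : EuclideanSpace ℝ (Fin k) => ψ (‖x‖ ^ 2) * w x) ⊆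
      {x : EuclideanSpace ℝ (Fin k) | ‖x‖ ^ 2 ∈ tsupport ψ} := by
    refine closure_minimal (fun x hx => ?_) hcl
    exact subset_tsupport ψ (Function.mem_support.2 (left_ne_zero_of_mul hx))
  have hball : {x : EuclideanSpace ℝ (Fin k) | ‖x‖ ^ 2 ∈ tsupport ψ} ⊆ Metric.ball 0 R := by
    intro x hx
    rw [mem_ball_zero_iff]
    exact lt_of_pow_lt_pow_left₀ 2 hR.le (hs hx).2
  refine ⟨?_, hsub.trans hball⟩
  exact (isCompact_closedBall (0 : EuclideanSpace ℝ (Fin k)) R).of_isClosed_subset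
    (isClosed_tsupport _) ((hsub.trans hball).trans Metric.ball_subset_closedBall)

lemma radialOp_continuous (n : ℕ) (m : ℤ) (μ : ℝ) {φ : ℝ → ℂ} (hφ : ContDiff ℝ ∞ φ) :
    Continuous (radialOp k μ n m φ) := by
  have h1 : Continuous (iteratedDeriv 2 φ) := hφ.continuous_iteratedDeriv 2 (by norm_cast)
  have h2 : Continuous (deriv φ) := hφ.continuous_deriv (by simp)
  have h3 := hφ.continuous
  unfold radialOp
  fun_prop

lemma radialOp_tsupport_subset (n : ℕ) (m : ℤ) (μ : ℝ) (φ : ℝ → ℂ) :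
    tsupport (radialOp k μ n m φ) ⊆ tsupport φ := by
  refine closure_minimal (fun t ht => ?_) (isClosed_tsupport φ)
  by_contra hn
  have h : φ =ᶠ[𝓝 t] fun _ => 0 := notMem_tsupport_iff_eventuallyEq.1 hn
  refine ht ?_
  have h2 := h.iteratedDeriv_eq 2
  rw [radialOp, h.deriv_eq, h2, h.eq_of_nhds]
  simp

lemma conj_radialOp (n : ℕ) (m : ℤ) (μ : ℝ) {φ : ℝ → ℂ} (hφ : ∀ t, conj (φ t) = φ t) (t : ℝ) :
    conj (radialOp k μ n m φ t) = radialOp k μ n m φ t := by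
  have key : ∀ ψ : ℝ → ℂ, (∀ t, conj (ψ t) = ψ t) → ∀ t, conj (deriv ψ t) = deriv ψ t := by
    intro ψ hψ t
    have := deriv.star (f := ψ) (x := t)
    have e : (fun y => star (ψ y)) = ψ := funext hψ
    rw [e] at this
    exact this.symm
  have h1 := key φ hφ
  have h2 := key _ h1
  rw [radialOp, iteratedDeriv_succ, iteratedDeriv_one]
  simp only [map_sub, map_add, map_mul, h1 t, h2 t, hφ t, map_pow, map_div₀, Complex.conj_ofReal,
    map_natCast, map_intCast, map_ofNat, map_one]

/-- The weak form of the radial equation. -/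
lemma integral_radialOp_mul_radialComponent (hk : 0 < k) (h : IsSkewComplex L μ) {R : ℝ}
    (hR : 0 < R) {lam : ℂ} {n : ℕ} {m : ℤ} {P : MvPolynomial (Fin k) ℂ}
    (hP : P ∈ harmonicSpace L μ n m) {F : EuclideanSpace ℝ (Fin k) → ℂ}
    (hF : ContDiffOn ℝ 2 F (Metric.ball 0 R)) (hE : ∀ x ∈ Metric.ball 0 R, glz L μ F x = lam * F x)
    {φ : ℝ → ℂ} (hφ : ContDiff ℝ ∞ φ) (hs : tsupport φ ⊆ Ioo 0 (R ^ 2))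
    (hreal : ∀ t, conj (φ t) = φ t) :
    ∫ r in (0 : ℝ)..R, (r : ℂ) ^ (k - 1 + 2 * n) *
      ((radialOp k μ n m φ (r ^ 2) - lam * φ (r ^ 2)) * radialComponent n P F (r ^ 2)) = 0 := by
  have hPc : Continuous fun x : EuclideanSpace ℝ (Fin k) => conj (polyFun P x) :=
    Complex.continuous_conj.comp (polyFun_continuous P)
  have hint : ∀ ψ : ℝ → ℂ, Continuous ψ → tsupport ψ ⊆ Ioo 0 (R ^ 2) →
      Integrable fun x : EuclideanSpace ℝ (Fin k) => ψ (‖x‖ ^ 2) * conj (polyFun P x) * F x := by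
    intro ψ hψ hψs
    obtain ⟨c1, c2⟩ := tsupport_comp_normSq_mul hR hψs
      (fun x : EuclideanSpace ℝ (Fin k) => conj (polyFun P x))
    exact integrable_mul_of_tsupport ((hψ.comp (by fun_prop)).mul hPc) c1 Metric.isOpen_ball c2
      hF.continuousOn
  have hv : ContDiff ℝ ∞ (productFn φ P) := contDiff_iff_contDiffAt.2 fun x =>
    contDiffAt_productFn (N := ⊤) hφ.contDiffAt P
  obtain ⟨c1, c2⟩ := tsupport_comp_normSq_mul (k := k) hR hs (polyFun P)
  have hsym := integral_glz_symm h (hv.of_le (by norm_cast)) c1 Metric.isOpen_ball c2 hF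
  have hφ2 : ContDiff ℝ 2 φ := hφ.of_le (by norm_cast)
  have i1 := hint _ (radialOp_continuous (k := k) n m μ hφ)
    ((radialOp_tsupport_subset n m μ φ).trans hs)
  have i2 := hint _ hφ.continuous hs
  have e1 : ∀ x, conj (glz L μ (productFn φ P) x) * F x =
      radialOp k μ n m φ (‖x‖ ^ 2) * conj (polyFun P x) * F x := fun x => by
    rw [glz_productFn h hφ2.contDiffAt hP, map_mul, conj_radialOp n m μ hreal]
  -- The eigenvalue equation is known only inside the ball; outside, the test function vanishes.
  have e2 : ∀ x, conj (productFn φ P x) * glz L μ F x =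
      lam * (φ (‖x‖ ^ 2) * conj (polyFun P x) * F x) := fun x => by
    by_cases hx : x ∈ Metric.ball (0 : EuclideanSpace ℝ (Fin k)) R
    · rw [hE x hx, productFn, map_mul, hreal]; ring
    · have : productFn φ P x = 0 := image_eq_zero_of_notMem_tsupport fun hx' => hx (c2 hx')
      have h2 : φ (‖x‖ ^ 2) * polyFun P x = 0 := this
      have h3 : φ (‖x‖ ^ 2) * conj (polyFun P x) = 0 := by
        rcases mul_eq_zero.1 h2 with h3 | h3 <;> simp [h3]
      rw [this, h3]; simp
  simp only [e1, e2] at hsym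
  rw [integral_const_mul, ← sub_eq_zero, ← integral_const_mul, ← integral_sub i1 (i2.const_mul _),
    integral_polar hk (g := fun x => radialOp k μ n m φ (‖x‖ ^ 2) * conj (polyFun P x) * F x -
      lam * (φ (‖x‖ ^ 2) * conj (polyFun P x) * F x)) (i1.sub (i2.const_mul _))] at hsym
  rw [intervalIntegral.integral_of_le hR.le, ← hsym]
  have hz : ∀ r ∈ Ioi (0 : ℝ) \ Ioc 0 R, radialOp k μ n m φ (r ^ 2) = 0 ∧ φ (r ^ 2) = 0 := by
    intro r hr
    have hr0 : 0 < r := hr.1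
    have hr1 : R < r := by
      by_contra hcon
      exact hr.2 ⟨hr0, not_lt.1 hcon⟩
    have : r ^ 2 ∉ tsupport φ := fun hmem => by
      have h1 := (hs hmem).2
      have h2 : R ^ 2 < r ^ 2 := by gcongr
      linarith
    exact ⟨image_eq_zero_of_notMem_tsupport fun h' => this (radialOp_tsupport_subset n m μ φ h'),
      image_eq_zero_of_notMem_tsupport this⟩
  have hpt : ∀ r ∈ Ioi (0 : ℝ), r ^ (k - 1) • ∫ θ : Metric.sphere (0 : EuclideanSpace ℝ (Fin k)) 1,
      (radialOp k μ n m φ (‖r • (θ : EuclideanSpace ℝ (Fin k))‖ ^ 2) *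
        conj (polyFun P (r • (θ : EuclideanSpace ℝ (Fin k)))) * F
            (r • (θ : EuclideanSpace ℝ (Fin k))) -
      lam * (φ (‖r • (θ : EuclideanSpace ℝ (Fin k))‖ ^ 2) *
        conj (polyFun P (r • (θ : EuclideanSpace ℝ (Fin k)))) *
          F (r • (θ : EuclideanSpace ℝ (Fin k))))) ∂(sphereMeasure k) =
      (r : ℂ) ^ (k - 1 + 2 * n) *
      ((radialOp k μ n m φ (r ^ 2) - lam * φ (r ^ 2)) * radialComponent n P F (r ^ 2)) := by
    intro r hr
    have hr0 : (0 : ℝ) < r := hr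
    have : ∀ θ : Metric.sphere (0 : EuclideanSpace ℝ (Fin k)) 1,
        (radialOp k μ n m φ (‖r • (θ : EuclideanSpace ℝ (Fin k))‖ ^ 2) *
        conj (polyFun P (r • (θ : EuclideanSpace ℝ (Fin k)))) * F
            (r • (θ : EuclideanSpace ℝ (Fin k))) -
      lam * (φ (‖r • (θ : EuclideanSpace ℝ (Fin k))‖ ^ 2) *
        conj (polyFun P (r • (θ : EuclideanSpace ℝ (Fin k)))) *
          F (r • (θ : EuclideanSpace ℝ (Fin k))))) =
        ((radialOp k μ n m φ (r ^ 2) - lam * φ (r ^ 2)) * (r : ℂ) ^ n) *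
          (F (r • (θ : EuclideanSpace ℝ (Fin k))) *
            conj (polyFun P (θ : EuclideanSpace ℝ (Fin k)))) := by
      intro θ
      have h1 : ‖(θ : EuclideanSpace ℝ (Fin k))‖ = 1 := by simp
      rw [norm_smul, h1, mul_one, Real.norm_eq_abs, sq_abs,
        polyFun_homogeneous (mem_harmonicSpace.1 hP).1]
      simp only [map_mul, map_pow, Complex.conj_ofReal]
      ring
    simp only [this]
    rw [integral_const_mul]
    have h2 := radialComponent_sq n P F hr0
    rw [sphereMean] at h2
    rw [← h2, Complex.real_smul]
    push_cast
    ring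
  rw [← setIntegral_eq_of_subset_of_forall_sdiff_eq_zero measurableSet_Ioi
    (Ioc_subset_Ioi_self : Ioc 0 R ⊆ Ioi 0)]
  · exact setIntegral_congr_fun measurableSet_Ioi fun r hr => (hpt r hr).symm
  · intro r hr
    rw [(hz r hr).1, (hz r hr).2]
    simp

/-- The Lagrange identity for the radial operator, in the variable `r = √t`. -/
lemma hasDerivAt_lagrange {N n : ℕ} {m : ℤ} (hN : k + 2 * n = N + 1) {φ f : ℝ → ℂ} {r : ℝ}
    (hφ : ContDiffAt ℝ 2 φ (r ^ 2)) (hf : ContDiffAt ℝ 2 f (r ^ 2)) :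
    HasDerivAt (fun r : ℝ => 2 * (r : ℂ) ^ (N + 1) *
      (deriv φ (r ^ 2) * f (r ^ 2) - φ (r ^ 2) * deriv f (r ^ 2)))
      ((r : ℂ) ^ N * (radialOp k μ n m φ (r ^ 2) * f (r ^ 2) -
        φ (r ^ 2) * radialOp k μ n m f (r ^ 2))) r := by
  have d1 := (hf.differentiableAt (by norm_num)).hasDerivAt
  have d2 := hasDerivAt_deriv_of_contDiffAt hf
  have e1 := (hφ.differentiableAt (by norm_num)).hasDerivAt
  have e2 := hasDerivAt_deriv_of_contDiffAt hφ
  have hs : HasDerivAt (fun r : ℝ => r ^ 2) (2 * r) r := by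
    simpa using hasDerivAt_pow 2 r
  have hw := HasDerivAt.scomp (h := fun r : ℝ => r ^ 2) r ((e2.mul d1).sub (e1.mul d2)) hs
  have hp : HasDerivAt (fun r : ℝ => 2 * (r : ℂ) ^ (N + 1)) (2 * ((N + 1) * (r : ℂ) ^ N)) r := by
    have := ((hasDerivAt_pow (N + 1) (r : ℂ)).comp_ofReal).const_mul 2
    simpa using this
  refine (hp.mul hw).congr_deriv ?_
  simp only [Function.comp_apply, Pi.mul_apply, Pi.sub_apply, Complex.real_smul, radialOp]
  have hN' : (2 * k + 4 * n : ℂ) = 2 * (N + 1) := by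
    have : (k : ℂ) + 2 * n = N + 1 := by exact_mod_cast hN
    linear_combination 2 * this
  rw [hN']
  push_cast
  ring

/-- The radial components of an eigenfunction satisfy the radial equation. -/
lemma radialOp_radialComponent (hk : 0 < k) (h : IsSkewComplex L μ) {R : ℝ}
    (hR : 0 < R) {lam : ℂ} {n : ℕ} {m : ℤ} {P : MvPolynomial (Fin k) ℂ}
    (hP : P ∈ harmonicSpace L μ n m) {F : EuclideanSpace ℝ (Fin k) → ℂ}
    (hF : ContDiffOn ℝ 2 F (Metric.ball 0 R)) (hE : ∀ x ∈ Metric.ball 0 R, glz L μ F x =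
        lam * F x) :
    ∀ t ∈ Ioo 0 (R ^ 2), radialOp k μ n m (radialComponent n P F) t =
      lam * radialComponent n P F t := by
  set f := radialComponent n P F with hfdef
  have hf : ContDiffOn ℝ 2 f (Ioo 0 (R ^ 2)) := contDiffOn_radialComponent hR n P hF
  have hfc : ∀ t ∈ Ioo 0 (R ^ 2), ContDiffAt ℝ 2 f t := fun t ht =>
    hf.contDiffAt (Ioo_mem_nhds ht.1 ht.2)
  obtain ⟨N, hN⟩ : ∃ N, k + 2 * n = N + 1 := ⟨k + 2 * n - 1, by omega⟩
  have hN' : k - 1 + 2 * n = N := by omega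
  have hop : ContinuousOn (radialOp k μ n m f) (Ioo 0 (R ^ 2)) := by
    have h1 : ContDiffOn ℝ 1 (deriv f) (Ioo 0 (R ^ 2)) := hf.deriv_of_isOpen isOpen_Ioo
        (by norm_num)
    have h2 : ContDiffOn ℝ 0 (deriv (deriv f)) (Ioo 0 (R ^ 2)) :=
      h1.deriv_of_isOpen isOpen_Ioo (by norm_num)
    have h2' := h2.continuousOn
    have h1' := h1.continuousOn
    have h0' := hf.continuousOn
    have : radialOp k μ n m f = fun t => 4 * t * deriv (deriv f) t + (2 * k + 4 * n) * deriv f t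
        - (2 * m * μ + 4 * μ ^ 2 * (1 + t / 4)) * f t := by
      funext t
      rw [radialOp, iteratedDeriv_succ, iteratedDeriv_one]
    rw [this]
    fun_prop
  have hsq : ∀ r ∈ Ioo 0 R, r ^ 2 ∈ Ioo 0 (R ^ 2) := fun r hr =>
    ⟨pow_pos hr.1 2, pow_lt_pow_left₀ hr.2 hr.1.le two_ne_zero⟩
  set D : ℝ → ℂ := fun r => (r : ℂ) ^ N * (radialOp k μ n m f (r ^ 2) - lam * f (r ^ 2)) with hD
  have hDc : ContinuousOn D (Ioo 0 R) := by
    refine ContinuousOn.mul (by fun_prop) (ContinuousOn.sub ?_ (continuousOn_const.mul ?_))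
    · exact hop.comp (by fun_prop) hsq
    · exact hf.continuousOn.comp (by fun_prop) hsq
  have hweak : ∀ g : ℝ → ℝ, ContDiff ℝ ∞ g → HasCompactSupport g → tsupport g ⊆ Ioo 0 R →
      ∫ x, g x • D x = 0 := by
    intro g hg hc hs
    obtain ⟨p1, p2, p3⟩ := contDiff_comp_sqrt hg hc hs
    -- An arbitrary test function of `r`, rewritten in the variable `t`. The weak equation together
    -- with the Lagrange identity moves the operator from `φ` to the radial component.
    set φ : ℝ → ℂ := fun t => (g (Real.sqrt t) : ℂ) with hφdef
    have hφ2 : ContDiff ℝ 2 φ := p1.of_le (by norm_cast)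
    have w1 := integral_radialOp_mul_radialComponent hk h hR hP hF hE p1 p3
      (fun t => Complex.conj_ofReal _)
    rw [hN', ← hfdef] at w1
    have c1 : Continuous fun t => radialOp k μ n m φ t * f t :=
      continuous_mul_of_tsupport (radialOp_continuous n m μ p1) isOpen_Ioo
        ((radialOp_tsupport_subset n m μ φ).trans p3) hf.continuousOn
    have c2 : Continuous fun t => φ t * radialOp k μ n m f t :=
      continuous_mul_of_tsupport p1.continuous isOpen_Ioo p3 hop
    have c3 : Continuous fun t => φ t * f t :=
      continuous_mul_of_tsupport p1.continuous isOpen_Ioo p3 hf.continuousOn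
    have hsqc : Continuous fun r : ℝ => r ^ 2 := continuous_pow 2
    have hlag : ∫ r in (0 : ℝ)..R, (r : ℂ) ^ N * (radialOp k μ n m φ (r ^ 2) * f (r ^ 2) -
        φ (r ^ 2) * radialOp k μ n m f (r ^ 2)) = 0 := by
      have hout : ∀ r : ℝ, r ^ 2 ∉ tsupport φ → φ (r ^ 2) = 0 ∧ deriv φ (r ^ 2) = 0 := fun r hr =>
          by
        have hev : φ =ᶠ[𝓝 (r ^ 2)] fun _ => 0 := notMem_tsupport_iff_eventuallyEq.1 hr
        exact ⟨hev.eq_of_nhds, by rw [hev.deriv_eq]; simp⟩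
      -- The boundary terms vanish: at `R` by the support of `φ`, at `0` by the factor `r^{N+1}`.
      rw [intervalIntegral.integral_eq_sub_of_hasDerivAt
        (f := fun r : ℝ => 2 * (r : ℂ) ^ (N + 1) *
          (deriv φ (r ^ 2) * f (r ^ 2) - φ (r ^ 2) * deriv f (r ^ 2)))]
      · have a1 := hout R fun hm => lt_irrefl _ (p3 hm).2
        simp [a1.1, a1.2]
      · intro r _
        by_cases hr : r ^ 2 ∈ tsupport φ
        · exact hasDerivAt_lagrange hN hφ2.contDiffAt (hfc _ (p3 hr))
        · have hev : φ =ᶠ[𝓝 (r ^ 2)] fun _ => 0 := notMem_tsupport_iff_eventuallyEq.1 hr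
          have ho : {s : ℝ | s ^ 2 ∉ tsupport φ} ∈ 𝓝 r :=
            ((isClosed_tsupport φ).isOpen_compl.preimage hsqc).mem_nhds hr
          have hev2 : (fun r : ℝ => 2 * (r : ℂ) ^ (N + 1) *
              (deriv φ (r ^ 2) * f (r ^ 2) - φ (r ^ 2) * deriv f (r ^ 2))) =ᶠ[𝓝 r] fun _ => 0 := by
            filter_upwards [ho] with s hs
            simp [(hout s hs).1, (hout s hs).2]
          have : radialOp k μ n m φ (r ^ 2) = 0 :=
            image_eq_zero_of_notMem_tsupport fun h' => hr (radialOp_tsupport_subset n m μ φ h')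
          rw [this, (hout r hr).1]
          simpa using (hasDerivAt_const r (0 : ℂ)).congr_of_eventuallyEq hev2
      · refine Continuous.intervalIntegrable ?_ _ _
        exact (by fun_prop : Continuous fun r : ℝ => (r : ℂ) ^ N).mul
          ((c1.comp hsqc).sub (c2.comp hsqc))
    have hcomb : ∫ r in (0 : ℝ)..R, (g r • D r) = 0 := by
      have i1 : IntervalIntegrable (fun r : ℝ => (r : ℂ) ^ N * ((radialOp k μ n m φ (r ^ 2) -
          lam * φ (r ^ 2)) * f (r ^ 2))) volume 0 R := by
        refine Continuous.intervalIntegrable ?_ _ _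
        refine (by fun_prop : Continuous fun r : ℝ => (r : ℂ) ^ N).mul
          (((c1.comp hsqc).sub ((c3.comp hsqc).const_mul lam)).congr fun r => ?_)
        simp only [Function.comp_apply, Pi.sub_apply]
        ring
      have i2 : IntervalIntegrable (fun r : ℝ => (r : ℂ) ^ N * (radialOp k μ n m φ (r ^ 2) *
          f (r ^ 2) - φ (r ^ 2) * radialOp k μ n m f (r ^ 2))) volume 0 R :=
        Continuous.intervalIntegrable ((by fun_prop : Continuous fun r : ℝ => (r : ℂ) ^ N).mul
          ((c1.comp hsqc).sub (c2.comp hsqc))) _ _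
      rw [← sub_zero (0 : ℂ)]
      nth_rewrite 2 [← hlag]
      rw [← w1, ← intervalIntegral.integral_sub i1 i2]
      refine intervalIntegral.integral_congr fun r hr => ?_
      rw [uIcc_of_le hR.le] at hr
      have : φ (r ^ 2) = g r := by simp only [hφdef]; rw [Real.sqrt_sq hr.1]
      simp only [hD, this, Complex.real_smul]
      ring
    rw [intervalIntegral.integral_of_le hR.le] at hcomb
    rw [← hcomb, setIntegral_eq_integral_of_forall_compl_eq_zero]
    intro r hr
    have : g r = 0 := image_eq_zero_of_notMem_tsupport fun hm => hr ⟨(hs hm).1, (hs hm).2.le⟩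
    simp [this]
  -- The fundamental lemma of the calculus of variations; continuity of `D` then upgrades almost
  -- everywhere to everywhere.
  have hae := isOpen_Ioo.ae_eq_zero_of_integral_contDiff_smul_eq_zero
    (hDc.locallyIntegrableOn measurableSet_Ioo) hweak
  have hzero : EqOn D 0 (Ioo 0 R) := by
    refine Measure.eqOn_open_of_ae_eq (μ := volume) ?_ isOpen_Ioo hDc continuousOn_const
    exact (ae_restrict_iff' measurableSet_Ioo).2 hae
  intro t ht
  have hs := sqrt_mem_Ioo hR ht
  have := hzero hs
  simp only [hD, Real.sq_sqrt ht.1.le, Pi.zero_apply, mul_eq_zero] at this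
  refine sub_eq_zero.1 (this.resolve_left (pow_ne_zero _ ?_))
  simpa using hs.1.ne'

/-- With `M = r^n f(r²)` the weighted Wronskian is `r^{k+n}M f₁' - ½(r^{k+n-1}M' - n r^{k+n-2}M)f₁`,
where `M` and `M'` are continuous at `0`. For `k ≥ 2` every term tends to `0`: the power in the last
one is trivial only if `n = 0`, and then the coefficient `n` vanishes. -/
lemma tendsto_wronskian_radialComponent (hk : 2 ≤ k) {R : ℝ} (hR : 0 < R) (n : ℕ)
    (P : MvPolynomial (Fin k) ℂ) {F : EuclideanSpace ℝ (Fin k) → ℂ}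
    (hF : ContDiffOn ℝ 2 F (Metric.ball 0 R)) {f1 : ℝ → ℂ} (hf1 : ContDiff ℝ 2 f1) :
    Filter.Tendsto (fun r : ℝ => (r : ℂ) ^ (k + 2 * n) *
      (radialComponent n P F (r ^ 2) * deriv f1 (r ^ 2) -
        deriv (radialComponent n P F) (r ^ 2) * f1 (r ^ 2))) (𝓝[>] 0) (𝓝 0) := by
  obtain ⟨K, rfl⟩ : ∃ K, k = K + 2 := ⟨k - 2, by omega⟩
  set M := sphereMean P F with hM
  have hMc : ContDiffOn ℝ 2 M (Ioo (-R) R) := contDiffOn_sphereMean P hF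
  have h0 : (0 : ℝ) ∈ Ioo (-R) R := ⟨by linarith, hR⟩
  have c0 : ContinuousAt M 0 := hMc.continuousOn.continuousAt (isOpen_Ioo.mem_nhds h0)
  have hM1 : ContDiffOn ℝ 1 (deriv M) (Ioo (-R) R) := hMc.deriv_of_isOpen isOpen_Ioo (by norm_num)
  have c1 : ContinuousAt (deriv M) 0 := hM1.continuousOn.continuousAt (isOpen_Ioo.mem_nhds h0)
  have c2 : Continuous fun r : ℝ => f1 (r ^ 2) := hf1.continuous.comp (continuous_pow 2)
  have c3 : Continuous fun r : ℝ => deriv f1 (r ^ 2) :=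
    (hf1.continuous_deriv (by norm_num)).comp (continuous_pow 2)
  have hpow : ∀ N : ℕ, Continuous fun r : ℝ => (r : ℂ) ^ N := fun N => by fun_prop
  have hcont : ContinuousAt (fun r : ℝ => (r : ℂ) ^ (K + 2 + n) * M r * deriv f1 (r ^ 2) -
      1 / 2 * ((r : ℂ) ^ (K + 1 + n) * deriv M r - n * (r : ℂ) ^ (K + n) * M r) * f1 (r ^ 2)) 0 :=
    (((hpow _).continuousAt.mul c0).mul c3.continuousAt).sub
      ((continuousAt_const.mul (((hpow _).continuousAt.mul c1).sub
        ((continuousAt_const.mul (hpow _).continuousAt).mul c0))).mul c2.continuousAt)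
  have hlim := hcont.tendsto.mono_left (nhdsWithin_le_nhds (s := Ioi (0 : ℝ)))
  have hzero : (n : ℂ) * (0 : ℂ) ^ (K + n) = 0 := by
    rcases Nat.eq_zero_or_pos n with rfl | hn
    · simp
    · rw [zero_pow (by omega), mul_zero]
  have hval : ((0 : ℝ) : ℂ) ^ (K + 2 + n) * M 0 * deriv f1 (0 ^ 2) -
      1 / 2 * (((0 : ℝ) : ℂ) ^ (K + 1 + n) * deriv M 0 - n * ((0 : ℝ) : ℂ) ^ (K + n) * M 0) *
        f1 (0 ^ 2) = 0 := by
    rw [Complex.ofReal_zero, hzero, zero_pow (by omega), zero_pow (by omega)]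
    ring
  rw [hval] at hlim
  refine hlim.congr' ?_
  filter_upwards [Ioo_mem_nhdsGT hR] with r hr
  have hr0 : (r : ℂ) ≠ 0 := by simpa using hr.1.ne'
  have hsq : r ^ 2 ∈ Ioo 0 (R ^ 2) :=
    ⟨pow_pos hr.1 2, pow_lt_pow_left₀ hr.2 hr.1.le two_ne_zero⟩
  have hfd : HasDerivAt (radialComponent n P F) (deriv (radialComponent n P F) (r ^ 2)) (r ^ 2) :=
    (((contDiffOn_radialComponent hR n P hF).contDiffAt
      (Ioo_mem_nhds hsq.1 hsq.2)).differentiableAt (by norm_num)).hasDerivAt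
  have hs : HasDerivAt (fun r : ℝ => r ^ 2) (2 * r) r := by
    simpa using hasDerivAt_pow 2 r
  have hp : HasDerivAt (fun r : ℝ => (r : ℂ) ^ n) (n * (r : ℂ) ^ (n - 1)) r := by
    simpa using (hasDerivAt_pow n (r : ℂ)).comp_ofReal
  have hprod := hp.mul (HasDerivAt.scomp (h := fun r : ℝ => r ^ 2) r hfd hs)
  have hMd : HasDerivAt M (deriv M r) r :=
    ((hMc.contDiffAt (Ioo_mem_nhds (by linarith [hr.1]) hr.2)).differentiableAt
      (by norm_num)).hasDerivAt
  have hev : ((fun r : ℝ => (r : ℂ) ^ n) * (radialComponent n P F ∘ fun r : ℝ => r ^ 2)) =ᶠ[𝓝 r]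
      M := by
    filter_upwards [lt_mem_nhds hr.1] with s hs
    exact radialComponent_sq n P F hs
  have e1 := (hprod.congr_of_eventuallyEq hev.symm).unique hMd
  have e2 := radialComponent_sq n P F hr.1
  rw [← hM] at e2
  rw [← e1, ← e2]
  simp only [Function.comp_apply, Complex.real_smul]
  have e3 : (n : ℂ) * (r : ℂ) ^ (n - 1) * r = n * (r : ℂ) ^ n := by
    rcases Nat.eq_zero_or_pos n with rfl | hn
    · simp
    · rw [mul_assoc, ← pow_succ, Nat.sub_add_cancel hn]
  push_cast
  have p1 : (r : ℂ) ^ (K + 2 + n) = r ^ K * r * r * r ^ n := by ring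
  have p2 : (r : ℂ) ^ (K + 1 + n) = r ^ K * r * r ^ n := by ring
  have p3 : (r : ℂ) ^ (K + n) = r ^ K * r ^ n := by ring
  have p4 : (r : ℂ) ^ (K + 2 + 2 * n) = r ^ K * r * r * r ^ n * r ^ n := by ring
  rw [p1, p2, p3, p4]
  linear_combination (-1 / 2 * (r : ℂ) ^ K * r ^ n * radialComponent n P F (r ^ 2) * f1 (r ^ 2)) *
      e3

/-! ### Eigenfunctions over a ball -/

/-- A function on `[0, R²]`, extended by zero. -/
def truncate (R : ℝ) (f : ℝ → ℂ) : ℝ → ℂ := (Icc 0 (R ^ 2)).indicator f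

lemma truncate_of_mem {R : ℝ} {f : ℝ → ℂ} {t : ℝ} (ht : t ∈ Icc 0 (R ^ 2)) :
    truncate R f t = f t := indicator_of_mem ht f

lemma truncate_mem_radialEigenspace {R A B : ℝ} {n : ℕ} {m : ℤ} {lam c : ℂ}
    {f1 : ℝ → ℂ} (hf1 : ContDiff ℝ 2 f1) (hode1 : ∀ t, radialOp k μ n m f1 t = lam * f1 t)
    (hbc : c * (A * deriv f1 (R ^ 2) + B * f1 (R ^ 2)) = 0) :
    truncate R (c • f1) ∈ radialEigenspace k μ R A B n m lam := by
  have hcf : ContDiff ℝ 2 (c • f1) := contDiff_const.smul hf1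
  have hmem : R ^ 2 ∈ Icc 0 (R ^ 2) := ⟨sq_nonneg R, le_refl _⟩
  have hE : EqOn (truncate R (c • f1)) (c • f1) (Icc 0 (R ^ 2)) := fun t ht => truncate_of_mem ht
  refine ⟨fun t ht => indicator_of_notMem ht _, hcf.contDiffOn.congr hE, fun t ht => ?_,
    c * deriv f1 (R ^ 2), ?_, ?_⟩
  · have hev : truncate R (c • f1) =ᶠ[𝓝 t] c • f1 := hE.eventuallyEq_of_mem (Icc_mem_nhds ht.1 ht.2)
    have e3 := iteratedDeriv_const_smul (hf1.contDiffAt (x := t)) c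
    have e4 := deriv_const_smul c (hf1.differentiable (by norm_num) t)
    have q2 := hode1 t
    have q1 := hev.iteratedDeriv_eq 2
    simp only [radialOp] at q2 ⊢
    rw [q1, hev.deriv_eq, hev.eq_of_nhds, e3, e4]
    simp only [Pi.smul_apply, smul_eq_mul]
    linear_combination c * q2
  · refine HasDerivWithinAt.congr ?_ hE (hE hmem)
    exact ((hf1.differentiable (by norm_num) (R ^ 2)).hasDerivAt.const_mul c).hasDerivWithinAt
  · rw [hE hmem, Pi.smul_apply, smul_eq_mul]
    linear_combination hbc

/-- Being `C²` up to `t = 0`, `f` has a bounded Wronskian with `f₁`, so the weight `r^{k+2n}` with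
positive exponent kills it at the origin. The scalar `c` is kept inside the boundary condition so
that `c = 0` covers the zero function. -/
lemma exists_of_mem_radialEigenspace (hk : 0 < k) {R A B : ℝ} (hR : 0 < R) {n : ℕ} {m : ℤ} {lam : ℂ}
    {f1 : ℝ → ℂ} (hf1 : ContDiff ℝ 2 f1) (hf10 : f1 0 = 1)
    (hode1 : ∀ t, radialOp k μ n m f1 t = lam * f1 t)
    {f : ℝ → ℂ} (hf : f ∈ radialEigenspace k μ R A B n m lam) :
    ∃ c : ℂ, c * (A * deriv f1 (R ^ 2) + B * f1 (R ^ 2)) = 0 ∧ f = truncate R (c • f1) := by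
  obtain ⟨z, hc, hode, d, hd, hbc⟩ := hf
  have hR2 : 0 < R ^ 2 := by positivity
  have hu : UniqueDiffOn ℝ (Icc 0 (R ^ 2)) := uniqueDiffOn_Icc hR2
  have hd1 : ContinuousOn (derivWithin f (Icc 0 (R ^ 2))) (Icc 0 (R ^ 2)) :=
    hc.continuousOn_derivWithin hu (by norm_num)
  obtain ⟨C1, hC1⟩ := isCompact_Icc.exists_bound_of_continuousOn hd1
  obtain ⟨C0, hC0⟩ := isCompact_Icc.exists_bound_of_continuousOn hc.continuousOn
  obtain ⟨C2, hC2⟩ := (isCompact_Icc (a := 0) (b := R ^ 2)).exists_bound_of_continuousOn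
    hf1.continuous.continuousOn
  obtain ⟨C3, hC3⟩ := (isCompact_Icc (a := 0) (b := R ^ 2)).exists_bound_of_continuousOn
    (hf1.continuous_deriv (by norm_num)).continuousOn
  have hlim : Filter.Tendsto (fun r : ℝ => (r : ℂ) ^ (k + 2 * n) *
      (f (r ^ 2) * deriv f1 (r ^ 2) - deriv f (r ^ 2) * f1 (r ^ 2))) (𝓝[>] 0) (𝓝 0) := by
    have h1 : Filter.Tendsto (fun r : ℝ => (r : ℂ) ^ (k + 2 * n)) (𝓝[>] 0) (𝓝 0) := by
      have : Continuous fun r : ℝ => (r : ℂ) ^ (k + 2 * n) := by fun_prop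
      have h2 := (this.tendsto 0).mono_left (nhdsWithin_le_nhds (s := Ioi (0 : ℝ)))
      rwa [Complex.ofReal_zero, zero_pow (show k + 2 * n ≠ 0 by omega)] at h2
    refine h1.zero_mul_isBoundedUnder_le (Filter.isBoundedUnder_of_eventually_le
      (a := C0 * C3 + C1 * C2) ?_)
    filter_upwards [Ioo_mem_nhdsGT hR] with r hr
    have hsq : r ^ 2 ∈ Ioo 0 (R ^ 2) :=
      ⟨pow_pos hr.1 2, pow_lt_pow_left₀ hr.2 hr.1.le two_ne_zero⟩
    have hI := Ioo_subset_Icc_self hsq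
    have e := derivWithin_of_mem_nhds (f := f) (Icc_mem_nhds hsq.1 hsq.2)
    have b0 := hC0 _ hI
    have b1 := hC1 _ hI
    have b2 := hC2 _ hI
    have b3 := hC3 _ hI
    rw [e] at b1
    refine (norm_sub_le _ _).trans ?_
    rw [norm_mul, norm_mul]
    exact add_le_add (mul_le_mul b0 b3 (norm_nonneg _) ((norm_nonneg _).trans b0))
      (mul_le_mul b1 b2 (norm_nonneg _) ((norm_nonneg _).trans b1))
  obtain ⟨c, hcE⟩ := exists_eq_mul_of_wronskian hR (hc.mono Ioo_subset_Icc_self) hode hf1 hf10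
    hode1 hlim
  have hE : EqOn f (c • f1) (Icc 0 (R ^ 2)) := by
    rw [← closure_Ioo hR2.ne]
    refine EqOn.of_subset_closure (s := Ioo 0 (R ^ 2)) (fun t ht => hcE t ht) ?_
      (hf1.continuous.const_smul c).continuousOn subset_closure le_rfl
    rw [closure_Ioo hR2.ne]
    exact hc.continuousOn
  have hmem : R ^ 2 ∈ Icc 0 (R ^ 2) := ⟨sq_nonneg R, le_refl _⟩
  refine ⟨c, ?_, ?_⟩
  · have h2 : HasDerivWithinAt f (c * deriv f1 (R ^ 2)) (Icc 0 (R ^ 2)) (R ^ 2) :=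
      HasDerivWithinAt.congr
        ((hf1.differentiable (by norm_num) (R ^ 2)).hasDerivAt.const_mul c).hasDerivWithinAt
        hE (hE hmem)
    rw [(hu _ hmem).eq_deriv _ hd h2, hE hmem, Pi.smul_apply, smul_eq_mul] at hbc
    linear_combination hbc
  · funext t
    by_cases ht : t ∈ Icc 0 (R ^ 2)
    · rw [truncate_of_mem ht, hE ht]
    · rw [z t ht, truncate, indicator_of_notMem ht]

/-- The radial components of an eigenfunction over the ball are multiples of the regular radial
eigenfunction. -/
lemma radialComponent_of_mem_ballEigenspace (hk : 0 < k) (h : IsSkewComplex L μ) {R A B : ℝ}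
    (hR : 0 < R) {n : ℕ} {m : ℤ} {lam : ℂ} {f1 : ℝ → ℂ} (hf1 : ContDiff ℝ 2 f1) (hf10 : f1 0 = 1)
    (hode1 : ∀ t, radialOp k μ n m f1 t = lam * f1 t)
    {F : EuclideanSpace ℝ (Fin k) → ℂ} (hF : F ∈ ballEigenspace L μ R A B lam)
    {P : MvPolynomial (Fin k) ℂ} (hP : P ∈ harmonicSpace L μ n m) :
    ∃ c : ℂ, c * (A * deriv f1 (R ^ 2) + B * f1 (R ^ 2)) = 0 ∧
      ∀ t ∈ Ioc 0 (R ^ 2), radialComponent n P F t = c * f1 t := by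
  obtain ⟨-, hc, hE, hb⟩ := hF
  have hR2 : 0 < R ^ 2 := by positivity
  have hball : ContDiffOn ℝ 2 F (Metric.ball 0 R) := hc.mono Metric.ball_subset_closedBall
  obtain ⟨c, hcE⟩ := exists_eq_mul_of_wronskian hR (contDiffOn_radialComponent hR n P hball)
    (radialOp_radialComponent hk h hR hP hball hE) hf1 hf10 hode1
    (tendsto_wronskian_radialComponent (two_le_of_isSkewComplex hk h) hR n P hball hf1)
  have hmem : R ^ 2 ∈ Ioc 0 (R ^ 2) := ⟨hR2, le_refl _⟩
  have hEq : EqOn (radialComponent n P F) (c • f1) (Ioc 0 (R ^ 2)) :=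
    EqOn.of_subset_closure (s := Ioo 0 (R ^ 2)) (fun t ht => hcE t ht)
      (continuousOn_radialComponent hR n P hc.continuousOn)
      (hf1.continuous.const_smul c).continuousOn Ioo_subset_Ioc_self
      (by rw [closure_Ioo hR2.ne]; exact Ioc_subset_Icc_self)
  refine ⟨c, ?_, fun t ht => hEq ht⟩
  obtain ⟨d, hd, hbc⟩ := hb n m P hP
  -- At `t = 0` the radial component takes a conventional value (`0⁻¹ = 0` when `n > 0`), so the
  -- identity with `c f₁` is used on `(0, R²]` only.
  have hd' := hd.mono (Ioc_subset_Icc_self)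
  have h2 : HasDerivWithinAt (radialComponent n P F) (c * deriv f1 (R ^ 2)) (Ioc 0 (R ^ 2))
      (R ^ 2) :=
    HasDerivWithinAt.congr
      ((hf1.differentiable (by norm_num) (R ^ 2)).hasDerivAt.const_mul c).hasDerivWithinAt
      hEq (hEq hmem)
  have hu : UniqueDiffWithinAt ℝ (Ioc 0 (R ^ 2)) (R ^ 2) := uniqueDiffOn_Ioc 0 (R ^ 2) _ hmem
  rw [hu.eq_deriv _ hd' h2, hEq hmem, Pi.smul_apply, smul_eq_mul] at hbc
  linear_combination hbc

lemma contDiff_productFn {f : ℝ → ℂ} (hf : ContDiff ℝ 2 f) (P : MvPolynomial (Fin k) ℂ) :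
    ContDiff ℝ 2 (productFn f P) :=
  contDiff_iff_contDiffAt.2 fun _ => contDiffAt_productFn (N := 2) hf.contDiffAt P

lemma norm_sq_mem_Icc {R : ℝ} {x : EuclideanSpace ℝ (Fin k)} (hx : x ∈ Metric.closedBall 0 R) :
    ‖x‖ ^ 2 ∈ Icc 0 (R ^ 2) :=
  ⟨by positivity, pow_le_pow_left₀ (norm_nonneg x) (mem_closedBall_zero_iff.1 hx) 2⟩

lemma norm_sq_notMem_Icc {R : ℝ} (hR : 0 < R) {x : EuclideanSpace ℝ (Fin k)}
    (hx : x ∉ Metric.closedBall 0 R) : ‖x‖ ^ 2 ∉ Icc 0 (R ^ 2) := fun h =>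
  hx (mem_closedBall_zero_iff.2 (le_of_sq_le_sq h.2 hR.le))

lemma productFn_truncate_of_mem {R : ℝ} (f : ℝ → ℂ) (P : MvPolynomial (Fin k) ℂ)
    {x : EuclideanSpace ℝ (Fin k)} (hx : x ∈ Metric.closedBall 0 R) :
    productFn (truncate R f) P x = productFn f P x := by
  rw [productFn, productFn, truncate_of_mem (norm_sq_mem_Icc hx)]

lemma productFn_truncate_of_notMem {R : ℝ} (hR : 0 < R) (f : ℝ → ℂ) (P : MvPolynomial (Fin k) ℂ)
    {x : EuclideanSpace ℝ (Fin k)} (hx : x ∉ Metric.closedBall 0 R) :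
    productFn (truncate R f) P x = 0 := by
  rw [productFn, truncate, indicator_of_notMem (norm_sq_notMem_Icc hR hx), zero_mul]

lemma productFn_smul_sphere {n : ℕ} {P : MvPolynomial (Fin k) ℂ} (hP : P.IsHomogeneous n)
    (f : ℝ → ℂ) (r : ℝ) {θ : EuclideanSpace ℝ (Fin k)} (hθ : ‖θ‖ = 1) :
    productFn f P (r • θ) = f (r ^ 2) * (r : ℂ) ^ n * polyFun P θ := by
  rw [productFn, norm_smul, hθ, mul_one, Real.norm_eq_abs, sq_abs, polyFun_homogeneous hP]
  ring

lemma smul_sphere_mem_closedBall {R r : ℝ} (hr : r ∈ Icc 0 R) {θ : EuclideanSpace ℝ (Fin k)}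
    (hθ : ‖θ‖ = 1) : r • θ ∈ Metric.closedBall (0 : EuclideanSpace ℝ (Fin k)) R := by
  rw [mem_closedBall_zero_iff, norm_smul, hθ, mul_one, Real.norm_eq_abs, abs_of_nonneg hr.1]
  exact hr.2

/-- The product functions are eigenfunctions over the ball. -/
lemma productFn_mem_ballEigenspace (hk : 0 < k) (h : IsSkewComplex L μ) {R A B : ℝ}
    (hR : 0 < R) {n : ℕ} {m : ℤ} {lam c : ℂ} {f1 : ℝ → ℂ} (hf1 : ContDiff ℝ 2 f1)
    (hode1 : ∀ t, radialOp k μ n m f1 t = lam * f1 t)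
    (hbc : c * (A * deriv f1 (R ^ 2) + B * f1 (R ^ 2)) = 0)
    {P : MvPolynomial (Fin k) ℂ} (hP : P ∈ harmonicSpace L μ n m) :
    productFn (truncate R (c • f1)) P ∈ ballEigenspace L μ R A B lam ⊓ sector L μ R n m := by
  have hhom := (mem_harmonicSpace.1 hP).1
  have hR2 : 0 < R ^ 2 := by positivity
  have hcf : ContDiff ℝ 2 (c • f1) := contDiff_const.smul hf1
  have hop : ∀ t, radialOp k μ n m (c • f1) t = lam * (c • f1) t := fun t => by
    have e3 := iteratedDeriv_const_smul (hf1.contDiffAt (x := t)) c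
    have e4 := deriv_const_smul c (hf1.differentiable (by norm_num) t)
    have q2 := hode1 t
    simp only [radialOp] at q2 ⊢
    rw [e3, e4]
    simp only [Pi.smul_apply, smul_eq_mul]
    linear_combination c * q2
  have hE : EqOn (productFn (truncate R (c • f1)) P) (productFn (c • f1) P)
      (Metric.closedBall 0 R) := fun x hx => productFn_truncate_of_mem _ P hx
  refine ⟨⟨fun x hx => productFn_truncate_of_notMem hR _ P hx,
    (contDiff_productFn hcf P).contDiffOn.congr hE, fun x hx => ?_, fun n' m' P' hP' => ?_⟩, ?_⟩
  · have hx' := Metric.ball_subset_closedBall hx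
    have hev : productFn (truncate R (c • f1)) P =ᶠ[𝓝 x] productFn (c • f1) P :=
      hE.eventuallyEq_of_mem (Filter.mem_of_superset (Metric.isOpen_ball.mem_nhds hx)
        Metric.ball_subset_closedBall)
    have : glz L μ (productFn (truncate R (c • f1)) P) x = glz L μ (productFn (c • f1) P) x := by
      simp only [glz, (InnerProductSpace.laplacian_congr_nhds hev).eq_of_nhds, hev.fderiv_eq,
        hev.eq_of_nhds]
    rw [this, glz_productFn h hcf.contDiffAt hP, hop, hE hx', productFn]
    ring
  · have hrc : ∀ t ∈ Ioc 0 (R ^ 2), radialComponent n' P' (productFn (truncate R (c • f1)) P) t =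
        sphereInt P P' * (c * f1 t) := by
      intro t ht
      have hs : 0 < Real.sqrt t := Real.sqrt_pos.2 ht.1
      have hs' : ((Real.sqrt t : ℝ) : ℂ) ≠ 0 := by simpa using hs.ne'
      have : ∀ θ : Metric.sphere (0 : EuclideanSpace ℝ (Fin k)) 1,
          productFn (truncate R (c • f1)) P (Real.sqrt t • (θ : EuclideanSpace ℝ (Fin k))) *
            conj (polyFun P' (θ : EuclideanSpace ℝ (Fin k))) =
          (c * f1 t * (Real.sqrt t : ℂ) ^ n) * (polyFun P (θ : EuclideanSpace ℝ (Fin k)) *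
            conj (polyFun P' (θ : EuclideanSpace ℝ (Fin k)))) := fun θ => by
        have h1 : ‖(θ : EuclideanSpace ℝ (Fin k))‖ = 1 := by simp
        rw [hE (smul_sphere_mem_closedBall ⟨hs.le, Real.sqrt_le_iff.2 ⟨hR.le, ht.2⟩⟩ h1),
          productFn_smul_sphere hhom _ _ h1, Real.sq_sqrt ht.1.le]
        simp only [Pi.smul_apply, smul_eq_mul]
        ring
      simp only [radialComponent, this]
      rw [integral_const_mul]
      change _ * (_ * sphereInt P P') = _
      -- Sectors are orthogonal on the sphere, so only components in the own sector survive, and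
      -- these are constant multiples of `c f₁`.
      by_cases hne : (n, m) = (n', m')
      · obtain ⟨rfl, rfl⟩ := Prod.mk.inj hne
        field_simp
      · rw [sphereInt_eq_zero hk h hP hP' hne]
        ring
    have hmem : R ^ 2 ∈ Ioc 0 (R ^ 2) := ⟨hR2, le_refl _⟩
    refine ⟨sphereInt P P' * (c * deriv f1 (R ^ 2)), ?_, ?_⟩
    -- The derivative at `R²` only involves `t` near `R²`, so the value at `t = 0` is irrelevant.
    · refine HasDerivWithinAt.congr_of_eventuallyEq
        (((hf1.differentiable (by norm_num) (R ^ 2)).hasDerivAt.const_mul c).const_mul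
          (sphereInt P P')).hasDerivWithinAt ?_ (hrc _ hmem)
      filter_upwards [self_mem_nhdsWithin, nhdsWithin_le_nhds (lt_mem_nhds hR2)] with t h1 h2
      exact hrc t ⟨h2, h1.2⟩
    · rw [hrc _ hmem]
      linear_combination sphereInt P P' * hbc
  · intro r hr
    refine ⟨(c * f1 (r ^ 2) * (r : ℂ) ^ n) • P, Submodule.smul_mem _ _ hP, fun θ hθ => ?_⟩
    rw [hE (smul_sphere_mem_closedBall ⟨hr.1.le, hr.2⟩ hθ), productFn_smul_sphere hhom _ _ hθ,
      polyFun_smul, Pi.smul_apply, smul_eq_mul]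

/-- On each sphere `F` expands in an orthonormal basis of `H^{(n,m)}` whose coefficients are radial
components, up to the factor `r^n`. All of these are multiples `c_j f₁` of the same function, so the
angular part `P = ∑ c_j e_j` is the same for every radius. -/
lemma exists_productFn_of_mem_sector (hk : 0 < k) (h : IsSkewComplex L μ) {R A B : ℝ}
    (hR : 0 < R) {n : ℕ} {m : ℤ} {lam : ℂ} {f1 : ℝ → ℂ} (hf1 : ContDiff ℝ 2 f1) (hf10 : f1 0 = 1)
    (hode1 : ∀ t, radialOp k μ n m f1 t = lam * f1 t)
    {F : EuclideanSpace ℝ (Fin k) → ℂ} (hF : F ∈ ballEigenspace L μ R A B lam)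
    (hS : F ∈ sector L μ R n m) :
    ∃ c : ℂ, c * (A * deriv f1 (R ^ 2) + B * f1 (R ^ 2)) = 0 ∧ ∃ P ∈ harmonicSpace L μ n m,
      F = productFn (truncate R (c • f1)) P := by
  obtain ⟨d, e, he, hon, hex⟩ := exists_orthonormal_basis (L := L) (μ := μ) hk n m
  choose c hc hcE using fun j =>
    radialComponent_of_mem_ballEigenspace hk h hR hf1 hf10 hode1 hF (he j)
  set P := ∑ j, c j • e j with hPdef
  have hP : P ∈ harmonicSpace L μ n m :=
    Submodule.sum_mem _ fun j _ => Submodule.smul_mem _ _ (he j)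
  have hsph : ∀ r ∈ Ioc 0 R, ∀ θ : EuclideanSpace ℝ (Fin k), ‖θ‖ = 1 →
      F (r • θ) = productFn f1 P (r • θ) := by
    intro r hr θ hθ
    obtain ⟨Q, hQ, hQF⟩ := hS r hr
    have hco : ∀ j, sphereInt Q (e j) = (r : ℂ) ^ n * (c j * f1 (r ^ 2)) := fun j => by
      have h2 : r ^ 2 ∈ Ioc 0 (R ^ 2) := ⟨pow_pos hr.1 2, pow_le_pow_left₀ hr.1.le hr.2 2⟩
      rw [← hcE j _ h2, radialComponent_sq n (e j) F hr.1, sphereMean, sphereInt]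
      refine integral_congr_ae (Filter.Eventually.of_forall fun θ => ?_)
      have h1 : ‖(θ : EuclideanSpace ℝ (Fin k))‖ = 1 := by simp
      simp only [hQF _ h1]
    rw [hQF θ hθ, productFn_smul_sphere (mem_harmonicSpace.1 hP).1 _ _ hθ, hex Q hQ, hPdef,
      polyFun_sum, polyFun_sum, Finset.mul_sum]
    refine Finset.sum_congr rfl fun j _ => ?_
    simp only [polyFun_smul, hco]
    ring
  have hprod : Continuous (productFn f1 P) := (contDiff_productFn hf1 P).continuous
  have hball : ∀ x ∈ Metric.closedBall (0 : EuclideanSpace ℝ (Fin k)) R, F x = productFn f1 P x :=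
      by
    intro x hx
    -- The sector condition says nothing at the origin; continuity along a ray settles it.
    by_cases hx0 : x = 0
    · subst hx0
      set θ : EuclideanSpace ℝ (Fin k) := basisVec ⟨0, hk⟩
      have hθ : ‖θ‖ = 1 := by simp [θ]
      have hEq : EqOn (fun r : ℝ => F (r • θ)) (fun r : ℝ => productFn f1 P (r • θ)) (Icc 0 R) := by
        refine EqOn.of_subset_closure (s := Ioc 0 R) (fun r hr => hsph r hr θ hθ) ?_
          (hprod.comp (by fun_prop)).continuousOn Ioc_subset_Icc_self
          (closure_Ioc hR.ne).ge
        exact hF.2.1.continuousOn.comp (by fun_prop) fun r hr => smul_sphere_mem_closedBall hr hθ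
      simpa using hEq ⟨le_refl _, hR.le⟩
    · have hn : 0 < ‖x‖ := norm_pos_iff.2 hx0
      have := hsph ‖x‖ ⟨hn, mem_closedBall_zero_iff.1 hx⟩ (‖x‖⁻¹ • x) (by
        rw [norm_smul, norm_inv, norm_norm, inv_mul_cancel₀ hn.ne'])
      rwa [smul_smul, mul_inv_cancel₀ hn.ne', one_smul] at this
  -- If `f₁` violates the boundary condition, every `c_j` is zero and so is `F`.
  by_cases hκ : (A * deriv f1 (R ^ 2) + B * f1 (R ^ 2)) = 0
  · refine ⟨1, by rw [hκ, mul_zero], P, hP, ?_⟩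
    funext x
    by_cases hx : x ∈ Metric.closedBall (0 : EuclideanSpace ℝ (Fin k)) R
    · rw [hball x hx, productFn_truncate_of_mem _ _ hx, one_smul]
    · rw [hF.1 x hx, productFn_truncate_of_notMem hR _ _ hx]
  · have hc0 : ∀ j, c j = 0 := fun j => (mul_eq_zero.1 (hc j)).resolve_right hκ
    refine ⟨0, zero_mul _, P, hP, ?_⟩
    have hP0 : P = 0 := by simp [hPdef, hc0]
    funext x
    by_cases hx : x ∈ Metric.closedBall (0 : EuclideanSpace ℝ (Fin k)) R
    · rw [hball x hx, productFn_truncate_of_mem _ _ hx, hP0]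
      simp [productFn, polyFun_zero]
    · rw [hF.1 x hx, productFn_truncate_of_notMem hR _ _ hx]

lemma mem_ballEigenspace_inf_sector_iff (hk : 0 < k) (h : IsSkewComplex L μ) {R A B : ℝ}
    (hR : 0 < R) (n : ℕ) (m : ℤ) (lam : ℂ) (F : EuclideanSpace ℝ (Fin k) → ℂ) :
    F ∈ ballEigenspace L μ R A B lam ⊓ sector L μ R n m ↔
      ∃ f ∈ radialEigenspace k μ R A B n m lam, ∃ P ∈ harmonicSpace L μ n m, F = productFn f P := by
  obtain ⟨f1, hf1, hf10, hode1⟩ := exists_radial_solution (k := k) hk h.pos n m lam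
  constructor
  · rintro ⟨hF, hS⟩
    obtain ⟨c, hc, P, hP, hE⟩ := exists_productFn_of_mem_sector hk h hR hf1 hf10 hode1 hF hS
    exact ⟨_, truncate_mem_radialEigenspace hf1 hode1 hc, P, hP, hE⟩
  · rintro ⟨f, hf, P, hP, rfl⟩
    obtain ⟨c, hc, rfl⟩ := exists_of_mem_radialEigenspace hk hR hf1 hf10 hode1 hf
    exact productFn_mem_ballEigenspace hk h hR hf1 hode1 hc hP

/-- A non-zero radial eigenfunction is a multiple of `f₁`, which therefore satisfies the boundary
condition itself. Then `P ↦ f₁(|x|²)P` is an isomorphism onto the sector eigenspace; it is injective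
because `f₁(0) = 1` gives a sphere on which `f₁` does not vanish. -/
lemma rank_ballEigenspace_inf_sector (hk : 0 < k) (h : IsSkewComplex L μ) {R A B : ℝ}
    (hR : 0 < R) (n : ℕ) (m : ℤ) (lam : ℂ) (hne : radialEigenspace k μ R A B n m lam ≠ ⊥) :
    Module.rank ℂ ↥(ballEigenspace L μ R A B lam ⊓ sector L μ R n m) =
      Module.rank ℂ (harmonicSpace L μ n m) := by
  obtain ⟨f1, hf1, hf10, hode1⟩ := exists_radial_solution (k := k) hk h.pos n m lam
  obtain ⟨f, hf, hf0⟩ := Submodule.exists_mem_ne_zero_of_ne_bot hne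
  obtain ⟨c, hc, hfE⟩ := exists_of_mem_radialEigenspace hk hR hf1 hf10 hode1 hf
  have hκ : (A * deriv f1 (R ^ 2) + B * f1 (R ^ 2)) = 0 := by
    refine (mul_eq_zero.1 hc).resolve_left fun hc0 => hf0 ?_
    rw [hfE, hc0]
    funext t
    simp [truncate]
  have hmem : ∀ P : harmonicSpace L μ n m,
      productFn (truncate R f1) (P : MvPolynomial (Fin k) ℂ) ∈
        ballEigenspace L μ R A B lam ⊓ sector L μ R n m := fun P => by
    have := productFn_mem_ballEigenspace (A := A) (B := B) hk h hR hf1 hode1 (c := 1)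
      (by rw [hκ, mul_zero]) P.2
    rwa [one_smul] at this
  let Φ : harmonicSpace L μ n m →ₗ[ℂ] ↥(ballEigenspace L μ R A B lam ⊓ sector L μ R n m) :=
    { toFun := fun P => ⟨_, hmem P⟩
      map_add' := fun P Q => by
        ext x
        simp [productFn, polyFun_add, mul_add]
      map_smul' := fun a P => by
        ext x
        simp only [productFn, polyFun_smul, Submodule.coe_smul, Pi.smul_apply, smul_eq_mul,
          RingHom.id_apply]
        ring }
  refine (LinearEquiv.ofBijective Φ ⟨?_, ?_⟩).rank_eq.symm
  · rw [← LinearMap.ker_eq_bot, LinearMap.ker_eq_bot']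
    intro P hP
    have hP' : ∀ x, productFn (truncate R f1) (P : MvPolynomial (Fin k) ℂ) x = 0 := fun x =>
      congrFun (congrArg Subtype.val hP) x
    have hhom := (mem_harmonicSpace.1 P.2).1
    have hcont : ContinuousAt (fun r : ℝ => f1 (r ^ 2)) 0 :=
      (hf1.continuous.comp (continuous_pow 2)).continuousAt
    have := hcont.eventually_ne (y := 0) (by simp [hf10])
    obtain ⟨r, h1, h2⟩ :=
      ((this.filter_mono (nhdsWithin_le_nhds (s := Ioi 0))).and (Ioo_mem_nhdsGT hR)).exists
    have hr : (r : ℂ) ≠ 0 := by simpa using h2.1.ne'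
    have hz : ∀ θ : EuclideanSpace ℝ (Fin k), ‖θ‖ = 1 →
        polyFun (P : MvPolynomial (Fin k) ℂ) θ = 0 := fun θ hθ => by
      have := hP' (r • θ)
      rw [productFn_truncate_of_mem _ _ (smul_sphere_mem_closedBall ⟨h2.1.le, h2.2.le⟩ hθ),
        productFn_smul_sphere hhom _ _ hθ] at this
      exact (mul_eq_zero.1 this).resolve_left (mul_ne_zero h1 (pow_ne_zero _ hr))
    ext1
    refine eq_zero_of_sphereInt_self hk hhom ?_
    rw [sphereInt]
    refine integral_eq_zero_of_ae (Filter.Eventually.of_forall fun θ => ?_)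
    simp [hz (θ : EuclideanSpace ℝ (Fin k)) (by simp)]
  · rintro ⟨F, hF, hS⟩
    obtain ⟨a, -, P, hP, hE⟩ := exists_productFn_of_mem_sector hk h hR hf1 hf10 hode1 hF hS
    refine ⟨⟨a • P, Submodule.smul_mem _ _ hP⟩, ?_⟩
    ext x
    change productFn (truncate R f1) (a • P) x = F x
    rw [hE]
    by_cases hx : x ∈ Metric.closedBall (0 : EuclideanSpace ℝ (Fin k)) R
    · rw [productFn_truncate_of_mem _ _ hx, productFn_truncate_of_mem _ _ hx]
      simp only [productFn, polyFun_smul, Pi.smul_apply, smul_eq_mul]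
      ring
    · rw [productFn_truncate_of_notMem hR _ _ hx, productFn_truncate_of_notMem hR _ _ hx]

/-! ### Density of the sector eigenfunctions over a ball -/

/-- Polynomials are uniformly dense in the continuous functions on a closed ball. -/
lemma exists_polyFun_near {R δ : ℝ} (hδ : 0 < δ) {F : EuclideanSpace ℝ (Fin k) → ℂ}
    (hF : ContinuousOn F (Metric.closedBall 0 R)) :
    ∃ Q : MvPolynomial (Fin k) ℂ, ∀ x ∈ Metric.closedBall 0 R, ‖F x - polyFun Q x‖ ≤ δ := by
  have : CompactSpace (Metric.closedBall (0 : EuclideanSpace ℝ (Fin k)) R) :=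
    isCompact_iff_compactSpace.1 (isCompact_closedBall _ _)
  let ρ : MvPolynomial (Fin k) ℂ → C(Metric.closedBall (0 : EuclideanSpace ℝ (Fin k)) R, ℂ) :=
    fun P => ⟨fun x => polyFun P x, (polyFun_continuous P).comp continuous_subtype_val⟩
  let S : StarSubalgebra ℂ C(Metric.closedBall (0 : EuclideanSpace ℝ (Fin k)) R, ℂ) :=
    { carrier := range ρ
      mul_mem' := by
        rintro _ _ ⟨P, rfl⟩ ⟨Q, rfl⟩
        exact ⟨P * Q, by ext x; simp [ρ, polyFun_mul]⟩
      add_mem' := by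
        rintro _ _ ⟨P, rfl⟩ ⟨Q, rfl⟩
        exact ⟨P + Q, by ext x; simp [ρ, polyFun_add]⟩
      algebraMap_mem' := fun c => ⟨MvPolynomial.C c, by ext x; simp [ρ, polyFun_C]⟩
      star_mem' := by
        rintro _ ⟨P, rfl⟩
        exact ⟨polyConj P, by ext x; simp [ρ, polyFun_polyConj]⟩ }
  have hsep : S.SeparatesPoints := by
    intro x y hxy
    have : ∃ i, (x : EuclideanSpace ℝ (Fin k)) i ≠ (y : EuclideanSpace ℝ (Fin k)) i := by
      by_contra hcon
      push Not at hcon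
      exact hxy (Subtype.ext (by ext i; exact hcon i))
    obtain ⟨i, hi⟩ := this
    refine ⟨_, ⟨ρ (MvPolynomial.X i), ⟨_, rfl⟩, rfl⟩, ?_⟩
    simpa [ρ, polyFun_X] using hi
  have htop := ContinuousMap.starSubalgebra_topologicalClosure_eq_top_of_separatesPoints S hsep
  let f : C(Metric.closedBall (0 : EuclideanSpace ℝ (Fin k)) R, ℂ) :=
    ⟨fun x => F x, continuousOn_iff_continuous_domRestrict.1 hF⟩
  have hf : f ∈ closure (S : Set C(Metric.closedBall (0 : EuclideanSpace ℝ (Fin k)) R, ℂ)) := by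
    rw [← StarSubalgebra.topologicalClosure_coe, htop]
    trivial
  obtain ⟨_, ⟨Q, rfl⟩, hQ⟩ := Metric.mem_closure_iff.1 hf δ hδ
  refine ⟨Q, fun x hx => ?_⟩
  rw [dist_eq_norm] at hQ
  exact ((f - ρ Q).norm_coe_le_norm ⟨x, hx⟩).trans hQ.le

/-- The orthogonal projection onto the span of an orthonormal family is a best approximation. -/
lemma norm_sub_sum_inner_le {H ι : Type*} [NormedAddCommGroup H] [InnerProductSpace ℂ H] [Fintype ι]
    {v : ι → H} (hv : Orthonormal ℂ v) (x : H) {y : H} (hy : y ∈ Submodule.span ℂ (range v)) :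
    ‖x - ∑ i, ⟪v i, x⟫_ℂ • v i‖ ≤ ‖x - y‖ := by
  set p := ∑ i, ⟪v i, x⟫_ℂ • v i with hp
  have h1 : ∀ i, ⟪v i, x - p⟫_ℂ = 0 := fun i => by
    rw [inner_sub_right, hp, hv.inner_right_fintype, sub_self]
  have h2 : ∀ z ∈ Submodule.span ℂ (range v), ⟪z, x - p⟫_ℂ = 0 := by
    intro z hz
    induction hz using Submodule.span_induction with
    | mem z hz => obtain ⟨i, rfl⟩ := hz; exact h1 i
    | zero => exact inner_zero_left _
    | add a b _ _ ha hb => rw [inner_add_left, ha, hb, add_zero]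
    | smul c a _ ha => rw [inner_smul_left, ha, mul_zero]
  have hpm : p ∈ Submodule.span ℂ (range v) :=
    Submodule.sum_mem _ fun i _ => Submodule.smul_mem _ _ (Submodule.subset_span ⟨i, rfl⟩)
  have h3 := h2 (p - y) (Submodule.sub_mem _ hpm hy)
  have h4 : ‖x - y‖ * ‖x - y‖ = ‖p - y‖ * ‖p - y‖ + ‖x - p‖ * ‖x - p‖ := by
    have := norm_add_sq_eq_norm_sq_add_norm_sq_of_inner_eq_zero (p - y) (x - p) h3
    rwa [show p - y + (x - p) = x - y by abel] at this
  nlinarith [norm_nonneg (x - y), norm_nonneg (x - p), mul_self_nonneg ‖p - y‖]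

/-- On each sphere a polynomial coincides with a combination of spherical harmonics. -/
lemma polyFun_smul_mem_span (hk : 0 < k) (h : IsSkewComplex L μ) (Q : MvPolynomial (Fin k) ℂ)
    (r : ℝ) (g : C(Metric.sphere (0 : EuclideanSpace ℝ (Fin k)) 1, ℂ))
    (hg : ∀ θ, g θ = polyFun Q (r • (θ : EuclideanSpace ℝ (Fin k)))) :
    g ∈ Submodule.span ℂ {G | ∃ (n : ℕ) (m : ℤ), n ≤ Q.totalDegree ∧
      m ∈ Finset.Icc (-(Q.totalDegree : ℤ)) Q.totalDegree ∧
        ∃ P ∈ harmonicSpace L μ n m, G = sphereRestrict k P} := by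
  have hsc : Continuous fun θ : Metric.sphere (0 : EuclideanSpace ℝ (Fin k)) 1 =>
      r • (θ : EuclideanSpace ℝ (Fin k)) := by fun_prop
  let T : MvPolynomial (Fin k) ℂ →ₗ[ℂ] C(Metric.sphere (0 : EuclideanSpace ℝ (Fin k)) 1, ℂ) :=
    { toFun := fun P => ⟨fun θ => polyFun P (r • (θ : EuclideanSpace ℝ (Fin k))),
        (polyFun_continuous P).comp hsc⟩
      map_add' := fun P Q => by ext θ; simp [polyFun_add]
      map_smul' := fun c P => by ext θ; simp [polyFun_smul] }
  have hgT : g = T Q := by ext θ; exact hg θ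
  rw [hgT]
  have hQ := Submodule.mem_map_of_mem (f := T) (mem_span_normSqPoly_mul_harmonic hk h Q)
  rw [Submodule.map_span] at hQ
  refine Submodule.span_le.2 ?_ hQ
  rintro _ ⟨_, ⟨j, n, m, hd, P, hP, rfl⟩, rfl⟩
  have hT : T (normSqPoly k ^ j * P) = ((r : ℂ) ^ (2 * j + n)) • sphereRestrict k P := by
    ext θ
    have h1 : ‖(θ : EuclideanSpace ℝ (Fin k))‖ = 1 := by simp
    change polyFun (normSqPoly k ^ j * P) (r • (θ : EuclideanSpace ℝ (Fin k))) =
      (r : ℂ) ^ (2 * j + n) * polyFun P θ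
    rw [polyFun_mul, polyFun_pow, polyFun_normSqPoly, norm_smul, h1,
      polyFun_homogeneous (mem_harmonicSpace.1 hP).1]
    simp only [mul_one, Real.norm_eq_abs, ← Complex.ofReal_pow, sq_abs]
    push_cast
    ring
  rw [SetLike.mem_coe, hT]
  refine Submodule.smul_mem _ _ ?_
  by_cases hP0 : P = 0
  · rw [hP0, map_zero]
    exact Submodule.zero_mem _
  · obtain ⟨p, hp, hm⟩ := exists_weight_of_harmonicSpace_ne_bot h
      ((Submodule.ne_bot_iff _).2 ⟨P, hP, hP0⟩)
    refine Submodule.subset_span ⟨n, m, by omega, ?_, P, hP, rfl⟩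
    rw [Finset.mem_Icc]
    omega

/-- An eigenfunction over the ball is close, over every sphere, to a finite sum of sector
eigenfunctions. -/
lemma exists_sum_sector_near (hk : 0 < k) (h : IsSkewComplex L μ) {R A B : ℝ} (hR : 0 < R) {lam : ℂ}
    {F : EuclideanSpace ℝ (Fin k) → ℂ} (hF : F ∈ ballEigenspace L μ R A B lam) {δ : ℝ}
    (hδ : 0 < δ) :
    ∃ G ∈ ⨆ (n : ℕ) (m : ℤ), ballEigenspace L μ R A B lam ⊓ sector L μ R n m,
      ∀ r ∈ Ioc 0 R, ∫ θ, ‖F (r • (θ : EuclideanSpace ℝ (Fin k))) -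
        G (r • (θ : EuclideanSpace ℝ (Fin k)))‖ ^ 2 ∂(sphereMeasure k) ≤
          δ ^ 2 * (sphereMeasure k).real univ := by
  obtain ⟨Q, hQ⟩ := exists_polyFun_near hδ hF.2.1.continuousOn
  set N := Q.totalDegree with hN
  -- On every sphere `Q` is a combination of harmonics from these finitely many sectors, whatever
  -- the radius.
  let S : Finset (ℕ × ℤ) := Finset.range (N + 1) ×ˢ Finset.Icc (-(N : ℤ)) N
  choose d e he hon hex using fun p : ℕ × ℤ =>
    exists_orthonormal_basis (L := L) (μ := μ) hk p.1 p.2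
  choose f1 hf1 hf10 hode1 using fun p : ℕ × ℤ =>
    exists_radial_solution (k := k) hk h.pos p.1 p.2 lam
  choose c hc hcE using fun (p : ℕ × ℤ) (j : Fin (d p)) =>
    radialComponent_of_mem_ballEigenspace hk h hR (hf1 p) (hf10 p) (hode1 p) hF (he p j)
  let ι := Σ p : S, Fin (d p)
  let v : ι → Lp ℂ 2 (sphereMeasure k) := fun i => sphereLp k (sphereRestrict k (e i.1 i.2))
  have hv : Orthonormal ℂ v := by
    classical
    rw [orthonormal_iff_ite]
    rintro ⟨⟨p, hp⟩, i⟩ ⟨⟨q, hq⟩, j⟩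
    simp only [v]
    rw [inner_sphereRestrict]
    by_cases hpq : p = q
    · subst hpq
      rw [hon]
      by_cases hij : i = j
      · subst hij
        simp
      · rw [if_neg (Ne.symm hij), if_neg]
        intro hcon
        cases hcon
        exact hij rfl
    · rw [sphereInt_eq_zero hk h (he q j) (he p i) (by simpa [eq_comm] using hpq), if_neg]
      rintro ⟨⟩
      exact hpq rfl
  refine ⟨∑ i : ι, productFn (truncate R (c i.1 i.2 • f1 i.1)) (e i.1 i.2),
    Submodule.sum_mem _ fun i _ => Submodule.mem_iSup_of_mem _ (Submodule.mem_iSup_of_mem _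
      (productFn_mem_ballEigenspace hk h hR (hf1 i.1) (hode1 i.1) (hc i.1 i.2) (he i.1 i.2))),
    fun r hr => ?_⟩
  have hn : ∀ θ : Metric.sphere (0 : EuclideanSpace ℝ (Fin k)) 1,
      ‖(θ : EuclideanSpace ℝ (Fin k))‖ = 1 := fun θ => by simp
  have hmem : ∀ θ : Metric.sphere (0 : EuclideanSpace ℝ (Fin k)) 1,
      r • (θ : EuclideanSpace ℝ (Fin k)) ∈ Metric.closedBall (0 : EuclideanSpace ℝ (Fin k)) R :=
    fun θ => smul_sphere_mem_closedBall ⟨hr.1.le, hr.2⟩ (hn θ)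
  have hsc : Continuous fun θ : Metric.sphere (0 : EuclideanSpace ℝ (Fin k)) 1 =>
      r • (θ : EuclideanSpace ℝ (Fin k)) := by fun_prop
  let Fr : C(Metric.sphere (0 : EuclideanSpace ℝ (Fin k)) 1, ℂ) :=
    ⟨fun θ => F (r • (θ : EuclideanSpace ℝ (Fin k))),
      hF.2.1.continuousOn.comp_continuous hsc hmem⟩
  let Qr : C(Metric.sphere (0 : EuclideanSpace ℝ (Fin k)) 1, ℂ) :=
    ⟨fun θ => polyFun Q (r • (θ : EuclideanSpace ℝ (Fin k))), (polyFun_continuous Q).comp hsc⟩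
  have hy : sphereLp k Qr ∈ Submodule.span ℂ (range v) := by
    have h1 := Submodule.mem_map_of_mem (f := (sphereLp k).toLinearMap)
      (polyFun_smul_mem_span hk h Q r Qr fun _ => rfl)
    rw [Submodule.map_span] at h1
    refine Submodule.span_le.2 ?_ h1
    rintro _ ⟨_, ⟨n, m, hn, hm, P, hP, rfl⟩, rfl⟩
    have hp : (n, m) ∈ S := Finset.mk_mem_product (Finset.mem_range.2 (by omega)) hm
    rw [hex (n, m) P hP, map_sum, map_sum]
    refine Submodule.sum_mem _ fun j _ => ?_
    rw [map_smul, map_smul]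
    exact Submodule.smul_mem _ _ (Submodule.subset_span ⟨⟨⟨(n, m), hp⟩, j⟩, rfl⟩)
  have hcoef : ∀ i : ι, ⟪v i, sphereLp k Fr⟫_ℂ =
      (r : ℂ) ^ i.1.1.1 * (c i.1 i.2 * f1 i.1 (r ^ 2)) := fun i => by
    have h2 : r ^ 2 ∈ Ioc 0 (R ^ 2) := ⟨pow_pos hr.1 2, pow_le_pow_left₀ hr.1.le hr.2 2⟩
    rw [← hcE i.1 i.2 _ h2, radialComponent_sq _ _ F hr.1]
    exact inner_sphereLp _ _
  -- The projection of `F` on the sphere of radius `r` has the radial components as coefficients. So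
  -- it is the restriction of one sum of sector eigenfunctions, the same for all `r`.
  have hproj : sphereLp k Fr - ∑ i, ⟪v i, sphereLp k Fr⟫_ℂ • v i =
      sphereLp k (Fr - ∑ i : ι, ((r : ℂ) ^ i.1.1.1 * (c i.1 i.2 * f1 i.1 (r ^ 2))) •
        sphereRestrict k (e i.1 i.2)) := by
    rw [map_sub, map_sum]
    simp only [map_smul, hcoef, v]
  have hle := norm_sub_sum_inner_le hv (sphereLp k Fr) hy
  rw [hproj, ← map_sub] at hle
  have hsq := pow_le_pow_left₀ (norm_nonneg _) hle 2
  rw [norm_sq_sphereLp, norm_sq_sphereLp] at hsq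
  have e1 : ∀ θ : Metric.sphere (0 : EuclideanSpace ℝ (Fin k)) 1,
      (Fr - ∑ i : ι, ((r : ℂ) ^ i.1.1.1 * (c i.1 i.2 * f1 i.1 (r ^ 2))) •
        sphereRestrict k (e i.1 i.2)) θ = F (r • (θ : EuclideanSpace ℝ (Fin k))) -
        (∑ i : ι, productFn (truncate R (c i.1 i.2 • f1 i.1)) (e i.1 i.2))
          (r • (θ : EuclideanSpace ℝ (Fin k))) := fun θ => by
    rw [Finset.sum_apply, ContinuousMap.sub_apply, ContinuousMap.coe_sum, Finset.sum_apply]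
    congr 1
    refine Finset.sum_congr rfl fun i _ => ?_
    rw [productFn_truncate_of_mem _ _ (hmem θ),
      productFn_smul_sphere (mem_harmonicSpace.1 (he i.1 i.2)).1 _ _ (hn θ)]
    change ((r : ℂ) ^ i.1.1.1 * (c i.1 i.2 * f1 i.1 (r ^ 2))) * polyFun (e i.1 i.2) θ = _
    simp only [Pi.smul_apply, smul_eq_mul]
    ring
  simp only [e1] at hsq
  refine hsq.trans ?_
  have h2 : ∫ θ, ‖(Fr - Qr) θ‖ ^ 2 ∂(sphereMeasure k) ≤ ∫ _, δ ^ 2 ∂(sphereMeasure k) := by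
    refine integral_mono_of_nonneg (Filter.Eventually.of_forall fun θ => by positivity)
      (integrable_const _) (Filter.Eventually.of_forall fun θ => ?_)
    exact pow_le_pow_left₀ (norm_nonneg _) (hQ _ (hmem θ)) 2
  refine h2.trans ?_
  rw [integral_const, smul_eq_mul, mul_comm]

lemma mem_closedBall_of_iSup_sector {R A B : ℝ} {lam : ℂ}
    {G : EuclideanSpace ℝ (Fin k) → ℂ}
    (hG : G ∈ ⨆ (n : ℕ) (m : ℤ), ballEigenspace L μ R A B lam ⊓ sector L μ R n m) :
    G ∈ ballEigenspace L μ R A B lam :=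
  (iSup_le fun _ => iSup_le fun _ => inf_le_left :
    (⨆ (n : ℕ) (m : ℤ), ballEigenspace L μ R A B lam ⊓ sector L μ R n m) ≤ _) hG

/-- The sums of sector eigenfunctions are `L²`-dense in the eigenspace over the ball. -/
lemma exists_eLpNorm_sub_lt (hk : 0 < k) (h : IsSkewComplex L μ) {R A B : ℝ} (hR : 0 < R) {lam : ℂ}
    {F : EuclideanSpace ℝ (Fin k) → ℂ} (hF : F ∈ ballEigenspace L μ R A B lam) {ε : ℝ≥0∞}
    (hε : 0 < ε) :
    ∃ G ∈ ⨆ (n : ℕ) (m : ℤ), ballEigenspace L μ R A B lam ⊓ sector L μ R n m,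
      eLpNorm (F - G) 2 volume < ε := by
  obtain ⟨ε', hε', hlt⟩ : ∃ ε' : ℝ, 0 < ε' ∧ ENNReal.ofReal ε' ≤ ε := by
    refine ⟨(min ε 1).toReal, ENNReal.toReal_pos (lt_min hε one_pos).ne' ?_, ?_⟩
    · exact ((min_le_right _ _).trans_lt ENNReal.one_lt_top).ne
    · rw [ENNReal.ofReal_toReal ((min_le_right _ _).trans_lt ENNReal.one_lt_top).ne]
      exact min_le_left _ _
  set C : ℝ := (sphereMeasure k).real univ * R ^ k with hC
  have hC0 : 0 ≤ C := by positivity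
  -- `C` is the surface area of the unit sphere times `R^k`, which bounds the polar integral of a
  -- constant; then `δ²C < ε'²` because `C < (1 + C)²`.
  set δ : ℝ := ε' / (1 + C) with hδ
  have hδ0 : 0 < δ := by positivity
  have hδC : δ ^ 2 * C < ε' ^ 2 := by
    rw [hδ, div_pow, div_mul_eq_mul_div, div_lt_iff₀ (by positivity)]
    exact mul_lt_mul_of_pos_left (by nlinarith) (by positivity)
  obtain ⟨G, hG, hGr⟩ := exists_sum_sector_near hk h hR hF hδ0
  refine ⟨G, hG, lt_of_lt_of_le ?_ hlt⟩
  have hD := Submodule.sub_mem _ hF (mem_closedBall_of_iSup_sector hG)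
  set D := F - G with hDdef
  have hDc : ContinuousOn D (Metric.closedBall 0 R) := hD.2.1.continuousOn
  have hDi : D = (Metric.closedBall (0 : EuclideanSpace ℝ (Fin k)) R).indicator D := by
    refine (indicator_eq_self.2 fun x hx => ?_).symm
    by_contra hn
    exact hx (hD.1 x hn)
  have hDm : AEStronglyMeasurable D volume := by
    rw [hDi, aestronglyMeasurable_indicator_iff measurableSet_closedBall]
    exact hDc.aestronglyMeasurable measurableSet_closedBall
  have hint : Integrable (fun x => ‖D x‖ ^ 2) := by
    have h1 : IntegrableOn (fun x => ‖D x‖ ^ 2) (Metric.closedBall 0 R) :=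
      (hDc.norm.pow 2).integrableOn_compact (isCompact_closedBall _ _)
    refine h1.integrable_of_forall_notMem_eq_zero fun x hx => ?_
    rw [hD.1 x hx]
    simp
  have hmem : MemLp D 2 volume := (memLp_two_iff_integrable_sq_norm hDm).2 hint
  rw [hmem.eLpNorm_eq_integral_rpow_norm two_ne_zero ENNReal.ofNat_ne_top,
    ENNReal.ofReal_lt_ofReal_iff hε']
  have hsq : ∫ x, ‖D x‖ ^ 2 ≤ δ ^ 2 * C := by
    rw [integral_polar hk hint, setIntegral_eq_of_subset_of_forall_sdiff_eq_zero measurableSet_Ioi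
      (Ioc_subset_Ioi_self : Ioc 0 R ⊆ Ioi 0)]
    · have hle : ∀ r ∈ Ioc 0 R, r ^ (k - 1) • ∫ θ, ‖D (r • (θ : EuclideanSpace ℝ (Fin k)))‖ ^ 2
          ∂(sphereMeasure k) ≤ R ^ (k - 1) * (δ ^ 2 * (sphereMeasure k).real univ) := by
        intro r hr
        have hr0 : 0 ≤ r := hr.1.le
        have hle' := hGr r hr
        rw [smul_eq_mul]
        refine mul_le_mul (pow_le_pow_left₀ hr0 hr.2 _) hle' ?_ (by positivity)
        exact integral_nonneg fun θ => by positivity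
      have hb : ∫ r in Ioc 0 R, r ^ (k - 1) • ∫ θ, ‖D (r • (θ : EuclideanSpace ℝ (Fin k)))‖ ^ 2
          ∂(sphereMeasure k) ≤
          ∫ _ in Ioc 0 R, R ^ (k - 1) * (δ ^ 2 * (sphereMeasure k).real univ) := by
        refine integral_mono_of_nonneg ?_ (integrable_const _) ?_
        · filter_upwards [ae_restrict_mem measurableSet_Ioc] with r hr
          have hr0 : 0 ≤ r := hr.1.le
          exact smul_nonneg (by positivity) (integral_nonneg fun θ => by positivity)
        · filter_upwards [ae_restrict_mem measurableSet_Ioc] with r hr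
          exact hle r hr
      refine hb.trans (le_of_eq ?_)
      rw [integral_const, measureReal_restrict_apply_univ, Real.volume_real_Ioc_of_le hR.le, hC]
      obtain ⟨K, rfl⟩ : ∃ K, k = K + 1 := ⟨k - 1, by omega⟩
      simp only [Nat.add_sub_cancel, smul_eq_mul, sub_zero, pow_succ]
      ring
    · intro r hr
      have hr1 : R < r := by
        by_contra hcon
        exact hr.2 ⟨hr.1, not_lt.1 hcon⟩
      have hz : ∀ θ : Metric.sphere (0 : EuclideanSpace ℝ (Fin k)) 1,
          D (r • (θ : EuclideanSpace ℝ (Fin k))) = 0 := fun θ => by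
        refine hD.1 _ fun hmem => ?_
        have h1 : ‖(θ : EuclideanSpace ℝ (Fin k))‖ = 1 := by simp
        rw [mem_closedBall_zero_iff, norm_smul, h1, mul_one, Real.norm_eq_abs,
          abs_of_pos (hR.trans hr1)] at hmem
        linarith
      simp [hz]
  have he : ∫ x, ‖D x‖ ^ (2 : ℝ≥0∞).toReal = ∫ x, ‖D x‖ ^ 2 := by
    simp
  rw [he, ENNReal.toReal_ofNat, ← one_div, ← Real.sqrt_eq_rpow, Real.sqrt_lt' hε']
  exact hsq.trans_lt hδC

/-! ### The operator in L² and its eigenfunctions as test functions -/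

/-- The product of a polynomial and the Gaussian as an element of `L²`. -/
def gaussLp (hμ : 0 < μ) : MvPolynomial (Fin k) ℂ →ₗ[ℂ]
    Lp ℂ 2 (volume : Measure (EuclideanSpace ℝ (Fin k))) where
  toFun Q := MemLp.toLp (gaussFn μ Q) (gaussFn_memLp Q hμ)
  map_add' P Q := by
    rw [← MemLp.toLp_add]
    refine MemLp.toLp_congr _ _ (Filter.Eventually.of_forall fun x => ?_)
    simp only [gaussFn, polyFun_add, Pi.add_apply, add_mul]
  map_smul' c P := by
    rw [RingHom.id_apply, ← MemLp.toLp_const_smul]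
    refine MemLp.toLp_congr _ _ (Filter.Eventually.of_forall fun x => ?_)
    simp only [gaussFn, polyFun_smul, Pi.smul_apply, smul_eq_mul, mul_assoc]

lemma coeFn_gaussLp (hμ : 0 < μ) (Q : MvPolynomial (Fin k) ℂ) :
    gaussLp hμ Q =ᵐ[volume] gaussFn μ Q := MemLp.coeFn_toLp (gaussFn_memLp Q hμ)

lemma inner_toLp {f : EuclideanSpace ℝ (Fin k) → ℂ} (hf : MemLp f 2 volume)
    (u : Lp ℂ 2 (volume : Measure (EuclideanSpace ℝ (Fin k)))) :
    ⟪hf.toLp f, u⟫_ℂ = ∫ x, conj (f x) * u x := by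
  rw [L2.inner_def]
  refine integral_congr_ae ?_
  filter_upwards [hf.coeFn_toLp] with x hx
  rw [hx, RCLike.inner_apply, mul_comm]

lemma inner_gaussLp (hμ : 0 < μ) (Q : MvPolynomial (Fin k) ℂ)
    (u : Lp ℂ 2 (volume : Measure (EuclideanSpace ℝ (Fin k)))) :
    ⟪gaussLp hμ Q, u⟫_ℂ = ∫ x, conj (gaussFn μ Q x) * u x :=
  inner_toLp (gaussFn_memLp Q hμ) u

lemma gaussLp_injective (hμ : 0 < μ) : Function.Injective (gaussLp (k := k) hμ) := by
  rw [← LinearMap.ker_eq_bot, LinearMap.ker_eq_bot']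
  intro Q hQ
  have h1 : gaussFn μ Q =ᵐ[volume] (fun _ => 0 : EuclideanSpace ℝ (Fin k) → ℂ) := by
    have h2 := (coeFn_gaussLp hμ Q).symm
    rw [hQ] at h2
    exact h2.trans (Lp.coeFn_zero _ _ _)
  have h3 := (gaussFn_contDiff μ Q).continuous.ae_eq_iff_eq volume continuous_const |>.1 h1
  refine polyFun_injective fun x => ?_
  have h4 := congrFun h3 x
  rw [gaussFn, mul_eq_zero] at h4
  rw [polyFun_zero]
  exact h4.resolve_right (by simp)

/-- The eigenfunction `laguerreFn` as an element of `L²`. -/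
def laguerreLp (hμ : 0 < μ) (r n : ℕ) (P : MvPolynomial (Fin k) ℂ) :
    Lp ℂ 2 (volume : Measure (EuclideanSpace ℝ (Fin k))) :=
  gaussLp hμ (radialPoly μ (laguerre r ((k : ℝ) / 2 + n - 1)) P)

lemma coeFn_laguerreLp (hμ : 0 < μ) (r n : ℕ) (P : MvPolynomial (Fin k) ℂ) :
    laguerreLp hμ r n P =ᵐ[volume] laguerreFn μ r n P := by
  rw [laguerreFn_eq_gaussFn]
  exact coeFn_gaussLp hμ _

lemma eq_laguerreLp_iff (hμ : 0 < μ) (r n : ℕ) (P : MvPolynomial (Fin k) ℂ)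
    (u : Lp ℂ 2 (volume : Measure (EuclideanSpace ℝ (Fin k)))) :
    u =ᵐ[volume] laguerreFn μ r n P ↔ u = laguerreLp hμ r n P :=
  ⟨fun h => Lp.ext (h.trans (coeFn_laguerreLp hμ r n P).symm),
    fun h => h ▸ coeFn_laguerreLp hμ r n P⟩

/-- The eigenfunctions belong to the graph of the `L²`-operator. -/
lemma laguerreLp_mem_l2Graph (h : IsSkewComplex L μ) (r : ℕ) {n : ℕ} {m : ℤ}
    {P : MvPolynomial (Fin k) ℂ} (hP : P ∈ harmonicSpace L μ n m) :
    (laguerreLp h.pos r n P, ((nu k μ r n m : ℝ) : ℂ) • laguerreLp h.pos r n P) ∈ l2Graph L μ := by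
  intro φ hφ hc
  have e1 : ∫ x, conj (glz L μ φ x) * (laguerreLp h.pos r n P) x =
      ∫ x, conj (glz L μ φ x) * laguerreFn μ r n P x := by
    refine integral_congr_ae ?_
    filter_upwards [coeFn_laguerreLp h.pos r n P] with x hx
    rw [hx]
  have e2 : ∫ x, conj (φ x) * (((nu k μ r n m : ℝ) : ℂ) • laguerreLp h.pos r n P :
      Lp ℂ 2 (volume : Measure (EuclideanSpace ℝ (Fin k)))) x =
      ∫ x, conj (φ x) * glz L μ (laguerreFn μ r n P) x := by
    refine integral_congr_ae ?_
    filter_upwards [coeFn_laguerreLp h.pos r n P,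
      Lp.coeFn_smul ((nu k μ r n m : ℝ) : ℂ) (laguerreLp h.pos r n P)] with x hx hx'
    rw [hx', Pi.smul_apply, hx, glz_laguerreFn h hP, smul_eq_mul]
  have hlag : ContDiff ℝ 2 (laguerreFn μ r n P) := by
    rw [laguerreFn_eq_gaussFn]
    exact (gaussFn_contDiff μ _).of_le (by norm_cast)
  change ∫ x, conj (glz L μ φ x) * (laguerreLp h.pos r n P) x = ∫ x, conj (φ x) *
    (((nu k μ r n m : ℝ) : ℂ) • laguerreLp h.pos r n P :
      Lp ℂ 2 (volume : Measure (EuclideanSpace ℝ (Fin k)))) x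
  rw [e1, e2]
  exact integral_glz_symm h (hφ.of_le (by norm_cast)) hc isOpen_univ (subset_univ _)
    hlag.contDiffOn

/-- The graph of the `L²`-operator is closed. -/
lemma isClosed_l2Graph : IsClosed (l2Graph L μ : Set
    (Lp ℂ 2 (volume : Measure (EuclideanSpace ℝ (Fin k))) ×
      Lp ℂ 2 (volume : Measure (EuclideanSpace ℝ (Fin k))))) := by
  have : (l2Graph L μ : Set (Lp ℂ 2 (volume : Measure (EuclideanSpace ℝ (Fin k))) ×
      Lp ℂ 2 (volume : Measure (EuclideanSpace ℝ (Fin k))))) =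
      ⋂ (φ : EuclideanSpace ℝ (Fin k) → ℂ) (h1 : ContDiff ℝ ∞ φ) (h2 : HasCompactSupport φ),
        {p | ⟪((glz_continuous (L := L) (μ := μ) h1).memLp_of_hasCompactSupport
            (glz_compactSupport h2) : MemLp (glz L μ φ) 2 volume).toLp _, p.1⟫_ℂ =
          ⟪(h1.continuous.memLp_of_hasCompactSupport h2 : MemLp φ 2 volume).toLp _, p.2⟫_ℂ} := by
    ext p
    simp only [mem_iInter, mem_ofPred_eq, inner_toLp]
    rfl
  rw [this]
  refine isClosed_iInter fun φ => isClosed_iInter fun h1 => isClosed_iInter fun h2 => ?_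
  exact isClosed_eq (by fun_prop) (by fun_prop)

/-- Cutting off in the variable `|x|²` at scale `1/ε` costs only `O(ε)`: the coefficient `4t` of the
second derivative absorbs one factor `ε` through `εt`, on which `c''(εt)` is supported compactly. -/
lemma radialOp_cutoff (n : ℕ) (m : ℤ) (μ ε : ℝ) {c g : ℝ → ℂ} (hc : ContDiff ℝ 2 c)
    (hg : ContDiff ℝ 2 g) (t : ℝ) :
    radialOp k μ n m (fun t => c (ε * t) * g t) t = c (ε * t) * radialOp k μ n m g t +
      ε * (8 * t * deriv c (ε * t) * deriv g t + 4 * (ε * t : ℝ) * iteratedDeriv 2 c (ε * t) * g t +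
        (2 * k + 4 * n) * deriv c (ε * t) * g t) := by
  have hs : ∀ t, HasDerivAt (fun t : ℝ => ε * t) ε t := fun t => by
    simpa using (hasDerivAt_id t).const_mul ε
  have c1 : ∀ t, HasDerivAt (fun t => c (ε * t)) (ε * deriv c (ε * t)) t := fun t => by
    exact (HasDerivAt.scomp (h := fun t : ℝ => ε * t) t
      (hc.differentiable (by norm_num) (ε * t)).hasDerivAt (hs t)).congr_deriv Complex.real_smul
  have c2 : ∀ t, HasDerivAt (fun t => deriv c (ε * t)) (ε * iteratedDeriv 2 c (ε * t)) t :=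
    fun t => by
    exact (HasDerivAt.scomp (h := fun t : ℝ => ε * t) t
      (hasDerivAt_deriv_of_contDiffAt (hc.contDiffAt (x := ε * t))) (hs t)).congr_deriv
        Complex.real_smul
  have g1 : ∀ t, HasDerivAt g (deriv g t) t := fun t => (hg.differentiable
      (by norm_num) t).hasDerivAt
  have g2 : ∀ t, HasDerivAt (deriv g) (iteratedDeriv 2 g t) t := fun t =>
    hasDerivAt_deriv_of_contDiffAt hg.contDiffAt
  have d1 : deriv (fun t => c (ε * t) * g t) =
      fun t => ε * deriv c (ε * t) * g t + c (ε * t) * deriv g t :=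
    funext fun t => ((c1 t).mul (g1 t)).deriv
  have d2 : iteratedDeriv 2 (fun t => c (ε * t) * g t) t =
      (ε * (ε * iteratedDeriv 2 c (ε * t))) * g t + ε * deriv c (ε * t) * deriv g t +
        (ε * deriv c (ε * t) * deriv g t + c (ε * t) * iteratedDeriv 2 g t) := by
    rw [iteratedDeriv_succ, iteratedDeriv_one, d1]
    exact ((((c2 t).const_mul (ε : ℂ)).mul (g1 t)).add ((c1 t).mul (g2 t))).deriv
  rw [radialOp, d2, d1, radialOp]
  push_cast
  ring

/-- Shows that `t g'` is again a polynomial in `μt` times the same exponential, so the commutator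
term with `g'` stays in `L²`. -/
lemma deriv_expRadial (μ : ℝ) (u : Polynomial ℂ) (t : ℝ) :
    t * deriv (expRadial μ u) t =
      expRadial μ (Polynomial.X * (Polynomial.derivative u - Polynomial.C (1 / 2) * u)) t := by
  have h1 : HasDerivAt (fun t : ℝ => (Real.exp (-(t * μ / 2)) : ℂ))
      ((Real.exp (-(t * μ / 2)) * (-(μ / 2)) : ℝ) : ℂ) t := by
    refine HasDerivAt.ofReal_comp (HasDerivAt.exp ?_)
    have : HasDerivAt (fun t : ℝ => -(t * μ / 2)) (-(1 * μ / 2)) t :=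
      (((hasDerivAt_id t).mul_const μ).div_const 2).neg
    exact this.congr_deriv (by ring)
  have h2 : HasDerivAt (expRadial μ u) _ t := (hasDerivAt_eval_mul u μ t).mul h1
  rw [h2.deriv, expRadial]
  simp only [Polynomial.eval_mul, Polynomial.eval_X, Polynomial.eval_sub, Polynomial.eval_C]
  push_cast
  ring

/-- The eigenfunctions are admissible test functions for the graph. -/
lemma integral_laguerreFn_of_mem_l2Graph (h : IsSkewComplex L μ)
    {u v : Lp ℂ 2 (volume : Measure (EuclideanSpace ℝ (Fin k)))} (huv : (u, v) ∈ l2Graph L μ)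
    (r : ℕ) {n : ℕ} {m : ℤ} {P : MvPolynomial (Fin k) ℂ} (hP : P ∈ harmonicSpace L μ n m) :
    ∫ x, conj ((nu k μ r n m : ℂ) * laguerreFn μ r n P x) * u x =
      ∫ x, conj (laguerreFn μ r n P x) * v x := by
  let χ : ContDiffBump (0 : ℝ) := ⟨1, 2, one_pos, one_lt_two⟩
  set c : ℝ → ℂ := fun t => (χ t : ℂ) with hc
  have hcs : ContDiff ℝ ∞ c := Complex.ofRealCLM.contDiff.comp χ.contDiff
  have hcc : HasCompactSupport c := χ.hasCompactSupport.comp_left Complex.ofReal_zero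
  have hc0 : c 0 = 1 := by
    have : χ 0 = 1 := χ.one_of_mem_closedBall (by simp [χ])
    simp [hc, this]
  have hcz : ∀ t : ℝ, 2 ≤ t → c t = 0 := fun t ht => by
    have : χ t = 0 := χ.zero_of_le_dist (by
      rw [Real.dist_eq, sub_zero, abs_of_nonneg (by linarith)]; exact ht)
    simp [hc, this]
  have hc1 : ∀ t, ‖c t‖ ≤ 1 := fun t => by
    rw [hc, Complex.norm_real, Real.norm_of_nonneg χ.nonneg]
    exact χ.le_one
  have hd1 : Continuous (deriv c) := hcs.continuous_deriv (by simp)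
  have hd2 : Continuous (iteratedDeriv 2 c) := hcs.continuous_iteratedDeriv 2 (by norm_cast)
  obtain ⟨C1, hC1⟩ := hd1.bounded_above_of_compact_support hcc.deriv
  -- The bound is on `t c''(t)`, so that it applies to `εt c''(εt)` uniformly in `ε`.
  obtain ⟨C2, hC2⟩ : ∃ C, ∀ t : ℝ, ‖(t : ℂ) * iteratedDeriv 2 c t‖ ≤ C := by
    refine Continuous.bounded_above_of_compact_support (by fun_prop) ?_
    rw [iteratedDeriv_succ, iteratedDeriv_one]
    exact hcc.deriv.deriv.mul_left
  have hC1p : 0 ≤ C1 := (norm_nonneg _).trans (hC1 0)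
  have hC2p : 0 ≤ C2 := (norm_nonneg _).trans (hC2 0)
  set U := laguerre r ((k : ℝ) / 2 + n - 1) with hU
  set g := expRadial μ U with hg
  have hgs : ContDiff ℝ ∞ g := expRadial_contDiff μ U
  set φ := laguerreFn μ r n P with hφ
  set B : EuclideanSpace ℝ (Fin k) → ℂ := fun x =>
    ((‖x‖ ^ 2 : ℝ) : ℂ) * deriv g (‖x‖ ^ 2) * polyFun P x with hB
  have hBmem : MemLp B 2 volume := by
    have : B = gaussFn μ (radialPoly μ
        (Polynomial.X * (Polynomial.derivative U - Polynomial.C (1 / 2) * U)) P) := by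
      rw [← productFn_expRadial]
      funext x
      rw [hB, productFn, ← deriv_expRadial]
    rw [this]
    exact gaussFn_memLp _ h.pos
  have hφmem : MemLp φ 2 volume := laguerreFn_memLp h.pos r n P
  set ν : ℂ := (nu k μ r n m : ℂ) with hν
  let ε : ℕ → ℝ := fun N => 1 / ((N : ℝ) + 1)
  have hε : ∀ N, 0 < ε N := fun N => by positivity
  have hε1 : ∀ N, ε N ≤ 1 := fun N => by
    rw [div_le_one (by positivity)]
    linarith [(Nat.cast_nonneg N : (0 : ℝ) ≤ N)]
  have hεlim : Filter.Tendsto ε Filter.atTop (𝓝 0) := tendsto_one_div_add_atTop_nhds_zero_nat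
  let Φ : ℝ → EuclideanSpace ℝ (Fin k) → ℂ := fun e => productFn (fun t => c (e * t) * g t) P
  have hΦs : ∀ e, ContDiff ℝ ∞ (Φ e) := fun e => contDiff_iff_contDiffAt.2 fun x =>
    contDiffAt_productFn (N := ⊤)
      ((hcs.comp (contDiff_const.mul contDiff_id)).mul hgs).contDiffAt P
  have hΦc : ∀ N, HasCompactSupport (Φ (ε N)) := fun N => by
    refine HasCompactSupport.intro (isCompact_closedBall (0 : EuclideanSpace ℝ (Fin k))
      (2 * ((N : ℝ) + 1))) fun x hx => ?_
    rw [mem_closedBall_zero_iff, not_le] at hx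
    have hN : (0 : ℝ) ≤ N := Nat.cast_nonneg N
    have h2 : 2 ≤ ε N * ‖x‖ ^ 2 := by
      rw [one_div_mul_eq_div, le_div_iff₀ (by positivity)]
      nlinarith
    change c (ε N * ‖x‖ ^ 2) * g (‖x‖ ^ 2) * polyFun P x = 0
    rw [hcz _ h2]
    ring
  -- The cut-off eigenfunction satisfies the eigenvalue equation up to `e` times fixed `L²`
  -- functions with bounded factors. With `ε N ≤ 1` this gives one integrable majorant for all `N`,
  -- and the error disappears in the limit.
  have hglz : ∀ e x, glz L μ (Φ e) x = c (e * ‖x‖ ^ 2) * (ν * φ x) +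
      e * (8 * deriv c (e * ‖x‖ ^ 2) *
      B x + 4 * ((e * ‖x‖ ^ 2 : ℝ) : ℂ) * iteratedDeriv 2 c (e * ‖x‖ ^ 2) * φ x +
        (2 * k + 4 * n) * deriv c (e * ‖x‖ ^ 2) * φ x) := fun e x => by
    have hcut : ContDiff ℝ ∞ fun t => c (e * t) * g t :=
      (hcs.comp (contDiff_const.mul contDiff_id)).mul hgs
    rw [glz_productFn h (hcut.of_le (by norm_cast)).contDiffAt hP,
      radialOp_cutoff n m μ e (hcs.of_le (by norm_cast)) (hgs.of_le (by norm_cast)), hg,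
      radialOp_laguerre, hφ, laguerreFn, productFn, hB]
    ring
  have hprod : ∀ {f : EuclideanSpace ℝ (Fin k) → ℂ}, MemLp f 2 volume →
      ∀ w : Lp ℂ 2 (volume : Measure (EuclideanSpace ℝ (Fin k))),
        Integrable fun x => ‖f x‖ * ‖w x‖ := fun hf w =>
    hf.norm.integrable_mul (Lp.memLp w).norm
  have hn2 : ∀ x : EuclideanSpace ℝ (Fin k), (0 : ℝ) ≤ 2 * k + 4 * n := fun x => by positivity
  have lim1 : Filter.Tendsto (fun N => ∫ x, conj (glz L μ (Φ (ε N)) x) * u x) Filter.atTop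
      (𝓝 (∫ x, conj (ν * φ x) * u x)) := by
    refine tendsto_integral_of_dominated_convergence (fun x =>
        (‖ν‖ + 4 * C2 + (2 * k + 4 * n) * C1) *
      (‖φ x‖ * ‖u x‖) + 8 * C1 * (‖B x‖ * ‖u x‖)) (fun N => ?_) ?_ (fun N => ?_) ?_
    · exact (Complex.continuous_conj.comp (glz_continuous (hΦs _))).aestronglyMeasurable.mul
        (Lp.aestronglyMeasurable u)
    · exact ((hprod hφmem u).const_mul _).add ((hprod hBmem u).const_mul _)
    · refine Filter.Eventually.of_forall fun x => ?_
      rw [norm_mul, RCLike.norm_conj, hglz]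
      have b0 := hc1 (ε N * ‖x‖ ^ 2)
      have b1 := hC1 (ε N * ‖x‖ ^ 2)
      have b2 := hC2 (ε N * ‖x‖ ^ 2)
      have t1 : ‖c (ε N * ‖x‖ ^ 2) * (ν * φ x)‖ ≤ ‖ν‖ * ‖φ x‖ := by
        rw [norm_mul, norm_mul]
        exact mul_le_of_le_one_left (by positivity) b0
      have t2 : ‖8 * deriv c (ε N * ‖x‖ ^ 2) * B x‖ ≤ 8 * C1 * ‖B x‖ := by
        rw [norm_mul, norm_mul, Complex.norm_ofNat]
        gcongr
      have t3 : ‖4 * ((ε N * ‖x‖ ^ 2 : ℝ) : ℂ) * iteratedDeriv 2 c (ε N * ‖x‖ ^ 2) * φ x‖ ≤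
          4 * C2 * ‖φ x‖ := by
        rw [mul_assoc (4 : ℂ), norm_mul, norm_mul, Complex.norm_ofNat]
        gcongr
      have t4 : ‖(2 * k + 4 * n) * deriv c (ε N * ‖x‖ ^ 2) * φ x‖ ≤
          (2 * k + 4 * n) * C1 * ‖φ x‖ := by
        have : ‖(2 * k + 4 * n : ℂ)‖ = 2 * k + 4 * n := by
          have e : (2 * k + 4 * n : ℂ) = ((2 * k + 4 * n : ℕ) : ℂ) := by push_cast; ring
          rw [e, Complex.norm_natCast]
          push_cast
          ring
        rw [norm_mul, norm_mul, this]
        gcongr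
      have t5 : ∀ z : ℂ, ‖(ε N : ℂ) * z‖ ≤ ‖z‖ := fun z => by
        rw [norm_mul, Complex.norm_real, Real.norm_of_nonneg (hε N).le]
        exact mul_le_of_le_one_left (norm_nonneg _) (hε1 N)
      have t6 := (norm_add_le _ _).trans (add_le_add t1 ((t5 _).trans
        ((norm_add_le _ _).trans (add_le_add ((norm_add_le _ _).trans (add_le_add t2 t3)) t4))))
      refine (mul_le_mul_of_nonneg_right t6 (norm_nonneg (u x))).trans (le_of_eq ?_)
      ring
    · refine Filter.Eventually.of_forall fun x => ?_
      refine Filter.Tendsto.mul_const _ ((Complex.continuous_conj.tendsto _).comp ?_)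
      have hcont : Continuous fun e : ℝ => glz L μ (Φ e) x := by
        have hcc' := hcs.continuous
        simp only [hglz]
        fun_prop
      have h3 := (hcont.tendsto 0).comp hεlim
      rw [hglz] at h3
      simpa [hc0, Function.comp_def] using h3
  have lim2 : Filter.Tendsto (fun N => ∫ x, conj (Φ (ε N) x) * v x) Filter.atTop
      (𝓝 (∫ x, conj (φ x) * v x)) := by
    have hΦ : ∀ e x, Φ e x = c (e * ‖x‖ ^ 2) * φ x := fun e x => by
      change c (e * ‖x‖ ^ 2) * g (‖x‖ ^ 2) * polyFun P x = _
      rw [mul_assoc]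
      rfl
    refine tendsto_integral_of_dominated_convergence (fun x => ‖φ x‖ * ‖v x‖) (fun N => ?_)
      (hprod hφmem v) (fun N => ?_) ?_
    · exact (Complex.continuous_conj.comp (hΦs _).continuous).aestronglyMeasurable.mul
        (Lp.aestronglyMeasurable v)
    · refine Filter.Eventually.of_forall fun x => ?_
      rw [norm_mul, RCLike.norm_conj, hΦ, norm_mul]
      exact mul_le_mul_of_nonneg_right (mul_le_of_le_one_left (norm_nonneg _) (hc1 _))
        (norm_nonneg _)
    · refine Filter.Eventually.of_forall fun x => ?_
      refine Filter.Tendsto.mul_const _ ((Complex.continuous_conj.tendsto _).comp ?_)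
      have hcont : Continuous fun e : ℝ => Φ e x := by
        have hcc' := hcs.continuous
        simp only [hΦ]
        fun_prop
      have h3 := (hcont.tendsto 0).comp hεlim
      rw [hΦ] at h3
      simpa [hc0, Function.comp_def] using h3
  refine tendsto_nhds_unique lim1 (lim2.congr fun N => ?_)
  exact (huv (Φ (ε N)) (hΦs _) (hΦc N)).symm

/-- The coefficients of a pair in the graph with respect to the eigenfunctions. -/
lemma inner_laguerreLp_of_mem_l2Graph (h : IsSkewComplex L μ)
    {u v : Lp ℂ 2 (volume : Measure (EuclideanSpace ℝ (Fin k)))} (huv : (u, v) ∈ l2Graph L μ)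
    (r : ℕ) {n : ℕ} {m : ℤ} {P : MvPolynomial (Fin k) ℂ} (hP : P ∈ harmonicSpace L μ n m) :
    ⟪laguerreLp h.pos r n P, v⟫_ℂ = nu k μ r n m * ⟪laguerreLp h.pos r n P, u⟫_ℂ := by
  have h1 := integral_laguerreFn_of_mem_l2Graph h huv r hP
  rw [laguerreLp, inner_gaussLp, inner_gaussLp, ← laguerreFn_eq_gaussFn, ← h1, ← integral_const_mul]
  refine integral_congr_ae (Filter.Eventually.of_forall fun x => ?_)
  simp only [map_mul, Complex.conj_ofReal]
  ring

/-! ### Completeness of the eigenfunctions -/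

open scoped FourierTransform in
/-- An integrable function with vanishing Fourier transform vanishes almost everywhere. -/
lemma ae_eq_zero_of_fourier_eq_zero {V : Type*} [NormedAddCommGroup V] [InnerProductSpace ℝ V]
    [FiniteDimensional ℝ V] [MeasurableSpace V] [BorelSpace V] {f : V → ℂ} (hf : Integrable f)
    (h : ∀ w, 𝓕 f w = 0) : ∀ᵐ x, f x = 0 := by
  refine ae_eq_zero_of_integral_contDiff_smul_eq_zero hf.locallyIntegrable fun g hg hc => ?_
  have hgc : ContDiff ℝ ∞ fun x => (g x : ℂ) := Complex.ofRealCLM.contDiff.comp hg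
  have hcc : HasCompactSupport fun x => (g x : ℂ) := hc.comp_left Complex.ofReal_zero
  -- Every test function is the Fourier transform of a Schwartz function, so the multiplication
  -- formula moves the transform onto `f`.
  let ψ : SchwartzMap V ℂ := hcc.toSchwartzMap hgc
  let G : SchwartzMap V ℂ := 𝓕⁻ ψ
  have hG : 𝓕 G = ψ := FourierTransform.fourier_fourierInv_eq ψ
  have h1 : ∫ ξ, 𝓕 (G : V → ℂ) ξ • f ξ = ∫ x, G x • 𝓕 f x := by
    simpa using! VectorFourier.integral_fourierIntegral_smul_eq_flip (L := innerₗ V)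
      Real.continuous_fourierChar continuous_inner G.integrable hf
  rw [← SchwartzMap.fourier_coe, hG] at h1
  simp only [h, smul_zero, integral_zero] at h1
  rw [← h1]
  refine integral_congr_ae (Filter.Eventually.of_forall fun x => ?_)
  simp only [Complex.real_smul, smul_eq_mul]
  rfl

/-- The products of polynomials and a Gaussian span a dense subspace of `L²`. -/
lemma eq_zero_of_inner_gaussLp_eq_zero (hμ : 0 < μ)
    {u : Lp ℂ 2 (volume : Measure (EuclideanSpace ℝ (Fin k)))}
    (hu : ∀ Q, ⟪gaussLp hμ Q, u⟫_ℂ = 0) : u = 0 := by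
  set e : EuclideanSpace ℝ (Fin k) → ℂ := fun x => (Real.exp (-(‖x‖ ^ 2 * μ / 2)) : ℂ) with he
  have hec : Continuous e := by fun_prop
  have hemem : ∀ ν : ℝ, 0 < ν →
      MemLp (fun x : EuclideanSpace ℝ (Fin k) => Real.exp (-(‖x‖ ^ 2 * ν / 2))) 2 volume := by
    intro ν hν
    refine (gaussFn_memLp (1 : MvPolynomial (Fin k) ℂ) hν).norm.congr_norm (by fun_prop) ?_
    refine Filter.Eventually.of_forall fun x => ?_
    rw [gaussFn, polyFun_one, one_mul, Complex.norm_real, norm_norm]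
  have hpoly : ∀ Q : MvPolynomial (Fin k) ℂ, ∫ x, polyFun Q x * (e x * u x) = 0 := fun Q => by
    rw [← hu (polyConj Q), inner_gaussLp]
    refine integral_congr_ae (Filter.Eventually.of_forall fun x => ?_)
    simp only [gaussFn, polyFun_polyConj, map_mul, Complex.conj_conj, Complex.conj_ofReal, he]
    ring
  have hint : Integrable fun x => e x * u x := by
    have := (hemem μ hμ).norm.integrable_mul (Lp.memLp u).norm
    refine this.mono (hec.aestronglyMeasurable.mul (Lp.aestronglyMeasurable u))
      (Filter.Eventually.of_forall fun x => ?_)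
    simp only [he, Pi.mul_apply, norm_mul, Complex.norm_real, norm_norm]
    exact le_rfl
  have hzero : ∀ᵐ x, e x * u x = 0 := by
    refine ae_eq_zero_of_fourier_eq_zero hint fun w => ?_
    rw [Real.fourier_eq]
    set Λ : MvPolynomial (Fin k) ℂ :=
      ∑ i, MvPolynomial.C (-(2 * Real.pi * Complex.I) * (w i : ℂ)) * MvPolynomial.X i with hΛ
    have hΛf : ∀ x, polyFun Λ x = -(2 * Real.pi * Complex.I) * (⟪x, w⟫_ℝ : ℝ) := fun x => by
      rw [hΛ, polyFun_sum, PiLp.inner_apply]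
      simp only [polyFun_mul, polyFun_C, polyFun_X, RCLike.inner_apply, conj_trivial]
      push_cast
      rw [Finset.mul_sum]
      exact Finset.sum_congr rfl fun i _ => by ring
    set K : ℝ := 2 * Real.pi * ‖w‖ with hK
    have hK0 : 0 ≤ K := by positivity
    have hΛn : ∀ x, ‖polyFun Λ x‖ ≤ K * ‖x‖ := fun x => by
      rw [hΛf, norm_mul, norm_neg, norm_mul, norm_mul, Complex.norm_I, Complex.norm_real,
        Complex.norm_real, Complex.norm_ofNat, Real.norm_of_nonneg Real.pi_pos.le, mul_one, hK,
        mul_assoc (2 * Real.pi), mul_comm ‖w‖]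
      exact mul_le_mul_of_nonneg_left (norm_inner_le_norm x w) (by positivity)
    -- Expand `e^{-2πi⟨x,w⟩}` into powers of the linear polynomial `Λ`. Every term integrates to
    -- zero by hypothesis, so the Fourier transform of `e·u` vanishes at `w`.
    have hsum := hasSum_integral_of_dominated_convergence (μ := volume)
      (F := fun (j : ℕ) x => polyFun (Λ ^ j) x / j.factorial * (e x * u x))
      (f := fun x => Real.fourierChar (-⟪x, w⟫_ℝ) • (e x * u x))
      (fun j x => (K * ‖x‖) ^ j / j.factorial * ‖e x * u x‖) (fun j => ?_) (fun j => ?_) ?_ ?_ ?_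
    · have hz : ∀ j : ℕ, ∫ x, polyFun (Λ ^ j) x / j.factorial * (e x * u x) = 0 := fun j => by
        have : ∀ x, polyFun (Λ ^ j) x / j.factorial * (e x * u x) =
            (j.factorial : ℂ)⁻¹ * (polyFun (Λ ^ j) x * (e x * u x)) := fun x => by ring
        simp only [this]
        rw [integral_const_mul, hpoly, mul_zero]
      simp only [hz] at hsum
      exact hsum.unique hasSum_zero
    · exact (((polyFun_continuous _).div_const _).aestronglyMeasurable).mul hint.1
    · refine Filter.Eventually.of_forall fun x => ?_
      rw [norm_mul, norm_div, Complex.norm_natCast, polyFun_pow, norm_pow]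
      exact mul_le_mul_of_nonneg_right (div_le_div_of_nonneg_right
        (pow_le_pow_left₀ (norm_nonneg _) (hΛn x) j) (by positivity)) (norm_nonneg _)
    · exact Filter.Eventually.of_forall fun x => (Real.summable_pow_div_factorial _).mul_right _
    · have hs : ∀ x, ∑' j : ℕ, (K * ‖x‖) ^ j / j.factorial * ‖e x * u x‖ =
          Real.exp (K * ‖x‖) * ‖e x * u x‖ := fun x => by
        rw [tsum_mul_right, Real.exp_eq_exp_ℝ, NormedSpace.exp_eq_tsum_div]
      simp only [hs]
      -- Half of the Gaussian exponent pays for the exponential: `K|x| ≤ μ|x|²/4 + K²/μ` by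
      -- completing the square.
      have hb := ((hemem (μ / 2) (by positivity)).norm.integrable_mul (Lp.memLp u).norm).const_mul
        (Real.exp (K ^ 2 / μ))
      refine hb.mono ((by fun_prop : Continuous fun x : EuclideanSpace ℝ (Fin k) =>
        Real.exp (K * ‖x‖)).aestronglyMeasurable.mul hint.1.norm)
        (Filter.Eventually.of_forall fun x => ?_)
      simp only [he, Pi.mul_apply, norm_mul, Complex.norm_real, norm_norm,
        Real.norm_of_nonneg (Real.exp_nonneg _)]
      rw [← mul_assoc, ← mul_assoc, ← Real.exp_add, ← Real.exp_add]
      refine mul_le_mul_of_nonneg_right (Real.exp_le_exp.2 ?_) (norm_nonneg _)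
      have : K ^ 2 / μ + -(‖x‖ ^ 2 * (μ / 2) / 2) - (K * ‖x‖ + -(‖x‖ ^ 2 * μ / 2)) =
          (μ * ‖x‖ / 2 - K) ^ 2 / μ := by
        field_simp
        ring
      have h2 : 0 ≤ (μ * ‖x‖ / 2 - K) ^ 2 / μ := by positivity
      linarith
    · refine Filter.Eventually.of_forall fun x => ?_
      have h1 : HasSum (fun j : ℕ => polyFun (Λ ^ j) x / j.factorial)
          (Complex.exp (polyFun Λ x)) := by
        simp only [polyFun_pow]
        rw [Complex.exp_eq_exp_ℂ]
        exact NormedSpace.expSeries_div_hasSum_exp _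
      have h2 : (Real.fourierChar (-⟪x, w⟫_ℝ) : ℂ) = Complex.exp (polyFun Λ x) := by
        rw [Real.fourierChar_apply, hΛf]
        congr 1
        push_cast
        ring
      rw [Circle.smul_def, h2, smul_eq_mul]
      exact h1.mul_right _
  refine Lp.ext ?_
  filter_upwards [hzero, Lp.coeFn_zero ℂ 2 (volume : Measure
      (EuclideanSpace ℝ (Fin k)))] with x hx h0
  rw [h0, Pi.zero_apply]
  exact (mul_eq_zero.1 hx).resolve_left (by simp [he])

/-- The eigenfunctions span all products of polynomials with the Gaussian. -/
lemma gaussLp_mem_span (hk : 0 < k) (h : IsSkewComplex L μ) (Q : MvPolynomial (Fin k) ℂ) :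
    gaussLp h.pos Q ∈ Submodule.span ℂ {u | ∃ (r n : ℕ) (m : ℤ), ∃ P ∈ harmonicSpace L μ n m,
      u = laguerreLp h.pos r n P} := by
  have hμ : (μ : ℂ) ≠ 0 := by simpa using h.pos.ne'
  have key : ∀ (n : ℕ) (m : ℤ), ∀ P ∈ harmonicSpace L μ n m, ∀ U : Polynomial ℂ,
      gaussLp h.pos (radialPoly μ U P) ∈ Submodule.span ℂ {u | ∃ (r n : ℕ) (m : ℤ),
        ∃ P ∈ harmonicSpace L μ n m, u = laguerreLp h.pos r n P} := by
    intro n m P hP U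
    -- One Laguerre polynomial in each degree, hence a basis of `ℂ[t]` for each fixed `n`.
    let S : Polynomial.Sequence ℂ :=
      ⟨fun r => laguerre r ((k : ℝ) / 2 + n - 1), fun r => laguerre_degree r _⟩
    have hU : U ∈ Submodule.span ℂ (range S) := by
      rw [S.span fun i => (Polynomial.leadingCoeff_ne_zero.2 (S.ne_zero i)).isUnit]
      trivial
    induction hU using Submodule.span_induction with
    | mem z hz =>
      obtain ⟨r, rfl⟩ := hz
      exact Submodule.subset_span ⟨r, n, m, P, hP, rfl⟩
    | zero => simp [radialPoly]
    | add a b _ _ ha hb =>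
      rw [radialPoly, map_add, add_mul, map_add]
      exact Submodule.add_mem _ ha hb
    | smul c a _ ha =>
      rw [radialPoly, map_smul, smul_mul_assoc, map_smul]
      exact Submodule.smul_mem _ _ ha
  have hQ := Submodule.mem_map_of_mem (f := gaussLp h.pos) (mem_span_normSqPoly_mul_harmonic hk h Q)
  rw [Submodule.map_span] at hQ
  refine Submodule.span_le.2 ?_ hQ
  rintro _ ⟨_, ⟨j, n, m, -, P, hP, rfl⟩, rfl⟩
  have e : normSqPoly k ^ j * P = ((μ : ℂ) ^ j)⁻¹ • radialPoly μ (Polynomial.X ^ j) P := by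
    rw [radialPoly, map_pow, Polynomial.aeval_X, smul_pow, smul_mul_assoc, smul_smul,
      inv_mul_cancel₀ (pow_ne_zero _ hμ), one_smul]
  rw [e, map_smul]
  exact Submodule.smul_mem _ _ (key n m P hP _)

lemma eq_zero_of_inner_laguerreLp_eq_zero (hk : 0 < k) (h : IsSkewComplex L μ)
    {u : Lp ℂ 2 (volume : Measure (EuclideanSpace ℝ (Fin k)))}
    (hu : ∀ (r n : ℕ) (m : ℤ), ∀ P ∈ harmonicSpace L μ n m, ⟪laguerreLp h.pos r n P, u⟫_ℂ = 0) :
    u = 0 := by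
  refine eq_zero_of_inner_gaussLp_eq_zero h.pos fun Q => ?_
  have hQ := gaussLp_mem_span hk h Q
  generalize gaussLp h.pos Q = w at hQ ⊢
  induction hQ using Submodule.span_induction with
  | mem z hz =>
    obtain ⟨r, n, m, P, hP, rfl⟩ := hz
    exact hu r n m P hP
  | zero => exact inner_zero_left _
  | add a b _ _ ha hb => rw [inner_add_left, ha, hb, add_zero]
  | smul c a _ ha => rw [inner_smul_left, ha, mul_zero]

/-! ### Eigenspaces, resolvent and spectrum -/

/-- The eigenfunctions with a given eigenvalue. -/
def laguerreSet (L : EuclideanSpace ℝ (Fin k) →ₗ[ℝ] EuclideanSpace ℝ (Fin k)) (μ : ℝ) (lam : ℂ) :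
    Set (Lp ℂ 2 (volume : Measure (EuclideanSpace ℝ (Fin k)))) :=
  {u | ∃ (r n : ℕ) (m : ℤ), lam = nu k μ r n m ∧ ∃ P ∈ harmonicSpace L μ n m,
    u =ᵐ[volume] laguerreFn μ r n P}

lemma topologicalClosure_span_laguerreFn (hk : 0 < k) (h : IsSkewComplex L μ) :
    (Submodule.span ℂ {u : Lp ℂ 2 (volume : Measure (EuclideanSpace ℝ (Fin k))) |
      ∃ (r n : ℕ) (m : ℤ), ∃ P ∈ harmonicSpace L μ n m,
        u =ᵐ[volume] laguerreFn μ r n P}).topologicalClosure = ⊤ := by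
  rw [Submodule.topologicalClosure_eq_top_iff, Submodule.eq_bot_iff]
  intro u hu
  refine eq_zero_of_inner_laguerreLp_eq_zero hk h fun r n m P hP => ?_
  exact (Submodule.mem_orthogonal _ _).1 hu _
    (Submodule.subset_span ⟨r, n, m, P, hP, coeFn_laguerreLp h.pos r n P⟩)

lemma mem_l2Eigenspace {lam : ℂ} {u : Lp ℂ 2 (volume : Measure (EuclideanSpace ℝ (Fin k)))} :
    u ∈ l2Eigenspace L μ lam ↔ (u, lam • u) ∈ l2Graph L μ := Iff.rfl

lemma isClosed_l2Eigenspace (lam : ℂ) : IsClosed (l2Eigenspace L μ lam : Set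
    (Lp ℂ 2 (volume : Measure (EuclideanSpace ℝ (Fin k))))) :=
  isClosed_l2Graph.preimage (by fun_prop : Continuous
    fun u : Lp ℂ 2 (volume : Measure (EuclideanSpace ℝ (Fin k))) => (u, lam • u))

lemma span_laguerreSet_le (h : IsSkewComplex L μ) (lam : ℂ) :
    Submodule.span ℂ (laguerreSet L μ lam) ≤ l2Eigenspace L μ lam := by
  refine Submodule.span_le.2 ?_
  rintro u ⟨r, n, m, rfl, P, hP, hu⟩
  rw [eq_laguerreLp_iff h.pos] at hu
  subst hu
  exact laguerreLp_mem_l2Graph h r hP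

lemma inner_laguerreLp_of_mem_l2Eigenspace (h : IsSkewComplex L μ) {lam : ℂ}
    {u : Lp ℂ 2 (volume : Measure (EuclideanSpace ℝ (Fin k)))} (hu : u ∈ l2Eigenspace L μ lam)
    {r n : ℕ} {m : ℤ} {P : MvPolynomial (Fin k) ℂ} (hP : P ∈ harmonicSpace L μ n m)
    (hne : lam ≠ nu k μ r n m) : ⟪laguerreLp h.pos r n P, u⟫_ℂ = 0 := by
  have h1 := inner_laguerreLp_of_mem_l2Graph h (mem_l2Eigenspace.1 hu) r hP
  rw [inner_smul_right, ← sub_eq_zero, ← sub_mul, mul_eq_zero] at h1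
  exact h1.resolve_left (sub_ne_zero.2 hne)

/-- Subtract from an eigenvector its projection onto the closed span. The rest is still an
eigenvector. It is orthogonal to the Laguerre functions with this eigenvalue by construction and to
the others because the eigenvalues differ, so it vanishes by completeness. -/
lemma l2Eigenspace_eq (hk : 0 < k) (h : IsSkewComplex L μ) (lam : ℂ) :
    l2Eigenspace L μ lam = (Submodule.span ℂ (laguerreSet L μ lam)).topologicalClosure := by
  have hle := Submodule.topologicalClosure_minimal _ (span_laguerreSet_le h lam)
    (isClosed_l2Eigenspace lam)
  refine le_antisymm (fun u hu => ?_) hle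
  set W := (Submodule.span ℂ (laguerreSet L μ lam)).topologicalClosure with hW
  have : CompleteSpace W := (Submodule.isClosed_topologicalClosure _).completeSpace_coe
  have hd : u - W.starProjection u ∈ Wᗮ := Submodule.sub_starProjection_mem_orthogonal u
  have hd2 : u - W.starProjection u ∈ l2Eigenspace L μ lam :=
    Submodule.sub_mem _ hu (hle (Submodule.starProjection_apply_mem W u))
  have hz : u - W.starProjection u = 0 := by
    refine eq_zero_of_inner_laguerreLp_eq_zero hk h fun r n m P hP => ?_
    by_cases hne : lam = nu k μ r n m
    · refine (Submodule.mem_orthogonal _ _).1 hd _ (Submodule.le_topologicalClosure _ ?_)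
      exact Submodule.subset_span ⟨r, n, m, hne, P, hP, coeFn_laguerreLp h.pos r n P⟩
    · exact inner_laguerreLp_of_mem_l2Eigenspace h hd2 hP hne
  rw [sub_eq_zero.1 hz]
  exact Submodule.starProjection_apply_mem W u

/-- The Landau levels, in increasing order of `s = r + p`. -/
def landauLevel (k : ℕ) (μ : ℝ) (s : ℕ) : ℝ := -((4 * s + k) * μ + 4 * μ ^ 2)

lemma landauLevel_injective (hμ : 0 < μ) : Function.Injective (landauLevel k μ) := by
  intro s t hst
  simp only [landauLevel] at hst
  have h1 : (s : ℝ) * μ = t * μ := by linarith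
  exact_mod_cast mul_right_cancel₀ hμ.ne' h1

lemma nu_neg (r n : ℕ) : nu k μ r n (-n) = landauLevel k μ r := by
  simp [nu, landauLevel]

lemma exists_nu_eq_landauLevel (h : IsSkewComplex L μ) {n : ℕ} {m : ℤ}
    (hne : harmonicSpace L μ n m ≠ ⊥) (r : ℕ) : ∃ s, nu k μ r n m = landauLevel k μ s := by
  obtain ⟨p, -, rfl⟩ := exists_weight_of_harmonicSpace_ne_bot h hne
  refine ⟨r + p, ?_⟩
  simp only [nu, landauLevel]
  push_cast
  ring

/-- The eigenspaces are mutually orthogonal. -/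
lemma inner_eq_zero_of_mem_l2Eigenspace (hk : 0 < k) (h : IsSkewComplex L μ) {lam lam' : ℂ}
    (hne : lam ≠ lam') {u v : Lp ℂ 2 (volume : Measure (EuclideanSpace ℝ (Fin k)))}
    (hu : u ∈ l2Eigenspace L μ lam) (hv : v ∈ l2Eigenspace L μ lam') : ⟪u, v⟫_ℂ = 0 := by
  rw [l2Eigenspace_eq hk h] at hu
  have hv' : v ∈ (Submodule.span ℂ (laguerreSet L μ lam)).topologicalClosureᗮ := by
    rw [Submodule.orthogonal_closure, Submodule.mem_orthogonal]
    intro w hw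
    induction hw using Submodule.span_induction with
    | mem z hz =>
      obtain ⟨r, n, m, rfl, P, hP, hz⟩ := hz
      rw [(eq_laguerreLp_iff h.pos r n P z).1 hz]
      exact inner_laguerreLp_of_mem_l2Eigenspace h hv hP hne.symm
    | zero => exact inner_zero_left _
    | add a b _ _ ha hb => rw [inner_add_left, ha, hb, add_zero]
    | smul c a _ ha => rw [inner_smul_left, ha, mul_zero]
  exact (Submodule.mem_orthogonal _ _).1 hv' u hu

lemma orthogonalFamily_l2Eigenspace (hk : 0 < k) (h : IsSkewComplex L μ) :
    OrthogonalFamily ℂ (fun s : ℕ => l2Eigenspace L μ (landauLevel k μ s))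
      fun s => (l2Eigenspace L μ (landauLevel k μ s)).subtypeₗᵢ := by
  intro s t hst u v
  refine inner_eq_zero_of_mem_l2Eigenspace hk h (fun heq => hst ?_) u.2 v.2
  exact landauLevel_injective h.pos (by exact_mod_cast heq)

lemma dense_iSup_l2Eigenspace (hk : 0 < k) (h : IsSkewComplex L μ) :
    Dense ((⨆ s : ℕ, l2Eigenspace L μ (landauLevel k μ s) : Submodule ℂ _) : Set
      (Lp ℂ 2 (volume : Measure (EuclideanSpace ℝ (Fin k))))) := by
  rw [Submodule.dense_iff_topologicalClosure_eq_top, eq_top_iff,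
    ← topologicalClosure_span_laguerreFn hk h]
  refine Submodule.topologicalClosure_mono (Submodule.span_le.2 ?_)
  rintro u ⟨r, n, m, P, hP, hu⟩
  rw [eq_laguerreLp_iff h.pos] at hu
  subst hu
  by_cases hP0 : P = 0
  · have : laguerreLp h.pos r n P = 0 := by simp [laguerreLp, radialPoly, hP0]
    rw [this]
    exact Submodule.zero_mem _
  · obtain ⟨s, hs⟩ := exists_nu_eq_landauLevel h ((Submodule.ne_bot_iff _).2 ⟨P, hP, hP0⟩) r
    refine Submodule.mem_iSup_of_mem s ?_
    rw [← hs]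
    exact laguerreLp_mem_l2Graph h r hP

/-- The levels go to `-∞`, so all but finitely many are at distance at least `1` from `lam`. No
exclusion of levels is needed, since the inverse of zero is zero. -/
lemma exists_bound_inv (hμ : 0 < μ) (lam : ℂ) :
    ∃ C : ℝ, 0 ≤ C ∧ ∀ s, ‖((landauLevel k μ s : ℂ) - lam)⁻¹‖ ≤ C := by
  obtain ⟨N, hN⟩ := exists_nat_ge ((‖lam‖ + 1) / (4 * μ))
  refine ⟨1 + ∑ s ∈ Finset.range N, ‖((landauLevel k μ s : ℂ) - lam)⁻¹‖, by positivity, fun s => ?_⟩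
  rcases lt_or_ge s N with hs | hs
  · have := Finset.single_le_sum (f := fun s => ‖((landauLevel k μ s : ℂ) - lam)⁻¹‖)
      (fun i _ => norm_nonneg _) (Finset.mem_range.2 hs)
    linarith
  · have h1 : ‖lam‖ + 1 ≤ 4 * μ * s := by
      rw [div_le_iff₀ (by positivity)] at hN
      have : (N : ℝ) ≤ s := by exact_mod_cast hs
      nlinarith
    have h2 : 4 * μ * s ≤ ‖(landauLevel k μ s : ℂ)‖ := by
      rw [Complex.norm_real, landauLevel, norm_neg, Real.norm_of_nonneg (by positivity)]
      have : (0 : ℝ) ≤ k * μ + 4 * μ ^ 2 := by positivity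
      linarith
    have h3 : 1 ≤ ‖(landauLevel k μ s : ℂ) - lam‖ := by
      have := norm_sub_norm_le (landauLevel k μ s : ℂ) lam
      linarith
    rw [norm_inv]
    have h4 := inv_le_one_of_one_le₀ h3
    have h5 : 0 ≤ ∑ s ∈ Finset.range N, ‖((landauLevel k μ s : ℂ) - lam)⁻¹‖ :=
      Finset.sum_nonneg fun _ _ => norm_nonneg _
    linarith

lemma eq_zero_of_mem_l2Eigenspace (hk : 0 < k) (h : IsSkewComplex L μ) {lam : ℂ}
    (hlam : ∀ s, lam ≠ landauLevel k μ s)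
    {u : Lp ℂ 2 (volume : Measure (EuclideanSpace ℝ (Fin k)))} (hu : u ∈ l2Eigenspace L μ lam) :
    u = 0 := by
  refine eq_zero_of_inner_laguerreLp_eq_zero hk h fun r n m P hP => ?_
  by_cases hP0 : P = 0
  · have : laguerreLp h.pos r n P = 0 := by simp [laguerreLp, radialPoly, hP0]
    rw [this, inner_zero_left]
  · obtain ⟨s, hs⟩ := exists_nu_eq_landauLevel h ((Submodule.ne_bot_iff _).2 ⟨P, hP, hP0⟩) r
    exact inner_laguerreLp_of_mem_l2Eigenspace h hu hP (hs ▸ hlam s)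

/-- The resolvent equation is solvable, with a bound, on a dense subspace. -/
lemma exists_resolvent_bound (hk : 0 < k) (h : IsSkewComplex L μ) {lam : ℂ}
    (hlam : ∀ s, lam ≠ landauLevel k μ s) {C : ℝ} (hC : 0 ≤ C)
    (hb : ∀ s, ‖((landauLevel k μ s : ℂ) - lam)⁻¹‖ ≤ C)
    {w : Lp ℂ 2 (volume : Measure (EuclideanSpace ℝ (Fin k)))}
    (hw : w ∈ ⨆ s : ℕ, l2Eigenspace L μ (landauLevel k μ s)) :
    ∃ u, (u, w + lam • u) ∈ l2Graph L μ ∧ ‖u‖ ≤ C * ‖w‖ := by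
  obtain ⟨f, hf, rfl⟩ := (Submodule.mem_iSup_iff_exists_finsupp _ _).1 hw
  have hV := orthogonalFamily_l2Eigenspace hk h
  -- The resolvent acts diagonally on the orthogonal eigenspaces, so its norm is bounded by the
  -- largest multiplier.
  let c : ℕ → ℂ := fun s => ((landauLevel k μ s : ℂ) - lam)⁻¹
  have hc : ∀ s, c s * ((landauLevel k μ s : ℂ) - lam) = 1 := fun s =>
    inv_mul_cancel₀ (sub_ne_zero.2 (hlam s).symm)
  refine ⟨∑ s ∈ f.support, c s • f s, ?_, ?_⟩
  · have e : (∑ s ∈ f.support, c s • f s, (f.sum fun _ x => x) + lam • ∑ s ∈ f.support, c s • f s) =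
        ∑ s ∈ f.support, c s • (f s, (landauLevel k μ s : ℂ) • f s) := by
      refine Prod.ext ?_ ?_
      · rw [Prod.fst_sum]
        rfl
      · rw [Prod.snd_sum, Finsupp.sum, Finset.smul_sum, ← Finset.sum_add_distrib]
        refine Finset.sum_congr rfl fun s _ => ?_
        change f s + lam • c s • f s = c s • (landauLevel k μ s : ℂ) • f s
        rw [smul_smul, smul_smul]
        nth_rewrite 1 [← one_smul ℂ (f s)]
        rw [← add_smul, ← hc s]
        congr 1
        ring
    rw [e]
    exact Submodule.sum_mem _ fun s _ => Submodule.smul_mem _ _ (mem_l2Eigenspace.1 (hf s))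
  · have n1 := hV.norm_sum (fun s => c s • ⟨f s, hf s⟩) f.support
    have n2 := hV.norm_sum (fun s => ⟨f s, hf s⟩) f.support
    simp only [map_smul, Submodule.coe_subtypeₗᵢ, Submodule.subtype_apply, norm_smul] at n1 n2
    refine le_of_sq_le_sq ?_ (by positivity)
    rw [Finsupp.sum, mul_pow, n1, n2, Finset.mul_sum]
    refine Finset.sum_le_sum fun s _ => ?_
    rw [mul_pow]
    exact mul_le_mul_of_nonneg_right (pow_le_pow_left₀ (norm_nonneg _) (hb s) 2) (by positivity)

/-- As `lam` is not an eigenvalue, solutions of the resolvent equation are unique. This makes the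
bounded solution on the dense sum of eigenspaces linear; it extends by continuity, and closedness of
the graph keeps the equation valid for the extension. -/
lemma exists_resolvent (hk : 0 < k) (h : IsSkewComplex L μ) {lam : ℂ}
    (hlam : ∀ s, lam ≠ landauLevel k μ s) :
    ∃ S : Lp ℂ 2 (volume : Measure (EuclideanSpace ℝ (Fin k))) →L[ℂ]
      Lp ℂ 2 (volume : Measure (EuclideanSpace ℝ (Fin k))),
    ∀ u w, (u, w + lam • u) ∈ l2Graph L μ ↔ u = S w := by
  obtain ⟨C, hC, hb⟩ := exists_bound_inv (k := k) h.pos lam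
  set D : Submodule ℂ (Lp ℂ 2 (volume : Measure (EuclideanSpace ℝ (Fin k)))) :=
    ⨆ s : ℕ, l2Eigenspace L μ (landauLevel k μ s) with hD
  have huniq : ∀ u u' w, (u, w + lam • u) ∈ l2Graph L μ → (u', w + lam • u') ∈ l2Graph L μ →
      u = u' := by
    intro u u' w h1 h2
    refine sub_eq_zero.1 (eq_zero_of_mem_l2Eigenspace hk h hlam (mem_l2Eigenspace.2 ?_))
    have := Submodule.sub_mem _ h1 h2
    rwa [Prod.mk_sub_mk, add_sub_add_left_eq_sub, ← smul_sub] at this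
  choose s0 hs0 hs0b using fun w : D => exists_resolvent_bound hk h hlam hC hb w.2
  let S0 : D →ₗ[ℂ] Lp ℂ 2 (volume : Measure (EuclideanSpace ℝ (Fin k))) :=
    { toFun := s0
      map_add' := fun w w' => by
        refine huniq _ _ _ (hs0 (w + w')) ?_
        have := Submodule.add_mem _ (hs0 w) (hs0 w')
        rw [Prod.mk_add_mk] at this
        convert this using 2
        rw [Submodule.coe_add, smul_add]
        abel
      map_smul' := fun a w => by
        refine huniq _ _ _ (hs0 (a • w)) ?_
        have := Submodule.smul_mem _ a (hs0 w)
        rw [Prod.smul_mk] at this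
        rw [RingHom.id_apply]
        convert this using 2
        rw [Submodule.coe_smul, smul_add, smul_comm] }
  have hdense : DenseRange D.subtype := by
    rw [DenseRange, Submodule.coe_subtype, Subtype.range_coe]
    exact dense_iSup_l2Eigenspace hk h
  let S := S0.extendOfNorm D.subtype
  have hS : ∀ w : D, S w = s0 w := fun w =>
    LinearMap.extendOfNorm_eq hdense ⟨C, hs0b⟩ w
  have hmem : ∀ w, (S w, w + lam • S w) ∈ l2Graph L μ := by
    have hcl : IsClosed {w | (S w, w + lam • S w) ∈ l2Graph L μ} :=
      isClosed_l2Graph.preimage (by fun_prop : Continuous fun w => (S w, w + lam • S w))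
    refine isClosed_property hdense hcl fun w => ?_
    change (S w, (w : Lp ℂ 2 (volume : Measure (EuclideanSpace ℝ (Fin k)))) + lam • S w) ∈ _
    rw [hS]
    exact hs0 w
  exact ⟨S, fun u w => ⟨fun hu => huniq _ _ _ hu (hmem w), fun hu => hu ▸ hmem w⟩⟩

lemma radialPoly_ne_zero {μ : ℝ} {u : Polynomial ℂ} (hu : u.coeff 0 ≠ 0)
    {P : MvPolynomial (Fin k) ℂ} (hP : P ≠ 0) : radialPoly μ u P ≠ 0 := by
  refine mul_ne_zero (fun h0 => hu ?_) hP
  have h1 := congrArg (fun Q => polyFun Q (0 : EuclideanSpace ℝ (Fin k))) h0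
  rw [polyFun_aeval, polyFun_smul, polyFun_normSqPoly] at h1
  rw [Polynomial.coeff_zero_eq_eval_zero]
  simpa [polyFun] using h1

lemma laguerre_radialPoly_ne_zero (hk : 0 < k) (μ : ℝ) (r n : ℕ) {P : MvPolynomial (Fin k) ℂ}
    (hP : P ≠ 0) : radialPoly μ (laguerre r ((k : ℝ) / 2 + n - 1)) P ≠ 0 := by
  refine radialPoly_ne_zero (laguerre_coeff_zero_ne r ?_) hP
  have : (0 : ℝ) < k := by exact_mod_cast hk
  have : (0 : ℝ) ≤ n := Nat.cast_nonneg n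
  linarith

/-- Every level `s` is attained with `n = 0`, `m = 0`, `r = s`, so a number outside the list avoids
all levels and has a resolvent. Conversely a non-zero eigenvector would have to equal `S 0 = 0`. -/
lemma l2Spectrum_eq (hk : 0 < k) (h : IsSkewComplex L μ) : l2Spectrum L μ =
    {lam : ℂ | ∃ (r n : ℕ) (m : ℤ), harmonicSpace L μ n m ≠ ⊥ ∧ lam = nu k μ r n m} := by
  ext lam
  constructor
  · intro hlam
    by_contra hcon
    refine hlam (exists_resolvent hk h fun s hs => hcon ?_)
    obtain ⟨P, hP, hP0⟩ := exists_mem_harmonicSpace_neg hk h 0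
    exact ⟨s, 0, _, (Submodule.ne_bot_iff _).2 ⟨P, hP, hP0⟩, by rw [nu_neg, hs]⟩
  · rintro ⟨r, n, m, hne, rfl⟩ ⟨S, hS⟩
    obtain ⟨P, hP, hP0⟩ := Submodule.exists_mem_ne_zero_of_ne_bot hne
    have h1 := (hS (laguerreLp h.pos r n P) 0).1 (by
      rw [zero_add]
      exact laguerreLp_mem_l2Graph h r hP)
    rw [map_zero] at h1
    refine laguerre_radialPoly_ne_zero hk μ r n hP0 (gaussLp_injective h.pos ?_)
    rw [map_zero]
    exact h1

lemma polyD_radialPoly (h : IsSkewComplex L μ) (u : Polynomial ℂ) (P : MvPolynomial (Fin k) ℂ) :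
    polyD L (radialPoly μ u P) = radialPoly μ u (polyD L P) := by
  have h1 : ∀ j : ℕ, polyD L (((μ : ℂ) • normSqPoly k) ^ j) = 0 := fun j => by
    induction j with
    | zero => simpa using polyD_C (L := L) 1
    | succ j ih => rw [pow_succ, polyD_mul, ih, map_smul, polyD_normSqPoly h]; simp
  have h2 : polyD L (Polynomial.aeval ((μ : ℂ) • normSqPoly k) u) = 0 := by
    induction u using Polynomial.induction_on' with
    | add p q hp hq => rw [map_add, map_add, hp, hq, add_zero]
    | monomial j a =>
      rw [Polynomial.aeval_monomial, polyD_mul, h1, MvPolynomial.algebraMap_eq, polyD_C]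
      simp
  rw [radialPoly, polyD_mul, h2, radialPoly]
  ring

/-- Take `r = s` and non-zero elements of `H^{(n,-n)}` for all `n`. They share the level `s`, and
their polynomial factors are eigenvectors of `D` with distinct eigenvalues, hence independent. -/
lemma not_finiteDimensional_l2Eigenspace (hk : 0 < k) (h : IsSkewComplex L μ) (s : ℕ) :
    ¬ FiniteDimensional ℂ (l2Eigenspace L μ (landauLevel k μ s)) := by
  intro hfin
  choose P hP hP0 using exists_mem_harmonicSpace_neg hk h
  let Q : ℕ → MvPolynomial (Fin k) ℂ := fun n =>
    radialPoly μ (laguerre s ((k : ℝ) / 2 + n - 1)) (P n)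
  have hQ : LinearIndependent ℂ Q := by
    refine Module.End.eigenvectors_linearIndependent' (polyD L : Module.End ℂ _)
      (fun n : ℕ => Complex.I * ((-n : ℤ) : ℂ) * μ) (fun a b hab => ?_) Q fun n => ⟨?_, ?_⟩
    · have := weight_injective h.pos hab
      exact_mod_cast neg_injective this
    · rw [Module.End.mem_eigenspace_iff, polyD_radialPoly h, (mem_harmonicSpace.1 (hP n)).2.2]
      rw [radialPoly, mul_smul_comm]
      rfl
    · exact laguerre_radialPoly_ne_zero hk μ s n (hP0 n)
  have hG : LinearIndependent ℂ (gaussLp h.pos ∘ Q) :=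
    hQ.map' _ (LinearMap.ker_eq_bot.2 (gaussLp_injective h.pos))
  let w : ℕ → l2Eigenspace L μ (landauLevel k μ s) := fun n =>
    ⟨gaussLp h.pos (Q n), by
      have := laguerreLp_mem_l2Graph h s (hP n)
      rwa [nu_neg] at this⟩
  have hw : LinearIndependent ℂ w :=
    LinearIndependent.of_comp (l2Eigenspace L μ (landauLevel k μ s)).subtype hG
  exact not_finite_iff_infinite.2 inferInstance hw.finite_of_isNoetherian

/-! ### The Laplacian on the Heisenberg-type group -/

lemma iteratedDeriv_two_mul_exp {g : ℝ → ℂ} (hg : ContDiffAt ℝ 2 g 0) (b c : ℂ) :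
    iteratedDeriv 2 (fun t : ℝ => g t * Complex.exp (c + t * b)) 0 =
      (iteratedDeriv 2 g 0 + 2 * b * deriv g 0 + b ^ 2 * g 0) * Complex.exp c := by
  have hE : ∀ t : ℝ, HasDerivAt (fun t : ℝ => Complex.exp (c + t * b))
      (b * Complex.exp (c + t * b)) t := fun t => by
    have h1 : HasDerivAt (fun t : ℝ => c + (t : ℂ) * b) b t := by
      simpa using ((Complex.ofRealCLM.hasDerivAt (x := t)).mul_const b).const_add c
    simpa [mul_comm] using h1.cexp
  have h1 : ∀ᶠ t in 𝓝 (0 : ℝ), HasDerivAt g (deriv g t) t := by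
    filter_upwards [hg.eventually (by simp)] with t ht
    exact (ht.differentiableAt (by norm_num)).hasDerivAt
  have h2 : deriv (fun t : ℝ => g t * Complex.exp (c + t * b)) =ᶠ[𝓝 0]
      fun t => deriv g t * Complex.exp (c + t * b) + g t * (b * Complex.exp (c + t * b)) := by
    filter_upwards [h1] with t ht
    exact (ht.mul (hE t)).deriv
  have h3 := hasDerivAt_deriv_of_contDiffAt hg
  rw [iteratedDeriv_succ, iteratedDeriv_one, h2.deriv_eq]
  refine ((h3.mul (hE 0)).add (h1.self_of_nhds.mul ((hE 0).const_mul b))).deriv.trans ?_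
  simp only [Complex.ofReal_zero, zero_mul, add_zero]
  ring

lemma HTypeData.inner_bracket (N : HTypeData k l) (γ : EuclideanSpace ℝ (Fin l))
    (x y : EuclideanSpace ℝ (Fin k)) : ⟪γ, N.bracket x y⟫_ℝ = ⟪N.J γ x, y⟫_ℝ := by
  have hγ : γ = ∑ α, γ α • EuclideanSpace.single α (1 : ℝ) := by
    simpa using ((EuclideanSpace.basisFun (Fin l) ℝ).sum_repr γ).symm
  conv_rhs => rw [hγ]
  simp only [map_sum, map_smul, LinearMap.sum_apply, LinearMap.smul_apply, sum_inner,
    real_inner_smul_left]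
  rw [PiLp.inner_apply]
  refine Finset.sum_congr rfl fun α _ => ?_
  rw [HTypeData.bracket, PiLp.toLp_apply, RCLike.inner_apply, conj_trivial, mul_comm]

lemma HTypeData.isSkewComplex (N : HTypeData k l) {γ : EuclideanSpace ℝ (Fin l)} (hγ : γ ≠ 0) :
    IsSkewComplex (N.Jmu γ) (muOf γ) where
  pos := mul_pos Real.pi_pos (norm_pos_iff.2 hγ)
  skew x y := by
    simp only [HTypeData.Jmu, LinearMap.smul_apply, real_inner_smul_left, real_inner_smul_right,
      N.skew]
    ring
  sq x := by
    simp only [HTypeData.Jmu, LinearMap.smul_apply, map_smul, N.clifford, muOf, smul_smul]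
    congr 1
    ring

/-- Elements of the centre act by translating `Z`, which multiplies the function by `e^{2πij} = 1`.
-/
lemma waveFn_mul_left (N : HTypeData k l) {γ v : EuclideanSpace ℝ (Fin l)}
    (hv : ∃ j : ℤ, ⟪γ, v⟫_ℝ = j) (ψ : EuclideanSpace ℝ (Fin k) → ℂ)
    (p : EuclideanSpace ℝ (Fin k) × EuclideanSpace ℝ (Fin l)) :
    waveFn γ ψ (N.mul (0, v) p) = waveFn γ ψ p := by
  obtain ⟨j, hj⟩ := hv
  have h0 : ⟪γ, N.bracket 0 p.1⟫_ℝ = 0 := by rw [N.inner_bracket]; simp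
  simp only [waveFn, HTypeData.mul, zero_add, inner_add_right, real_inner_smul_right, h0, hj]
  congr 1
  rw [Complex.exp_eq_exp_iff_exists_int]
  refine ⟨j, ?_⟩
  push_cast
  ring

/-- Along `e_i` the half bracket in the group law contributes the phase `e^{it(L x)_i}`, since
`2π·½⟨J_γ x, e_i⟩ = (L x)_i`. The cross terms sum to `2iD`, the squared phases to `-|L x|² =
-μ²|x|²`, and the Z-directions give `-4π²|γ|² = -4μ²`. -/
lemma laplacian_waveFn (N : HTypeData k l) {γ : EuclideanSpace ℝ (Fin l)} (hγ : γ ≠ 0)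
    {ψ : EuclideanSpace ℝ (Fin k) → ℂ} {x : EuclideanSpace ℝ (Fin k)}
    (z : EuclideanSpace ℝ (Fin l)) (hψ : ContDiffAt ℝ 2 ψ x) :
    N.laplacian (waveFn γ ψ) (x, z) = waveFn γ (glz (N.Jmu γ) (muOf γ) ψ) (x, z) := by
  set c : ℂ := 2 * Real.pi * Complex.I * (⟪γ, z⟫_ℝ : ℝ) with hc
  set L := N.Jmu γ with hL
  have hX : ∀ i : Fin k, iteratedDeriv 2 (fun t : ℝ =>
      waveFn γ ψ (N.mul (x, z) (t • EuclideanSpace.single i 1, 0))) 0 =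
      (fderiv ℝ (fun y => fderiv ℝ ψ y (basisVec i)) x (basisVec i) +
        2 * Complex.I * (L x i * fderiv ℝ ψ x (basisVec i)) - (L x i : ℂ) ^ 2 * ψ x) *
        Complex.exp c := by
    intro i
    have hline : ∀ t : ℝ, HasDerivAt (fun t : ℝ => x + t • (basisVec i : EuclideanSpace ℝ (Fin k)))
        (basisVec i) t := fun t => by
      simpa using ((hasDerivAt_id t).smul_const (basisVec i)).const_add x
    have hg : ContDiffAt ℝ 2 (fun t : ℝ => ψ (x + t • (basisVec i :
        EuclideanSpace ℝ (Fin k)))) 0 := by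
      refine ContDiffAt.comp (0 : ℝ) (by simpa using hψ) ?_
      fun_prop
    have h1 : deriv (fun t : ℝ => ψ (x + t • (basisVec i : EuclideanSpace ℝ (Fin k)))) =ᶠ[𝓝 0]
        fun t => fderiv ℝ ψ (x + t • basisVec i) (basisVec i) := by
      have hev : ∀ᶠ t : ℝ in 𝓝 0, ContDiffAt ℝ 2 ψ (x + t • basisVec i) :=
        (hline 0).continuousAt.eventually (by simpa using hψ.eventually (by simp))
      filter_upwards [hev] with t ht
      exact ((ht.differentiableAt (by norm_num)).hasFDerivAt.comp_hasDerivAt t (hline t)).deriv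
    have h2 : iteratedDeriv 2 (fun t : ℝ => ψ (x + t • (basisVec i : EuclideanSpace ℝ (Fin k)))) 0 =
        fderiv ℝ (fun y => fderiv ℝ ψ y (basisVec i)) x (basisVec i) := by
      rw [iteratedDeriv_succ, iteratedDeriv_one, h1.deriv_eq]
      have hd : DifferentiableAt ℝ (fun y => fderiv ℝ ψ y (basisVec i)) x :=
        ((hψ.fderiv_right (m := 1) (by norm_num)).differentiableAt (by norm_num)).clm_apply
          (differentiableAt_const _)
      have hd' : HasFDerivAt (fun y => fderiv ℝ ψ y (basisVec i))
          (fderiv ℝ (fun y => fderiv ℝ ψ y (basisVec i)) x) (x + (0 : ℝ) • basisVec i) := by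
        simpa using hd.hasFDerivAt
      exact (hd'.comp_hasDerivAt (0 : ℝ) (hline 0)).deriv
    have h3 : (fun t : ℝ => waveFn γ ψ (N.mul (x, z) (t • EuclideanSpace.single i 1, 0))) =
        fun t : ℝ => ψ (x + t • basisVec i) * Complex.exp (c + t * (Complex.I * L x i)) := by
      funext t
      simp only [waveFn, HTypeData.mul, add_zero, inner_add_right, real_inner_smul_right,
        N.inner_bracket, hc, basisVec, hL, HTypeData.Jmu, LinearMap.smul_apply, PiLp.smul_apply,
        EuclideanSpace.inner_single_right, smul_eq_mul]
      congr 2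
      simp
      ring
    rw [h3, iteratedDeriv_two_mul_exp hg, h2, h1.self_of_nhds]
    simp only [zero_smul, add_zero]
    congr 1
    linear_combination (L x i : ℂ) ^ 2 * ψ x * Complex.I_sq
  have hZ : ∀ α : Fin l, iteratedDeriv 2 (fun t : ℝ =>
      waveFn γ ψ (N.mul (x, z) (0, t • EuclideanSpace.single α 1))) 0 =
      -4 * Real.pi ^ 2 * (γ α : ℂ) ^ 2 * ψ x * Complex.exp c := by
    intro α
    have h0 : ⟪γ, N.bracket x 0⟫_ℝ = 0 := by rw [N.inner_bracket]; simp
    have h3 : (fun t : ℝ => waveFn γ ψ (N.mul (x, z) (0, t • EuclideanSpace.single α 1))) =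
        fun t : ℝ => ψ x * Complex.exp (c + t * (2 * Real.pi * Complex.I * γ α)) := by
      funext t
      simp only [waveFn, HTypeData.mul, add_zero, inner_add_right, real_inner_smul_right, h0, hc,
        EuclideanSpace.inner_single_right]
      congr 2
      simp
      ring
    rw [h3, iteratedDeriv_two_mul_exp (g := fun _ => ψ x) contDiffAt_const]
    simp only [deriv_const, iteratedDeriv_const]
    simp only [OfNat.ofNat_ne_zero, if_false]
    linear_combination 4 * (Real.pi : ℂ) ^ 2 * (γ α : ℂ) ^ 2 * ψ x * Complex.exp c * Complex.I_sq
  have hLsq : ∑ i, (L x i : ℂ) ^ 2 = (muOf γ : ℂ) ^ 2 * (‖x‖ : ℂ) ^ 2 := by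
    have h1 : ∑ i, (L x i) ^ 2 = muOf γ ^ 2 * ‖x‖ ^ 2 := by
      have h := N.isSkewComplex hγ
      rw [← EuclideanSpace.real_norm_sq_eq, ← real_inner_self_eq_norm_sq, h.skew, h.sq,
        real_inner_smul_right, real_inner_self_eq_norm_sq]
      ring
    exact_mod_cast h1
  have hγsq : ∑ α, (γ α : ℂ) ^ 2 = (‖γ‖ : ℂ) ^ 2 := by
    exact_mod_cast (EuclideanSpace.real_norm_sq_eq γ).symm
  have hD : ∑ i, (L x i : ℂ) * fderiv ℝ ψ x (basisVec i) = fderiv ℝ ψ x (L x) := by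
    have h1 : L x = ∑ i, L x i • basisVec i := by
      simpa [basisVec] using ((EuclideanSpace.basisFun (Fin k) ℝ).sum_repr (L x)).symm
    conv_rhs => rw [h1]
    simp
  rw [HTypeData.laplacian, Finset.sum_congr rfl fun i _ => hX i,
    Finset.sum_congr rfl fun α _ => hZ α, ← Finset.sum_mul, ← Finset.sum_mul, ← Finset.sum_mul,
    ← Finset.mul_sum, hγsq, Finset.sum_sub_distrib, Finset.sum_add_distrib, ← Finset.mul_sum,
    ← Finset.sum_mul, hLsq, hD, ← laplacian_eq_sum_fderiv hψ]
  simp only [waveFn, glz, ← hc]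
  have hmu : (muOf γ : ℂ) ^ 2 = Real.pi ^ 2 * (‖γ‖ : ℂ) ^ 2 := by
    rw [muOf]; push_cast; ring
  linear_combination 4 * ψ x * Complex.exp c * hmu

end

end ZCrystal
end

open ZCrystal
theorem mainTheorem2 (k l : ℕ) (hk : 0 < k) (N : HTypeData k l)
    (Γ : Submodule ℤ (EuclideanSpace ℝ (Fin l))) [DiscreteTopology Γ] [IsZLattice ℝ Γ]
    (γ : EuclideanSpace ℝ (Fin l)) (hγ : γ ≠ 0) (hΓ : ∀ v ∈ Γ, ∃ j : ℤ, ⟪γ, v⟫_ℝ = j) :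
    -- the operator `◁_μ` is the restriction of the Laplacian of the torus bundle to `W_γ`
    (∀ ψ : EuclideanSpace ℝ (Fin k) → ℂ,
      (∀ v ∈ Γ, ∀ p, waveFn γ ψ (N.mul (0, v) p) = waveFn γ ψ p) ∧
      ∀ x z, ContDiffAt ℝ 2 ψ x →
        N.laplacian (waveFn γ ψ) (x, z) = waveFn γ (glz (N.Jmu γ) (muOf γ) ψ) (x, z)) ∧
    -- the eigenfunctions over a ball
    (∀ R A B : ℝ, 0 < R → ∀ lam : ℂ,
      (∀ (n : ℕ) (m : ℤ) (F : EuclideanSpace ℝ (Fin k) → ℂ),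
        F ∈ ballEigenspace (N.Jmu γ) (muOf γ) R A B lam ⊓ sector (N.Jmu γ) (muOf γ) R n m ↔
          ∃ f ∈ radialEigenspace k (muOf γ) R A B n m lam,
            ∃ P ∈ harmonicSpace (N.Jmu γ) (muOf γ) n m, F = productFn f P) ∧
      (∀ F ∈ ballEigenspace (N.Jmu γ) (muOf γ) R A B lam, ∀ ε : ℝ≥0∞, 0 < ε →
        ∃ G ∈ ⨆ (n : ℕ) (m : ℤ),
          ballEigenspace (N.Jmu γ) (muOf γ) R A B lam ⊓ sector (N.Jmu γ) (muOf γ) R n m,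
          eLpNorm (F - G) 2 volume < ε) ∧
      ∀ (n : ℕ) (m : ℤ), FiniteDimensional ℂ (harmonicSpace (N.Jmu γ) (muOf γ) n m) ∧
        (radialEigenspace k (muOf γ) R A B n m lam ≠ ⊥ →
          Module.rank ℂ ↥(ballEigenspace (N.Jmu γ) (muOf γ) R A B lam ⊓
              sector (N.Jmu γ) (muOf γ) R n m) =
            Module.rank ℂ (harmonicSpace (N.Jmu γ) (muOf γ) n m))) ∧
    -- the explicit eigenfunctions over the whole X-space
    (∀ (r n : ℕ) (m : ℤ),
      (∀ u : Polynomial ℂ,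
        (u.degree = r ∧ ∃ c : ℂ, ∀ t : ℝ,
            radialOp k 1 n m (expRadial 1 u) t = c * expRadial 1 u t) ↔
          ∃ c : ℂ, c ≠ 0 ∧ u = Polynomial.C c * laguerre r ((k : ℝ) / 2 + n - 1)) ∧
      (∀ t : ℝ, radialOp k (muOf γ) n m
          (expRadial (muOf γ) (laguerre r ((k : ℝ) / 2 + n - 1))) t =
        nu k (muOf γ) r n m * expRadial (muOf γ) (laguerre r ((k : ℝ) / 2 + n - 1)) t) ∧
      ∀ P ∈ harmonicSpace (N.Jmu γ) (muOf γ) n m,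
        MemLp (laguerreFn (muOf γ) r n P) 2 volume ∧
        ∀ x, glz (N.Jmu γ) (muOf γ) (laguerreFn (muOf γ) r n P) x =
          nu k (muOf γ) r n m * laguerreFn (muOf γ) r n P x) ∧
    -- the `L²`-spectrum, the eigenspaces and their completeness
    l2Spectrum (N.Jmu γ) (muOf γ) =
      {lam : ℂ | ∃ (r n : ℕ) (m : ℤ), harmonicSpace (N.Jmu γ) (muOf γ) n m ≠ ⊥ ∧
        lam = nu k (muOf γ) r n m} ∧
    (∀ lam : ℂ, l2Eigenspace (N.Jmu γ) (muOf γ) lam =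
      (Submodule.span ℂ {u : Lp ℂ 2 (volume : Measure (EuclideanSpace ℝ (Fin k))) |
        ∃ (r n : ℕ) (m : ℤ), lam = nu k (muOf γ) r n m ∧
          ∃ P ∈ harmonicSpace (N.Jmu γ) (muOf γ) n m,
            u =ᵐ[volume] laguerreFn (muOf γ) r n P}).topologicalClosure) ∧
    (Submodule.span ℂ {u : Lp ℂ 2 (volume : Measure (EuclideanSpace ℝ (Fin k))) |
        ∃ (r n : ℕ) (m : ℤ), ∃ P ∈ harmonicSpace (N.Jmu γ) (muOf γ) n m,
          u =ᵐ[volume] laguerreFn (muOf γ) r n P}).topologicalClosure = ⊤ ∧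
    -- every eigenvalue occurs for infinitely many degrees and has infinite multiplicity
    ∀ lam ∈ l2Spectrum (N.Jmu γ) (muOf γ),
      {n : ℕ | ∃ (r : ℕ) (m : ℤ), harmonicSpace (N.Jmu γ) (muOf γ) n m ≠ ⊥ ∧
        lam = nu k (muOf γ) r n m}.Infinite ∧
      ¬ FiniteDimensional ℂ (l2Eigenspace (N.Jmu γ) (muOf γ) lam) := by
  have h := N.isSkewComplex hγ
  refine ⟨fun ψ => ⟨fun v hv p => waveFn_mul_left N (hΓ v hv) ψ p,
      fun x z hψ => laplacian_waveFn N hγ z hψ⟩,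
    fun R A B hR lam => ⟨fun n m F => mem_ballEigenspace_inf_sector_iff hk h hR n m lam F,
      fun F hF ε hε => exists_eLpNorm_sub_lt hk h hR hF hε,
      fun n m => ⟨inferInstance, rank_ballEigenspace_inf_sector hk h hR n m lam⟩⟩,
    fun r n m => ⟨laguerre_unique hk r n m, radialOp_laguerre r n m _, fun P hP =>
      ⟨laguerreFn_memLp h.pos r n P, glz_laguerreFn h hP⟩⟩,
    l2Spectrum_eq hk h, l2Eigenspace_eq hk h, topologicalClosure_span_laguerreFn hk h,
    fun lam hlam => ?_⟩
  rw [l2Spectrum_eq hk h] at hlam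
  obtain ⟨r, n, m, hne, rfl⟩ := hlam
  obtain ⟨s, hs⟩ := exists_nu_eq_landauLevel h hne r
  rw [hs]
  refine ⟨?_, not_finiteDimensional_l2Eigenspace hk h s⟩
  -- Every degree occurs: with `m = -n` one has `p = 0`, so `r = s` gives the level `s` for each
  -- `n`.
  convert Set.infinite_univ (α := ℕ)
  refine Set.eq_univ_of_forall fun n => ?_
  obtain ⟨P, hP, hP0⟩ := exists_mem_harmonicSpace_neg hk h n
  exact ⟨s, _, (Submodule.ne_bot_iff _).2 ⟨P, hP, hP0⟩, by rw [nu_neg]⟩
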